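/- **Setting.** Fix $T>0$, $Q\in\mathbb N$, $\mathcal Q=\{-Q,\dots,Q\}$, $\sigma>0$, $\gamma>0$, $\Phi,\eta\ge 0$, $\underline\delta<\overline\delta$ and $A=[\underline\delta,\overline\delta]^2$. Let $\Lambda^a,\Lambda^b\in C^1([\underline\delta,\overline\delta])$ with $0\le\Lambda^a,\Lambda^b\le\overline\Lambda$ and derivatives bounded by $L$ in absolute value, and let $\nu$ be a probability measure on $A$ with a Borel density $m$ with respect to Lebesgue measure, $0<m_-\le m\le m_+<\infty$ a.e. on $A$. Put $\Lambda^a_q=\Lambda^a\mathbf 1_{\{q>-Q\}}$, $\Lambda^b_q=\Lambda^b\mathbf 1_{\{q<Q\}}$ and, for $y\in\mathbb R^{\mathcal Q}$, $\delta=(\delta^a,\delta^b)\in A$, $$H_q(y,\delta)=-\eta q^2-\tfrac{\gamma\sigma^2}{2}q^2+\tfrac{\Lambda^a_q(\delta^a)}{\gamma}\bigl(1-e^{-\gamma(\delta^a+y_{q-1}-y_q)}\bigr)+\tfrac{\Lambda^b_q(\delta^b)}{\gamma}\bigl(1-e^{-\gamma(\delta^b+y_{q+1}-y_q)}\bigr)$$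 (the term of a nonexistent neighbour is $0$), $H^0_q(y)=\sup_{\delta\in A}H_q(y,\delta)$ and, for $\lambda>0$, $H^\lambda_q(y)=\lambda\log\int_A e^{H_q(y,\delta)/\lambda}\,\nu(d\delta)$. Let $v^0$ be the solution on $[0,T]$ of $-\dot v^0_q=H^0_q(v^0)$, $v^0_q(T)=-\Phi q^2$. For $h>0$, $\delta\in A$, $\varphi\in\mathbb R^{\mathcal Q}$ let $$C_h^\delta\varphi(q)=-\tfrac1\gamma\log\mathbb E\exp\Bigl(-\gamma\bigl[X_h+q_hS_h+\varphi_{q_h}-\textstyle\int_0^h\eta q_u^2\,du\bigr]\Bigr),$$ where $S=\sigma W$ with $W$ a Brownian motion, $(q_u)$ is a Markov chain on $\mathcal Q$, independent of $W$, with $q_0=q$ and jumps $r\to r-1$ at rate $\Lambda^a_r(\delta^a)$ (counted by $N^a$) and $r\to r+1$ at rate $\Lambda^b_r(\delta^b)$ (counted by $N^b$), and $X_h=\int_0^h(S_r+\delta^a)\,dN^a_r-\int_0^h(S_r-\delta^b)\,dN^b_r$. Let $(T_h^\lambda\varphi)_q=h\lambda\log\int_A e^{C_h^\delta\varphi(q)/(h\lambda)}\,\nu(d\delta)$.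 For $h=T/N$ and $t_n=nh$ put $v^{h,\lambda}_{N,q}=\widehat v^{h,\lambda}_{N,q}=-\Phi q^2$, $v^{h,\lambda}_n=T_h^\lambda v^{h,\lambda}_{n+1}$, $\widehat v^{h,\lambda}_n=\widehat v^{h,\lambda}_{n+1}+hH^\lambda(\widehat v^{h,\lambda}_{n+1})$. For $0\le n\le N-1$ let $\pi^{\rm ex}_{n,q}$ and $\pi^{\rm Ham}_{n,q}$ be the probability measures on $A$ whose densities with respect to $\nu$ are proportional to $\exp\bigl(C_h^\delta(v^{h,\lambda}_{n+1})(q)/(h\lambda)\bigr)$ and $\exp\bigl(H_q(\widehat v^{h,\lambda}_{n+1},\delta)/\lambda\bigr)$, respectively. Let $P_q(\xi^a,\xi^b)=(\mathbf 1_{\{q>-Q\}}\xi^a,\mathbf 1_{\{q<Q\}}\xi^b)$, $\mathcal A^*_q(t)=\operatorname{argmax}_{\delta\in A}H_q(v^0(t),\delta)$ and $\operatorname{dist}_q(\delta,\mathcal A^*_q(t))=\inf_{\delta^*\in\mathcal A^*_q(t)}|P_q(\delta-\delta^*)|$, with $|\cdot|$ the Euclidean norm. **Assumption (active-coordinate quadratic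 growth).** $\mu>0$ is such that for all $t\in[0,T]$, $q\in\mathcal Q$, $\delta\in A$, $$H^0_q(v^0(t))-H_q(v^0(t),\delta)\ \ge\ \tfrac\mu2\operatorname{dist}_q^2(\delta,\mathcal A^*_q(t)).$$ **Corollary (quote concentration).** There are constants $C,h_0,\lambda_0>0$, depending only on $T,Q,\sigma,\gamma,\Phi,\eta,\underline\delta,\overline\delta,\overline\Lambda,L,m_-,m_+,\mu$, such that the following holds for every $h=T/N\le h_0$ ($N\ge1$), every $0<\lambda\le\lambda_0$ and $\pi\in\{\pi^{\rm ex},\pi^{\rm Ham}\}$. 1. For all $0\le n\le N-1$, $t\in[t_n,t_{n+1})$, $q\in\mathcal Q$, the measure $\pi_{n,q}$ is a probability measure, $\operatorname{dist}_q^2(\cdot,\mathcal A^*_q(t))$ is $\pi_{n,q}$-integrable, and $$\int_A\operatorname{dist}_q^2(\delta,\mathcal A^*_q(t))\,\pi_{n,q}(d\delta)\le C\bigl[h+\lambda(1+|\log\lambda|)\bigr].$$ 2. If moreover the active optimizer at $(t,q)$ is unique, i.e. $P_q\mathcal A^*_q(t)$ is a singleton, then for $\delta^*\in\mathcal A^*_q(t)$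 and $\bar\delta^\pi_{n,q}=\int_A\delta\,\pi_{n,q}(d\delta)$, $$\bigl|P_q(\bar\delta^\pi_{n,q}-\delta^*)\bigr|^2\le C\bigl[h+\lambda(1+|\log\lambda|)\bigr].$$ 3. Suppose the active optimizer is unique for all $t\in[0,T]$, $q\in\mathcal Q$. Then there is a selector $\delta^*_q(t)\in\mathcal A^*_q(t)$ that is Borel measurable in $t\in[0,T]$ and whose inactive coordinates equal $\underline\delta$; and for every selector $\delta^*_q(t)\in\mathcal A^*_q(t)$ the map $t\mapsto P_q\delta^*_q(t)$ is Borel measurable on $[0,T]$ and, with $\bar\delta^\pi_{h,\lambda}(t,q)=\bar\delta^\pi_{n,q}$ for $t\in[t_n,t_{n+1})$, the integrands below are integrable and $$\sum_{q\in\mathcal Q}\int_0^T\bigl|P_q(\bar\delta^\pi_{h,\lambda}(t,q)-\delta^*_q(t))\bigr|^2dt\le C\bigl[h+\lambda(1+|\log\lambda|)\bigr].$$ -/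

import Mathlib

open MeasureTheory ProbabilityTheory Set
open scoped ENNReal NNReal

namespace MarketMaking

noncomputable section

/-- The scalar data of the model, together with the bounds on which constants may depend:
horizon `T`, inventory cap `Q`, volatility `σ`, risk aversion `γ`, terminal and running inventory
penalties `Φ`, `η`, quote interval `[lo, hi]`, intensity bound `Λbar`, density bounds `mlo`, `mhi`
and a bound `L` for the derivatives of the intensities. -/
structure Params where
  T : ℝ
  Q : ℕ
  σ : ℝ
  γ : ℝ
  Φ : ℝ
  η : ℝ
  lo : ℝ
  hi : ℝ
  Λbar : ℝ
  mlo : ℝ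
  mhi : ℝ
  L : ℝ
  T_pos : 0 < T
  σ_pos : 0 < σ
  γ_pos : 0 < γ
  Φ_nonneg : 0 ≤ Φ
  η_nonneg : 0 ≤ η
  lo_lt_hi : lo < hi
  mlo_pos : 0 < mlo

/-- Quotes `δ = (δᵃ, δᵇ)` in the Euclidean plane: `δ 0` is the ask, `δ 1` the bid coordinate. -/
abbrev Quote : Type := EuclideanSpace ℝ (Fin 2)

/-- The inventory set `{-Q, …, Q}`. -/
abbrev Inv (Q : ℕ) : Type := Icc (-(Q : ℤ)) (Q : ℤ)

theorem neg_le_self_cast (Q : ℕ) : -(Q : ℤ) ≤ (Q : ℤ) := by omega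

/-- The neighbour `q - 1`; its value at `q = -Q` is never used. -/
def Inv.down {Q : ℕ} (q : Inv Q) : Inv Q :=
  projIcc (-(Q : ℤ)) (Q : ℤ) (neg_le_self_cast Q) ((q : ℤ) - 1)

/-- The neighbour `q + 1`; its value at `q = Q` is never used. -/
def Inv.up {Q : ℕ} (q : Inv Q) : Inv Q :=
  projIcc (-(Q : ℤ)) (Q : ℤ) (neg_le_self_cast Q) ((q : ℤ) + 1)

/-- The ask side is active at inventory `q` (selling one unit stays in the inventory set). -/
def Inv.AskActive {Q : ℕ} (q : Inv Q) : Prop := -(Q : ℤ) < (q : ℤ)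

/-- The bid side is active at inventory `q`. -/
def Inv.BidActive {Q : ℕ} (q : Inv Q) : Prop := (q : ℤ) < (Q : ℤ)

instance {Q : ℕ} (q : Inv Q) : Decidable q.AskActive :=
  inferInstanceAs (Decidable (-(Q : ℤ) < (q : ℤ)))

instance {Q : ℕ} (q : Inv Q) : Decidable q.BidActive :=
  inferInstanceAs (Decidable ((q : ℤ) < (Q : ℤ)))

/-- The quote rectangle `A = [lo, hi]²`. -/
def Params.A (p : Params) : Set Quote := {δ | ∀ i, δ i ∈ Icc p.lo p.hi}

/-- The functional data of the model: the two fill intensities, of class `C¹` on `[lo, hi]`, and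
the density `m` of the reference law with respect to Lebesgue measure on `A`. -/
structure Market (p : Params) where
  Λa : ℝ → ℝ
  Λb : ℝ → ℝ
  contDiffOn_Λa : ContDiffOn ℝ 1 Λa (Icc p.lo p.hi)
  contDiffOn_Λb : ContDiffOn ℝ 1 Λb (Icc p.lo p.hi)
  Λa_mem : ∀ x ∈ Icc p.lo p.hi, Λa x ∈ Icc 0 p.Λbar
  Λb_mem : ∀ x ∈ Icc p.lo p.hi, Λb x ∈ Icc 0 p.Λbar
  deriv_Λa_le : ∀ x ∈ Icc p.lo p.hi, |derivWithin Λa (Icc p.lo p.hi) x| ≤ p.L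
  deriv_Λb_le : ∀ x ∈ Icc p.lo p.hi, |derivWithin Λb (Icc p.lo p.hi) x| ≤ p.L
  m : Quote → ℝ
  measurable_m : Measurable m
  m_mem : ∀ᵐ δ ∂(volume.restrict p.A), m δ ∈ Icc p.mlo p.mhi
  isProbabilityMeasure :
    IsProbabilityMeasure ((volume.restrict p.A).withDensity fun δ => ENNReal.ofReal (m δ))

namespace Market

variable {p : Params}

/-- The reference probability measure `ν` on `A`. -/
def ν (M : Market p) : Measure Quote :=
  (volume.restrict p.A).withDensity fun δ => ENNReal.ofReal (M.m δ)

/-- The ask intensity with the inventory constraint. -/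
def askRate (M : Market p) (q : Inv p.Q) (δ : Quote) : ℝ := if q.AskActive then M.Λa (δ 0) else 0

/-- The bid intensity with the inventory constraint. -/
def bidRate (M : Market p) (q : Inv p.Q) (δ : Quote) : ℝ := if q.BidActive then M.Λb (δ 1) else 0

/-- The value increment at an ask fill. -/
def askIncr (_M : Market p) (q : Inv p.Q) (y : Inv p.Q → ℝ) (δ : Quote) : ℝ :=
  if q.AskActive then δ 0 + y q.down - y q else 0

/-- The value increment at a bid fill. -/
def bidIncr (_M : Market p) (q : Inv p.Q) (y : Inv p.Q → ℝ) (δ : Quote) : ℝ :=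
  if q.BidActive then δ 1 + y q.up - y q else 0

/-- The deterministic-action Hamiltonian `H_q(y, δ)`. -/
def H (M : Market p) (q : Inv p.Q) (y : Inv p.Q → ℝ) (δ : Quote) : ℝ :=
  -p.η * (q : ℝ) ^ 2 - p.γ * p.σ ^ 2 / 2 * (q : ℝ) ^ 2
    + M.askRate q δ / p.γ * (1 - Real.exp (-p.γ * M.askIncr q y δ))
    + M.bidRate q δ / p.γ * (1 - Real.exp (-p.γ * M.bidIncr q y δ))

/-- The hard Hamiltonian, the supremum of `H_q(y, ·)` over `A`. -/
def H0 (M : Market p) (q : Inv p.Q) (y : Inv p.Q → ℝ) : ℝ := sSup (M.H q y '' p.A)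

/-- The soft (log-sum-exp) Hamiltonian at temperature `lam`. -/
def Hsoft (M : Market p) (lam : ℝ) (q : Inv p.Q) (y : Inv p.Q → ℝ) : ℝ :=
  lam * Real.log (∫ δ, Real.exp (M.H q y δ / lam) ∂M.ν)

/-- The terminal reduced value `-Φ q²`. -/
def terminal (_M : Market p) (q : Inv p.Q) : ℝ := -p.Φ * (q : ℝ) ^ 2

/-- `v` is the hard reduced value: on `[0, T]` it solves the backward system
`-v̇_q(t) = H⁰_q(v(t))` with `v_q(T) = -Φ q²`. -/
structure IsHardValue (M : Market p) (v : ℝ → Inv p.Q → ℝ) : Prop where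
  hasDerivWithinAt : ∀ t ∈ Icc 0 p.T, ∀ q,
    HasDerivWithinAt (fun s => v s q) (-M.H0 q (v t)) (Icc 0 p.T) t
  terminal_eq : ∀ q, v p.T q = M.terminal q

end Market

/-- The two kinds of fills. -/
inductive Side
  | ask
  | bid

/-- A probability space carrying a Brownian motion `W` and, independently of it, a family of
i.i.d. standard exponential clocks, two (ask and bid) for each jump of an inventory chain. -/
structure Noise (Ω : Type*) [MeasurableSpace Ω] (P : Measure Ω) where
  W : ℝ≥0 → Ω → ℝ
  clock : Side × ℕ → Ω → ℝ
  measurable_W : ∀ t, Measurable (W t)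
  measurable_clock : ∀ i, Measurable (clock i)
  isBrownian : IsBrownianReal W P
  hasLaw_clock : ∀ i, HasLaw (clock i) (expMeasure 1) P
  iIndepFun_clock : iIndepFun clock P
  indepFun : IndepFun (fun ω i => clock i ω) (fun ω t => W t ω) P

/-- The waiting time of an exponential clock running at rate `r`, given a standard exponential
value `e`; a clock of rate `0` never rings. -/
def waitingTime (r e : ℝ) : ℝ≥0∞ := if r = 0 then ∞ else ENNReal.ofReal (e / r)

section FixedQuote

/-! The canonical system with the quote `δ` frozen and `X₀ = S₀ = 0`, started from inventory `q`.
In state `r` an ask clock of rate `Λᵃ_r(δᵃ)` and a bid clock of rate `Λᵇ_r(δᵇ)` run; if the ask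
clock rings first the chain moves to `r - 1`, otherwise to `r + 1`, and the clocks are renewed. -/

variable {p : Params} (M : Market p) {Ω : Type*} [MeasurableSpace Ω] {P : Measure Ω}
  (B : Noise Ω P) (δ : Quote) (q : Inv p.Q)

/-- Time until the ask clock rings in state `r`, after `k` jumps. -/
def askWait (k : ℕ) (r : Inv p.Q) (ω : Ω) : ℝ≥0∞ :=
  waitingTime (M.askRate r δ) (B.clock (Side.ask, k) ω)

/-- Time until the bid clock rings in state `r`, after `k` jumps. -/
def bidWait (k : ℕ) (r : Inv p.Q) (ω : Ω) : ℝ≥0∞ :=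
  waitingTime (M.bidRate r δ) (B.clock (Side.bid, k) ω)

/-- The side of the jump number `k + 1` when it leaves state `r`. -/
def nextSide (k : ℕ) (r : Inv p.Q) (ω : Ω) : Side :=
  if askWait M B δ k r ω ≤ bidWait M B δ k r ω then Side.ask else Side.bid

/-- The state after `k` jumps and the time of the jump number `k` (time `0` for `k = 0`,
time `∞` if there is no such jump). -/
def jumpChain (ω : Ω) : ℕ → Inv p.Q × ℝ≥0∞
  | 0 => (q, 0)
  | k + 1 =>
    let s := jumpChain ω k
    (match nextSide M B δ k s.1 ω with
      | Side.ask => s.1.down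
      | Side.bid => s.1.up,
     s.2 + min (askWait M B δ k s.1 ω) (bidWait M B δ k s.1 ω))

/-- The state after `k` jumps. -/
def stateAfter (k : ℕ) (ω : Ω) : Inv p.Q := (jumpChain M B δ q ω k).1

/-- The time of the jump number `k`. -/
def jumpTime (k : ℕ) (ω : Ω) : ℝ≥0∞ := (jumpChain M B δ q ω k).2

/-- The side of the jump number `k + 1`. -/
def jumpSide (k : ℕ) (ω : Ω) : Side := nextSide M B δ k (stateAfter M B δ q k ω) ω

/-- The number of fills up to time `u`. -/
def fillCount (u : ℝ) (ω : Ω) : ℕ := {k : ℕ | jumpTime M B δ q (k + 1) ω ≤ ENNReal.ofReal u}.ncard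

/-- The inventory `q_u`. -/
def inventory (u : ℝ) (ω : Ω) : Inv p.Q := stateAfter M B δ q (fillCount M B δ q u ω) ω

/-- The midprice `S_u = σ W_u`. -/
def midprice (p : Params) {Ω : Type*} [MeasurableSpace Ω] {P : Measure Ω} (B : Noise Ω P)
    (u : ℝ≥0) (ω : Ω) : ℝ := p.σ * B.W u ω

/-- The cash `X_u = ∫ (S_r + δᵃ) dNᵃ_r - ∫ (S_r - δᵇ) dNᵇ_r` over `(0, u]`, as a sum over fills. -/
def cash (u : ℝ) (ω : Ω) : ℝ :=
  ∑ k ∈ Finset.range (fillCount M B δ q u ω),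
    match jumpSide M B δ q k ω with
    | Side.ask => midprice p B (jumpTime M B δ q (k + 1) ω).toNNReal ω + δ 0
    | Side.bid => -(midprice p B (jumpTime M B δ q (k + 1) ω).toNNReal ω - δ 1)

/-- The reward `F_φ(X_h, S_h, q_h) - ∫₀ʰ η q_u² du` with `F_φ(x, s, q) = x + q s + φ_q`. -/
def reward (h : ℝ) (φ : Inv p.Q → ℝ) (ω : Ω) : ℝ :=
  cash M B δ q h ω + (inventory M B δ q h ω : ℝ) * midprice p B h.toNNReal ω
    + φ (inventory M B δ q h ω) - ∫ u in (0 : ℝ)..h, p.η * (inventory M B δ q u ω : ℝ) ^ 2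

/-- The one-step certainty-equivalent score `C_h^δ φ(q)`. -/
def score (h : ℝ) (φ : Inv p.Q → ℝ) : ℝ :=
  -(1 / p.γ) * Real.log (∫ ω, Real.exp (-p.γ * reward M B δ q h φ ω) ∂P)

end FixedQuote

section Policies

variable {p : Params} (M : Market p) {Ω : Type*} [MeasurableSpace Ω] {P : Measure Ω}
  (B : Noise Ω P)

/-- The discrete entropy-regularized Bellman operator `T_h^lam`. -/
def bellman (h lam : ℝ) (φ : Inv p.Q → ℝ) (q : Inv p.Q) : ℝ :=
  h * lam * Real.log (∫ δ, Real.exp (score M B δ q h φ / (h * lam)) ∂M.ν)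

/-- The time step `h = T / N`. -/
def step (p : Params) (N : ℕ) : ℝ := p.T / N

/-- The exact discrete value: `v_N = -Φ q²` and `v_n = T_h^lam v_{n+1}` for `n < N`. -/
def exactValue (N : ℕ) (lam : ℝ) (n : ℕ) : Inv p.Q → ℝ :=
  (bellman M B (step p N) lam)^[N - n] M.terminal

/-- The soft Euler approximation: `v_N = -Φ q²` and `v_n = v_{n+1} + h H^lam(v_{n+1})`. -/
def eulerValue (N : ℕ) (lam : ℝ) (n : ℕ) : Inv p.Q → ℝ :=
  (fun y q => y q + step p N * M.Hsoft lam q y)^[N - n] M.terminal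

/-- The exact Bellman Gibbs policy: `dπ/dν` is proportional to `exp (C_h^δ(v_{n+1})(q) / (h lam))`. -/
def exactGibbs (N : ℕ) (lam : ℝ) (n : ℕ) (q : Inv p.Q) : Measure Quote :=
  M.ν.tilted fun δ => score M B δ q (step p N) (exactValue M B N lam (n + 1)) / (step p N * lam)

/-- The Hamiltonian-Gibbs proxy: `dπ/dν` is proportional to `exp (H_q(v_{n+1}, δ) / lam)`, where
`v` is the soft Euler approximation. -/
def hamGibbs (N : ℕ) (lam : ℝ) (n : ℕ) (q : Inv p.Q) : Measure Quote :=
  M.ν.tilted fun δ => M.H q (eulerValue M N lam (n + 1)) δ / lam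

/-- The mean quote of a discrete kernel. -/
def meanQuote {Q : ℕ} (π : ℕ → Inv Q → Measure Quote) (n : ℕ) (q : Inv Q) : Quote :=
  ∫ δ, δ ∂(π n q)

/-- The piecewise constant mean quote: its value on `[n h, (n + 1) h)` is the mean quote of the
kernel number `n`. -/
def meanQuotePath (p : Params) (N : ℕ) (π : ℕ → Inv p.Q → Measure Quote) (t : ℝ) (q : Inv p.Q) :
    Quote :=
  meanQuote π ⌊t / step p N⌋₊ q

end Policies

section Concentration

/-- The active projection `P_q`, which deletes the inactive coordinates. -/
def activeProj {Q : ℕ} (q : Inv Q) (ξ : Quote) : Quote :=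
  !₂[if q.AskActive then ξ 0 else 0, if q.BidActive then ξ 1 else 0]

variable {p : Params} (M : Market p)

/-- The set of maximizers over `A` of `H_q(y, ·)`. -/
def optimalQuotes (q : Inv p.Q) (y : Inv p.Q → ℝ) : Set Quote :=
  {δ | δ ∈ p.A ∧ IsMaxOn (M.H q y) p.A δ}

/-- The active-coordinate (Euclidean) distance of `δ` to a set `S` of quotes. -/
def activeDist {Q : ℕ} (q : Inv Q) (δ : Quote) (S : Set Quote) : ℝ :=
  sInf ((fun δ' => ‖activeProj q (δ - δ')‖) '' S)

/-- Active-coordinate quadratic growth with constant `μ` along the trajectory `v`. -/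
def QuadraticGrowth (v : ℝ → Inv p.Q → ℝ) (μ : ℝ) : Prop :=
  ∀ t ∈ Icc 0 p.T, ∀ q, ∀ δ ∈ p.A,
    μ / 2 * activeDist q δ (optimalQuotes M q (v t)) ^ 2 ≤ M.H0 q (v t) - M.H q (v t) δ

/-- The active optimizer at inventory `q` and value vector `y` is unique. -/
def UniqueActiveOptimizer (q : Inv p.Q) (y : Inv p.Q → ℝ) : Prop :=
  ∃! ξ : Quote, ξ ∈ activeProj q '' optimalQuotes M q y

/-- The error scale `h + lam (1 + |log lam|)`. -/
def rate (h lam : ℝ) : ℝ := h + lam * (1 + |Real.log lam|)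

end Concentration

end

end MarketMaking

/-!
The optimality gap `H0_q(v(t)) - H_q(v(t), δ)` has mean of order `h + lam (1 + |log lam|)` under both
Gibbs policies; quadratic growth turns this into a bound for the squared active distance.

*One-step expansion.* For a fixed quote the score is `φ_q + h H_q(φ, δ) + O(h²)`, uniformly on
bounded sets of `φ` (`exists_abs_score_sub_le`). With the clocks frozen, summation by parts writes
cash plus marked inventory as spreads plus the integral of the inventory against the price, a
Gaussian variable. Integrating it out leaves a factor between `1` and `exp (κ Q² h)`, which is
`exp (κ q² h)` when there is no fill (`exists_lintegral_exp_pathReward`). Since `n` fills up to time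
`h` have probability at most `(2 Λ h) ^ n` (`Noise.measure_pathTime_le`), the exponential moment is
determined up to `O(h²)` by the events of no fill and of one fill (`expMoment_le`,
`le_expMoment_add`).

*Soft against hard maximum.* The reference measure gives mass of order `lam²` to a square of side
of order `lam` at a maximizer, so the soft Hamiltonian is below the hard one by at most a multiple
of `lam (1 + |log lam|)` (`exists_laplace`).

*Convergence of the values.* The substitution `w = exp (-γ v)` and Grönwall's inequality bound the
hard value by a constant that depends on the parameters only (`exists_hardValue_bound`). On a
neighbourhood of this bounded set the Hamiltonian is Lipschitz (`exists_H_bounds`), and both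
one-step maps are consistent with it, so the discrete values converge at the stated rate
(`abs_iterate_sub_le`).

*Concentration.* By the Gibbs variational inequality (`lse_le_integral_tilted`) the mean of the
exponent under its Gibbs measure is at least its log-sum-exp. As both exponents are uniformly close
to `H_q(v(t), ·)` up to a constant, the mean optimality gap is small (`integral_gap_le`,
`exists_integral_gap_le`). Jensen's inequality gives the bound for the mean quote, and quadratic
growth makes a unique active optimizer Hölder continuous in time
(`continuous_activeProj_selector`), hence measurable.

The Gibbs measures are probability measures only if the score is measurable in the quote. For this
the reward is written as a jointly measurable function of intensities, quote, clocks and path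
(`measurable_pathReward`), where the path is evaluated through its values at grid points
(`gridEval`).
-/

namespace MarketMaking

noncomputable section

/-! ### The inventory chain as a function of its rates and clocks -/

/-- A function with values in a countable discrete space may be substituted for a parameter of a
family of measurable functions. -/
theorem measurable_comp_countable {X β γ : Type*} [MeasurableSpace X] [MeasurableSpace β]
    [MeasurableSpace γ] [Countable β] [MeasurableSingletonClass β] {f : X → β} {g : β → X → γ}
    (hf : Measurable f) (hg : ∀ b, Measurable (g b)) : Measurable fun x => g (f x) x :=
  (measurable_from_prod_countable_right (f := fun z : β × X => g z.1 z.2) hg).comp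
    (hf.prodMk measurable_id)

section Chain

variable {Q : ℕ}

/-- Waiting time of the ask clock number `k` in state `r` when the ask intensity is `a`. -/
def pathAskWait (a : ℝ) (c : Side × ℕ → ℝ) (k : ℕ) (r : Inv Q) : ℝ≥0∞ :=
  waitingTime (if r.AskActive then a else 0) (c (Side.ask, k))

/-- Waiting time of the bid clock number `k` in state `r` when the bid intensity is `b`. -/
def pathBidWait (b : ℝ) (c : Side × ℕ → ℝ) (k : ℕ) (r : Inv Q) : ℝ≥0∞ :=
  waitingTime (if r.BidActive then b else 0) (c (Side.bid, k))

/-- The chain of states and jump times, as a function of the intensities `a`, `b` and of the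
values `c` of the clocks. -/
def pathChain (a b : ℝ) (q : Inv Q) (c : Side × ℕ → ℝ) : ℕ → Inv Q × ℝ≥0∞
  | 0 => (q, 0)
  | k + 1 =>
    let s := pathChain a b q c k
    (if pathAskWait a c k s.1 ≤ pathBidWait b c k s.1 then s.1.down else s.1.up,
     s.2 + min (pathAskWait a c k s.1) (pathBidWait b c k s.1))

/-- The state after `k` jumps. -/
def pathState (a b : ℝ) (q : Inv Q) (c : Side × ℕ → ℝ) (k : ℕ) : Inv Q := (pathChain a b q c k).1

/-- The time of the jump number `k`. -/
def pathTime (a b : ℝ) (q : Inv Q) (c : Side × ℕ → ℝ) (k : ℕ) : ℝ≥0∞ := (pathChain a b q c k).2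

/-- The jump number `k + 1` is an ask fill. -/
def PathAsk (a b : ℝ) (q : Inv Q) (c : Side × ℕ → ℝ) (k : ℕ) : Prop :=
  pathAskWait a c k (pathState a b q c k) ≤ pathBidWait b c k (pathState a b q c k)

instance (a b : ℝ) (q : Inv Q) (c : Side × ℕ → ℝ) (k : ℕ) : Decidable (PathAsk a b q c k) :=
  inferInstanceAs (Decidable (_ ≤ _))

/-- The number of fills up to time `u`. -/
def pathCount (a b : ℝ) (q : Inv Q) (c : Side × ℕ → ℝ) (u : ℝ) : ℕ :=
  {k : ℕ | pathTime a b q c (k + 1) ≤ ENNReal.ofReal u}.ncard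

/-- The inventory at time `u`. -/
def pathInv (a b : ℝ) (q : Inv Q) (c : Side × ℕ → ℝ) (u : ℝ) : Inv Q :=
  pathState a b q c (pathCount a b q c u)

variable (a b : ℝ) (q : Inv Q) (c : Side × ℕ → ℝ)

theorem pathState_succ (k : ℕ) : pathState a b q c (k + 1) =
    if PathAsk a b q c k then (pathState a b q c k).down else (pathState a b q c k).up := rfl

theorem pathTime_succ (k : ℕ) : pathTime a b q c (k + 1) = pathTime a b q c k +
    min (pathAskWait a c k (pathState a b q c k)) (pathBidWait b c k (pathState a b q c k)) := rfl

@[simp] theorem pathState_zero : pathState a b q c 0 = q := rfl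

@[simp] theorem pathTime_zero : pathTime a b q c 0 = 0 := rfl

theorem pathTime_mono : Monotone (pathTime a b q c) :=
  monotone_nat_of_le_succ fun k => by rw [pathTime_succ]; exact le_self_add

theorem pathCount_eq {u : ℝ} {n : ℕ} (h1 : pathTime a b q c n ≤ ENNReal.ofReal u)
    (h2 : ENNReal.ofReal u < pathTime a b q c (n + 1)) : pathCount a b q c u = n := by
  have : {k : ℕ | pathTime a b q c (k + 1) ≤ ENNReal.ofReal u} = (Finset.range n : Set ℕ) := by
    ext k
    simp only [mem_ofPred_eq, Finset.coe_range, mem_Iio]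
    constructor
    · intro hk
      by_contra! hn
      exact absurd (h2.trans_le (pathTime_mono a b q c (by omega : n + 1 ≤ k + 1))) (by simpa using hk)
    · intro hk
      exact (pathTime_mono a b q c (by omega : k + 1 ≤ n)).trans h1
  rw [pathCount, this, Set.ncard_coe_finset, Finset.card_range]

theorem pathCount_eq_succ_iff {u : ℝ} {n : ℕ} : pathCount a b q c u = n + 1 ↔
    pathTime a b q c (n + 1) ≤ ENNReal.ofReal u ∧
      ENNReal.ofReal u < pathTime a b q c (n + 2) := by
  refine ⟨fun h => ?_, fun h => pathCount_eq a b q c h.1 h.2⟩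
  set S := {k : ℕ | pathTime a b q c (k + 1) ≤ ENNReal.ofReal u} with hS
  have hlow : ∀ k ∈ S, ∀ j ≤ k, j ∈ S := fun k hk j hj =>
    (pathTime_mono a b q c (by omega : j + 1 ≤ k + 1)).trans hk
  have hcard : S.ncard = n + 1 := h
  have hfin : S.Finite := Set.finite_of_ncard_ne_zero (by omega)
  constructor
  · by_contra hn
    have : S ⊆ (Finset.range n : Set ℕ) := fun k hk => by
      simp only [Finset.coe_range, mem_Iio]
      by_contra! hkn
      exact hn (hlow k hk n hkn)
    have := Set.ncard_le_ncard this (Finset.finite_toSet _)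
    rw [Set.ncard_coe_finset, Finset.card_range] at this
    omega
  · by_contra! hn
    have : (Finset.range (n + 2) : Set ℕ) ⊆ S := fun k hk => by
      simp only [Finset.coe_range, mem_Iio] at hk
      exact hlow (n + 1) hn k (by omega)
    have := Set.ncard_le_ncard this hfin
    rw [Set.ncard_coe_finset, Finset.card_range] at this
    omega

section Measurability

variable {X : Type*} [MeasurableSpace X] {a b : X → ℝ} {c : X → Side × ℕ → ℝ}

theorem measurable_waitingTime : Measurable fun z : ℝ × ℝ => waitingTime z.1 z.2 := by
  unfold waitingTime
  exact Measurable.ite (measurableSet_eq_fun measurable_fst measurable_const) measurable_const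
    (by fun_prop)

theorem measurable_pathAskWait (ha : Measurable a) (hc : Measurable c) (k : ℕ) (r : Inv Q) :
    Measurable fun x => pathAskWait (a x) (c x) k r := by
  by_cases hr : r.AskActive <;> simp only [pathAskWait, hr, if_true, if_false] <;>
    exact measurable_waitingTime.comp (Measurable.prodMk (by fun_prop)
      ((measurable_pi_apply _).comp hc))

theorem measurable_pathBidWait (hb : Measurable b) (hc : Measurable c) (k : ℕ) (r : Inv Q) :
    Measurable fun x => pathBidWait (b x) (c x) k r := by
  by_cases hr : r.BidActive <;> simp only [pathBidWait, hr, if_true, if_false] <;>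
    exact measurable_waitingTime.comp (Measurable.prodMk (by fun_prop)
      ((measurable_pi_apply _).comp hc))

theorem measurable_pathState_pathTime (ha : Measurable a) (hb : Measurable b) (hc : Measurable c)
    (k : ℕ) : Measurable (fun x => pathState (a x) (b x) q (c x) k) ∧
      Measurable fun x => pathTime (a x) (b x) q (c x) k := by
  induction k with
  | zero => exact ⟨measurable_const, measurable_const⟩
  | succ k ih =>
    have hA : Measurable fun x => pathAskWait (a x) (c x) k (pathState (a x) (b x) q (c x) k) :=
      measurable_comp_countable (g := fun r x => pathAskWait (a x) (c x) k r) ih.1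
        (measurable_pathAskWait ha hc k)
    have hB : Measurable fun x => pathBidWait (b x) (c x) k (pathState (a x) (b x) q (c x) k) :=
      measurable_comp_countable (g := fun r x => pathBidWait (b x) (c x) k r) ih.1
        (measurable_pathBidWait hb hc k)
    refine ⟨?_, ?_⟩
    · simp only [pathState_succ]
      refine Measurable.ite (measurableSet_le hA hB) ?_ ?_
      · exact (measurable_of_countable (fun r : Inv Q => r.down)).comp ih.1
      · exact (measurable_of_countable (fun r : Inv Q => r.up)).comp ih.1
    · simp only [pathTime_succ]
      exact ih.2.add (hA.min hB)

theorem measurable_pathState (ha : Measurable a) (hb : Measurable b) (hc : Measurable c)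
    (k : ℕ) : Measurable fun x => pathState (a x) (b x) q (c x) k :=
  (measurable_pathState_pathTime q ha hb hc k).1

theorem measurable_pathTime (ha : Measurable a) (hb : Measurable b) (hc : Measurable c)
    (k : ℕ) : Measurable fun x => pathTime (a x) (b x) q (c x) k :=
  (measurable_pathState_pathTime q ha hb hc k).2

theorem measurableSet_pathAsk (ha : Measurable a) (hb : Measurable b) (hc : Measurable c)
    (k : ℕ) : MeasurableSet {x | PathAsk (a x) (b x) q (c x) k} :=
  measurableSet_le
    (measurable_comp_countable (g := fun r x => pathAskWait (a x) (c x) k r)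
      (measurable_pathState q ha hb hc k) (measurable_pathAskWait ha hc k))
    (measurable_comp_countable (g := fun r x => pathBidWait (b x) (c x) k r)
      (measurable_pathState q ha hb hc k) (measurable_pathBidWait hb hc k))

theorem measurable_pathCount {u : X → ℝ} (ha : Measurable a) (hb : Measurable b)
    (hc : Measurable c) (hu : Measurable u) :
    Measurable fun x => pathCount (a x) (b x) q (c x) (u x) := by
  have hsucc : ∀ n, MeasurableSet {x | pathCount (a x) (b x) q (c x) (u x) = n + 1} := fun n => by
    simp only [pathCount_eq_succ_iff]
    exact (measurableSet_le (measurable_pathTime q ha hb hc _) hu.ennreal_ofReal).inter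
      (measurableSet_lt hu.ennreal_ofReal (measurable_pathTime q ha hb hc _))
  refine measurable_to_countable' fun n => ?_
  cases n with
  | succ n => exact hsucc n
  | zero =>
    have : (fun x => pathCount (a x) (b x) q (c x) (u x)) ⁻¹' {0}
        = (⋃ n, {x | pathCount (a x) (b x) q (c x) (u x) = n + 1})ᶜ := by
      ext x
      simp only [mem_preimage, mem_singleton_iff, mem_compl_iff, mem_iUnion, mem_ofPred_eq,
        not_exists]
      constructor
      · intro h n; omega
      · intro h
        by_contra hn
        exact h _ (Nat.succ_pred_eq_of_ne_zero hn).symm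
    rw [this]
    exact (MeasurableSet.iUnion hsucc).compl

theorem measurable_pathInv {u : X → ℝ} (ha : Measurable a) (hb : Measurable b)
    (hc : Measurable c) (hu : Measurable u) :
    Measurable fun x => pathInv (a x) (b x) q (c x) (u x) :=
  measurable_comp_countable (g := fun k x => pathState (a x) (b x) q (c x) k)
    (measurable_pathCount q ha hb hc hu) (measurable_pathState q ha hb hc)

end Measurability

end Chain

/-! ### The reward as a function of clocks and price path -/

/-- The reward as a function of the intensities `a`, `b`, the quote `δ`, the clocks `c` and the
Brownian path `s`. -/
def pathReward (p : Params) (a b : ℝ) (δ : Quote) (q : Inv p.Q) (h : ℝ) (φ : Inv p.Q → ℝ)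
    (c : Side × ℕ → ℝ) (s : ℝ≥0 → ℝ) : ℝ :=
  (∑ k ∈ Finset.range (pathCount a b q c h),
    if PathAsk a b q c k then p.σ * s (pathTime a b q c (k + 1)).toNNReal + δ 0
    else -(p.σ * s (pathTime a b q c (k + 1)).toNNReal - δ 1))
  + (pathInv a b q c h : ℝ) * (p.σ * s h.toNNReal) + φ (pathInv a b q c h)
  - ∫ u in (0 : ℝ)..h, p.η * (pathInv a b q c u : ℝ) ^ 2

section Identification

variable {p : Params} (M : Market p) {Ω : Type*} [MeasurableSpace Ω] {P : Measure Ω}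
  (B : Noise Ω P) (δ : Quote) (q : Inv p.Q)

theorem jumpChain_eq_pathChain (ω : Ω) (k : ℕ) : jumpChain M B δ q ω k =
    pathChain (M.Λa (δ 0)) (M.Λb (δ 1)) q (fun i => B.clock i ω) k := by
  induction k with
  | zero => rfl
  | succ k ih =>
    simp only [jumpChain, pathChain, ih]
    congr 1
    simp only [nextSide, askWait, bidWait, pathAskWait, pathBidWait, Market.askRate,
      Market.bidRate]
    split_ifs <;> rfl

/-- The reward depends on the sample point only through the clocks and the price path. -/
theorem reward_eq_pathReward (h : ℝ) (φ : Inv p.Q → ℝ) (ω : Ω) : reward M B δ q h φ ω =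
    pathReward p (M.Λa (δ 0)) (M.Λb (δ 1)) δ q h φ (fun i => B.clock i ω) (fun t => B.W t ω) := by
  have hst : ∀ k, stateAfter M B δ q k ω =
      pathState (M.Λa (δ 0)) (M.Λb (δ 1)) q (fun i => B.clock i ω) k := fun k => by
    rw [stateAfter, jumpChain_eq_pathChain]; rfl
  have hti : ∀ k, jumpTime M B δ q k ω =
      pathTime (M.Λa (δ 0)) (M.Λb (δ 1)) q (fun i => B.clock i ω) k := fun k => by
    rw [jumpTime, jumpChain_eq_pathChain]; rfl
  have hco : ∀ u, fillCount M B δ q u ω =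
      pathCount (M.Λa (δ 0)) (M.Λb (δ 1)) q (fun i => B.clock i ω) u := fun u => by
    simp only [fillCount, pathCount, hti]
  have hin : ∀ u, inventory M B δ q u ω =
      pathInv (M.Λa (δ 0)) (M.Λb (δ 1)) q (fun i => B.clock i ω) u := fun u => by
    rw [inventory, pathInv, hst, hco]
  simp only [reward, pathReward, hin, cash, hco, hti, midprice]
  congr 3
  refine Finset.sum_congr rfl fun k _ => ?_
  have : jumpSide M B δ q k ω = if PathAsk (M.Λa (δ 0)) (M.Λb (δ 1)) q (fun i => B.clock i ω) k
      then Side.ask else Side.bid := by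
    simp only [jumpSide, nextSide, hst]
    rfl
  rw [this]
  split_ifs <;> rfl

end Identification

/-- Evaluation of a path as the limit of its values at grid points: it agrees with the ordinary
evaluation of continuous paths, and it is jointly measurable in time and path, which the ordinary
evaluation on the space of all paths is not. -/
def gridEval (w : ℝ≥0 → ℝ) (t : ℝ≥0) : ℝ :=
  Filter.limUnder Filter.atTop fun m : ℕ => w ((⌈(t : ℝ) * (m + 1)⌉₊ : ℝ≥0) / (m + 1))

theorem gridEval_eq {w : ℝ≥0 → ℝ} (hw : Continuous w) (t : ℝ≥0) : gridEval w t = w t := by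
  refine Filter.Tendsto.limUnder_eq
    (g := fun m : ℕ => w ((⌈(t : ℝ) * (m + 1)⌉₊ : ℝ≥0) / (m + 1))) ?_
  refine (hw.tendsto t).comp ?_
  rw [← NNReal.tendsto_coe]
  have h1 := (tendsto_natCast_atTop_atTop (R := ℝ)).comp (Filter.tendsto_add_atTop_nat 1)
  have h2 := (tendsto_nat_ceil_mul_div_atTop t.2).comp h1
  exact h2.congr fun m => by simp

theorem measurable_gridEval {X : Type*} [MeasurableSpace X] {w : X → ℝ≥0 → ℝ} {t : X → ℝ≥0}
    (hw : Measurable w) (ht : Measurable t) : Measurable fun x => gridEval (w x) (t x) := by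
  unfold gridEval
  refine (StronglyMeasurable.limUnder fun m => Measurable.stronglyMeasurable ?_).measurable
  refine measurable_comp_countable
    (g := fun (k : ℕ) x => w x ((k : ℝ≥0) / (m + 1)))
    (f := fun x => ⌈(t x : ℝ) * (m + 1)⌉₊) ?_ ?_
  · exact Nat.measurable_ceil.comp (by fun_prop)
  · intro k; fun_prop

/-- Joint measurability of the reward in intensities, quote, clocks and Brownian path. -/
theorem measurable_pathReward {p : Params} (q : Inv p.Q) (h : ℝ) (φ : Inv p.Q → ℝ)
    {X : Type*} [MeasurableSpace X] {a b : X → ℝ} {δ : X → Quote} {c : X → Side × ℕ → ℝ}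
    {w : X → ℝ≥0 → ℝ} (ha : Measurable a) (hb : Measurable b) (hδ : Measurable δ)
    (hc : Measurable c) (hw : Measurable w) :
    Measurable fun x => pathReward p (a x) (b x) (δ x) q h φ (c x) (gridEval (w x)) := by
  classical
  have hN := measurable_pathCount q ha hb hc (measurable_const (a := h))
  have hI := measurable_pathInv q ha hb hc (measurable_const (a := h))
  have hcoord : ∀ i, Measurable fun x => δ x i := fun i => by fun_prop
  unfold pathReward
  refine ((Measurable.add ?_ ?_).add ?_).sub ?_
  · refine measurable_comp_countable
      (g := fun (n : ℕ) x => ∑ k ∈ Finset.range n,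
        if PathAsk (a x) (b x) q (c x) k
        then p.σ * gridEval (w x) (pathTime (a x) (b x) q (c x) (k + 1)).toNNReal + δ x 0
        else -(p.σ * gridEval (w x) (pathTime (a x) (b x) q (c x) (k + 1)).toNNReal - δ x 1))
      hN fun n => Finset.measurable_fun_sum _ fun k _ => ?_
    have hs : Measurable fun x => gridEval (w x)
        (pathTime (a x) (b x) q (c x) (k + 1)).toNNReal :=
      measurable_gridEval hw (measurable_pathTime q ha hb hc (k + 1)).ennreal_toNNReal
    exact Measurable.ite (measurableSet_pathAsk q ha hb hc k)
      ((hs.const_mul _).add (hcoord 0)) ((hs.const_mul _).sub (hcoord 1)).neg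
  · exact ((measurable_of_countable (fun r : Inv p.Q => (r : ℝ))).comp hI).mul
      ((measurable_gridEval hw measurable_const).const_mul _)
  · exact (measurable_of_countable φ).comp hI
  · simp only [intervalIntegral]
    have key : StronglyMeasurable (Function.uncurry fun (x : X) (u : ℝ) =>
        p.η * (pathInv (a x) (b x) q (c x) u : ℝ) ^ 2) := by
      refine Measurable.stronglyMeasurable ?_
      have := measurable_pathInv q (ha.comp (measurable_fst (β := ℝ)))
        (hb.comp (measurable_fst (β := ℝ))) (hc.comp (measurable_fst (β := ℝ))) measurable_snd
      exact (measurable_of_countable (fun r : Inv p.Q => p.η * (r : ℝ) ^ 2)).comp this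
    exact (key.integral_prod_right.sub key.integral_prod_right).measurable

/-! ### Exponential moments of Brownian step integrals -/

/-- The exponential moment of a stochastic integral of a deterministic step function against a
Brownian motion, from independence and Gaussianity of the increments. -/
theorem lintegral_exp_brownian_sum {Ω : Type*} [MeasurableSpace Ω] {P : Measure Ω}
    {W : ℝ≥0 → Ω → ℝ} (hW : IsPreBrownianReal W P) (hm : ∀ t, Measurable (W t)) {t : ℕ → ℝ≥0}
    (ht : Monotone t) (α : ℕ → ℝ) (n : ℕ) :
    ∫⁻ ω, ENNReal.ofReal (Real.exp (∑ j ∈ Finset.range n,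
        α j * (W (t (j + 1)) ω - W (t j) ω))) ∂P =
      ENNReal.ofReal (Real.exp (∑ j ∈ Finset.range n, α j ^ 2 * (t (j + 1) - t j) / 2)) := by
  have : IsProbabilityMeasure P := (hW.hasLaw_sub 0 0).isProbabilityMeasure
  set X : ℕ → Ω → ℝ := fun j ω => α j * (W (t (j + 1)) ω - W (t j) ω) with hX
  have hXm : ∀ j, Measurable (X j) := fun j => ((hm _).sub (hm _)).const_mul _
  have hind : iIndepFun X P :=
    (hW.hasIndepIncrements.nat ht).comp (fun j x => α j * x) fun j => by fun_prop
  have hlaw : ∀ j, P.map (fun ω => W (t (j + 1)) ω - W (t j) ω) =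
      gaussianReal 0 (t (j + 1) - t j) := fun j => by
    have h := (hW.hasLaw_sub (t (j + 1)) (t j)).map_eq
    have hd : (nndist (t (j + 1)).1 (t j).1 : ℝ≥0) = t (j + 1) - t j := by
      rw [← NNReal.coe_inj, NNReal.coe_sub (ht (Nat.le_succ j)), coe_nndist, Real.dist_eq,
        abs_of_nonneg]
      · rfl
      · exact sub_nonneg.2 (ht (Nat.le_succ j))
    rw [← hd]
    exact h
  have hint : ∀ j, Integrable (fun ω => Real.exp (1 * X j ω)) P := fun j => by
    have h1 := integrable_exp_mul_gaussianReal (μ := 0) (v := t (j + 1) - t j) (α j)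
    rw [← hlaw j, integrable_map_measure (by fun_prop) (by fun_prop)] at h1
    simpa [X, Function.comp_def] using h1
  have hmgf : ∀ j, mgf (X j) P 1 = Real.exp (α j ^ 2 * (t (j + 1) - t j) / 2) := fun j => by
    have h1 := mgf_gaussianReal (hlaw j) (α j)
    rw [NNReal.coe_sub (ht (Nat.le_succ j))] at h1
    simp only [mgf, X, one_mul] at h1 ⊢
    rw [h1]
    congr 1
    ring
  have hsum := hind.mgf_sum (t := 1) hXm (Finset.range n)
  have hsi := hind.integrable_exp_mul_sum (t := 1) hXm (s := Finset.range n) fun j _ => hint j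
  rw [← ofReal_integral_eq_lintegral_ofReal]
  · congr 1
    rw [Real.exp_sum]
    simp only [hmgf] at hsum
    rw [← hsum]
    simp [mgf, X]
  · simpa [X] using hsi
  · exact Filter.Eventually.of_forall fun ω => (Real.exp_pos _).le

/-! ### Integrating out the price path -/

section Path

variable {Q : ℕ} (a b : ℝ) (q : Inv Q) (c : Side × ℕ → ℝ)

theorem askActive_of_pathAskWait_ne_top {a : ℝ} {c : Side × ℕ → ℝ} {k : ℕ} {r : Inv Q}
    (h : pathAskWait a c k r ≠ ∞) : r.AskActive := by
  by_contra hr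
  simp [pathAskWait, waitingTime, hr] at h

theorem bidActive_of_pathBidWait_ne_top {b : ℝ} {c : Side × ℕ → ℝ} {k : ℕ} {r : Inv Q}
    (h : pathBidWait b c k r ≠ ∞) : r.BidActive := by
  by_contra hr
  simp [pathBidWait, waitingTime, hr] at h

theorem Inv.coe_down {r : Inv Q} (h : r.AskActive) : (r.down : ℤ) = r - 1 := by
  have h1 := r.2
  simp only [mem_Icc] at h1
  unfold Inv.AskActive at h
  rw [Inv.down, projIcc_of_mem _ (⟨by omega, by omega⟩ : (r : ℤ) - 1 ∈ Icc (-(Q : ℤ)) Q)]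

theorem Inv.coe_up {r : Inv Q} (h : r.BidActive) : (r.up : ℤ) = r + 1 := by
  have h1 := r.2
  simp only [mem_Icc] at h1
  unfold Inv.BidActive at h
  rw [Inv.up, projIcc_of_mem _ (⟨by omega, by omega⟩ : (r : ℤ) + 1 ∈ Icc (-(Q : ℤ)) Q)]

/-- A jump that takes place at a finite time leaves through an active side, so that it changes
the inventory by exactly one unit. -/
theorem pathState_succ_cast {k : ℕ} (h : pathTime a b q c (k + 1) ≠ ∞) :
    ((pathState a b q c (k + 1) : ℤ) : ℝ) =
      (pathState a b q c k : ℤ) + if PathAsk a b q c k then -1 else 1 := by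
  rw [pathTime_succ] at h
  have hmin := (ENNReal.add_ne_top.1 h).2
  rw [pathState_succ]
  split_ifs with hA
  · rw [PathAsk] at hA
    rw [min_eq_left hA] at hmin
    rw [Inv.coe_down (askActive_of_pathAskWait_ne_top hmin)]
    push_cast
    ring
  · rw [PathAsk, not_le] at hA
    rw [min_eq_right hA.le] at hmin
    rw [Inv.coe_up (bidActive_of_pathBidWait_ne_top hmin)]
    push_cast
    ring

/-- Summation by parts: the inventory-weighted price increments up to the jump number `m`. -/
theorem sum_fills_add_inventory (s : ℕ → ℝ) (hs : s 0 = 0) (m : ℕ)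
    (hm : pathTime a b q c m ≠ ∞) :
    ∑ k ∈ Finset.range m, (if PathAsk a b q c k then s (k + 1) else -s (k + 1))
        + ((pathState a b q c m : ℤ) : ℝ) * s m =
      ∑ j ∈ Finset.range m, ((pathState a b q c j : ℤ) : ℝ) * (s (j + 1) - s j) := by
  induction m with
  | zero => simp [hs]
  | succ m ih =>
    have hm' : pathTime a b q c m ≠ ∞ :=
      ne_top_of_le_ne_top hm (pathTime_mono a b q c (Nat.le_succ m))
    rw [Finset.sum_range_succ, Finset.sum_range_succ, ← ih hm', pathState_succ_cast a b q c hm]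
    split_ifs <;> ring

end Path

/-- The gain of a path apart from price movements and running penalty: quoted spreads of the fills
up to time `h`, and the terminal value. -/
def pathGain {Q : ℕ} (a b : ℝ) (δ : Quote) (q : Inv Q) (φ : Inv Q → ℝ) (c : Side × ℕ → ℝ)
    (n : ℕ) : ℝ :=
  ∑ k ∈ Finset.range n, (if PathAsk a b q c k then δ 0 else δ 1) + φ (pathState a b q c n)

/-- The constant `γ η + γ² σ² / 2` in front of `∫ q²` in the exponent after integrating out the
Brownian motion. -/
def Params.kap (p : Params) : ℝ := p.γ * p.η + p.γ ^ 2 * p.σ ^ 2 / 2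

theorem Params.kap_nonneg (p : Params) : 0 ≤ p.kap := by
  have := p.γ_pos; have := p.η_nonneg
  unfold Params.kap; positivity

theorem Inv.sq_le {Q : ℕ} (r : Inv Q) : ((r : ℤ) : ℝ) ^ 2 ≤ (Q : ℝ) ^ 2 := by
  have h1 := r.2
  simp only [mem_Icc] at h1
  apply sq_le_sq'
  · have := h1.1; exact_mod_cast this
  · have := h1.2; exact_mod_cast this

/-- With `n` fills up to time `h`, summation by parts turns cash plus marked inventory into spreads
plus an integral of the inventory against the price path. -/
theorem pathReward_eq {p : Params} {a b : ℝ} (δ : Quote) {q : Inv p.Q} {h : ℝ}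
    (φ : Inv p.Q → ℝ) {c : Side × ℕ → ℝ} {n : ℕ} {s : ℝ≥0 → ℝ} (hs : s 0 = 0)
    (h1 : pathTime a b q c n ≤ ENNReal.ofReal h)
    (h2 : ENNReal.ofReal h < pathTime a b q c (n + 1)) :
    pathReward p a b δ q h φ c s = pathGain a b δ q φ c n
      + p.σ * (∑ j ∈ Finset.range (n + 1), ((pathState a b q c j : ℤ) : ℝ) *
          (s (min (pathTime a b q c (j + 1)) (ENNReal.ofReal h)).toNNReal
            - s (min (pathTime a b q c j) (ENNReal.ofReal h)).toNNReal))
      - ∫ u in (0 : ℝ)..h, p.η * (pathInv a b q c u : ℝ) ^ 2 := by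
  have hN := pathCount_eq a b q c h1 h2
  have hmin : ∀ j ≤ n, min (pathTime a b q c j) (ENNReal.ofReal h) = pathTime a b q c j :=
    fun j hj => min_eq_left ((pathTime_mono a b q c hj).trans h1)
  have hab := sum_fills_add_inventory a b q c
    (fun j => s (min (pathTime a b q c j) (ENNReal.ofReal h)).toNNReal) (by simp [hs]) n
    (ne_top_of_le_ne_top ENNReal.ofReal_ne_top h1)
  rw [Finset.sum_range_succ, ← hab, min_eq_right h2.le]
  simp only [pathReward, pathInv, hN, pathGain]
  have hsum : ∑ k ∈ Finset.range n, (if PathAsk a b q c k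
        then p.σ * s (pathTime a b q c (k + 1)).toNNReal + δ 0
        else -(p.σ * s (pathTime a b q c (k + 1)).toNNReal - δ 1)) =
      ∑ k ∈ Finset.range n, (if PathAsk a b q c k then δ 0 else δ 1) +
      p.σ * ∑ k ∈ Finset.range n, (if PathAsk a b q c k
        then s (min (pathTime a b q c (k + 1)) (ENNReal.ofReal h)).toNNReal
        else -s (min (pathTime a b q c (k + 1)) (ENNReal.ofReal h)).toNNReal) := by
    rw [Finset.mul_sum, ← Finset.sum_add_distrib]
    refine Finset.sum_congr rfl fun k hk => ?_
    rw [hmin (k + 1) (by simpa using hk)]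
    split_ifs <;> ring
  rw [hsum]
  simp only [ENNReal.ofReal, ENNReal.toNNReal_coe]
  ring

theorem pathInv_eq_of_lt_pathTime_one {Q : ℕ} {a b : ℝ} {q : Inv Q} {c : Side × ℕ → ℝ} {h u : ℝ}
    (h2 : ENNReal.ofReal h < pathTime a b q c 1) (hu : u ≤ h) : pathInv a b q c u = q := by
  have := pathCount_eq a b q c (u := u) (n := 0) (by simp)
    ((ENNReal.ofReal_le_ofReal hu).trans_lt h2)
  rw [pathInv, this, pathState_zero]

/-- Integrating out the Brownian motion with the clocks frozen: price risk and running penalty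
only contribute a factor `exp v` with `0 ≤ v ≤ κ Q² h`, and `v = κ q² h` if there is no fill. -/
theorem exists_lintegral_exp_pathReward {p : Params} {Ω : Type*} [MeasurableSpace Ω]
    {P : Measure Ω} {W : ℝ≥0 → Ω → ℝ} (hW : IsBrownianReal W P) (hm : ∀ t, Measurable (W t))
    {a b : ℝ} (δ : Quote) {q : Inv p.Q} {h : ℝ} (hh : 0 ≤ h) (φ : Inv p.Q → ℝ)
    {c : Side × ℕ → ℝ} {n : ℕ} (h1 : pathTime a b q c n ≤ ENNReal.ofReal h)
    (h2 : ENNReal.ofReal h < pathTime a b q c (n + 1)) :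
    ∃ v, 0 ≤ v ∧ v ≤ p.kap * p.Q ^ 2 * h ∧ (n = 0 → v = p.kap * (q : ℝ) ^ 2 * h) ∧
      ∫⁻ ω, ENNReal.ofReal (Real.exp (-p.γ *
        pathReward p a b δ q h φ c (gridEval fun t => W t ω))) ∂P =
      ENNReal.ofReal (Real.exp (-p.γ * pathGain a b δ q φ c n + v)) := by
  set t : ℕ → ℝ≥0 := fun j => (min (pathTime a b q c j) (ENNReal.ofReal h)).toNNReal with htdef
  have hfin : ∀ j, min (pathTime a b q c j) (ENNReal.ofReal h) ≠ ∞ := fun j =>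
    ne_top_of_le_ne_top ENNReal.ofReal_ne_top (min_le_right _ _)
  have htm : Monotone t := fun i j hij => ENNReal.toNNReal_mono (hfin j)
    (min_le_min_right _ (pathTime_mono a b q c hij))
  have ht0 : t 0 = 0 := by simp [htdef]
  have htn : t (n + 1) = h.toNNReal := by
    rw [htdef]
    simp only [min_eq_right h2.le]
    exact ENNReal.toNNReal_coe _
  set x : ℕ → ℝ := fun j => ((pathState a b q c j : ℤ) : ℝ) with hx
  set I : ℝ := ∫ u in (0 : ℝ)..h, p.η * (pathInv a b q c u : ℝ) ^ 2 with hI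
  set V : ℝ := ∑ j ∈ Finset.range (n + 1), x j ^ 2 * ((t (j + 1) : ℝ) - t j) with hV
  have hγ := p.γ_pos
  have hη := p.η_nonneg
  have hdiff : ∀ j, 0 ≤ (t (j + 1) : ℝ) - t j := fun j => sub_nonneg.2 (htm (Nat.le_succ j))
  have hV0 : 0 ≤ V := Finset.sum_nonneg fun j _ => mul_nonneg (sq_nonneg _) (hdiff j)
  have hV1 : V ≤ p.Q ^ 2 * h := by
    calc V ≤ ∑ j ∈ Finset.range (n + 1), (p.Q : ℝ) ^ 2 * ((t (j + 1) : ℝ) - t j) :=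
          Finset.sum_le_sum fun j _ => mul_le_mul_of_nonneg_right (Inv.sq_le _) (hdiff j)
      _ = p.Q ^ 2 * h := by
          rw [← Finset.mul_sum, Finset.sum_range_sub (fun j => (t j : ℝ)), htn, ht0]
          simp [hh]
  have hI0 : 0 ≤ I := intervalIntegral.integral_nonneg hh fun u _ => by positivity
  have hI1 : I ≤ p.η * p.Q ^ 2 * h := by
    have := intervalIntegral.norm_integral_le_of_norm_le_const (a := 0) (b := h)
      (f := fun u => p.η * (pathInv a b q c u : ℝ) ^ 2) (C := p.η * p.Q ^ 2) fun u _ => by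
        rw [Real.norm_of_nonneg (by positivity)]
        exact mul_le_mul_of_nonneg_left (Inv.sq_le _) hη
    rw [sub_zero, abs_of_nonneg hh] at this
    exact (Real.le_norm_self _).trans this
  refine ⟨p.γ * I + p.γ ^ 2 * p.σ ^ 2 / 2 * V, by positivity, ?_, ?_, ?_⟩
  · calc p.γ * I + p.γ ^ 2 * p.σ ^ 2 / 2 * V
        ≤ p.γ * (p.η * p.Q ^ 2 * h) + p.γ ^ 2 * p.σ ^ 2 / 2 * (p.Q ^ 2 * h) := by gcongr
      _ = p.kap * p.Q ^ 2 * h := by unfold Params.kap; ring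
  · rintro rfl
    have hIe : I = p.η * (q : ℝ) ^ 2 * h := by
      rw [hI, intervalIntegral.integral_congr (g := fun _ => p.η * (q : ℝ) ^ 2)]
      · rw [intervalIntegral.integral_const, smul_eq_mul, sub_zero, mul_comm]
      · intro u hu
        rw [uIcc_of_le hh] at hu
        simp only [pathInv_eq_of_lt_pathTime_one h2 hu.2]
    have hVe : V = (q : ℝ) ^ 2 * h := by
      simp only [hV, zero_add, Finset.range_one, Finset.sum_singleton, ht0]
      rw [zero_add] at htn
      rw [htn]
      simp [hx, hh]
    rw [hIe, hVe]
    unfold Params.kap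
    ring
  · have hae : ∀ᵐ ω ∂P, ENNReal.ofReal (Real.exp (-p.γ *
          pathReward p a b δ q h φ c (gridEval fun t => W t ω))) =
        ENNReal.ofReal (Real.exp (-p.γ * (pathGain a b δ q φ c n - I))) *
        ENNReal.ofReal (Real.exp (∑ j ∈ Finset.range (n + 1),
          (-p.γ * p.σ * x j) * (W (t (j + 1)) ω - W (t j) ω))) := by
      filter_upwards [hW.cont, hW.eval_zero_ae_eq_zero] with ω hc h0
      have hg : (gridEval fun t => W t ω) = fun t => W t ω := funext fun t => gridEval_eq hc t
      rw [hg, pathReward_eq δ φ h0 h1 h2, ← ENNReal.ofReal_mul (Real.exp_pos _).le, ← Real.exp_add]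
      congr 2
      simp only [Finset.mul_sum]
      rw [← hI, mul_sub, mul_add, mul_sub, Finset.mul_sum]
      have : ∀ j, -p.γ * (p.σ * (((pathState a b q c j : ℤ) : ℝ) *
          (W (min (pathTime a b q c (j + 1)) (ENNReal.ofReal h)).toNNReal ω
            - W (min (pathTime a b q c j) (ENNReal.ofReal h)).toNNReal ω))) =
          -p.γ * p.σ * x j * (W (t (j + 1)) ω - W (t j) ω) := fun j => by
        simp only [hx, htdef]; ring
      rw [Finset.sum_congr rfl fun j _ => this j]
      ring
    rw [lintegral_congr_ae hae, lintegral_const_mul' _ _ ENNReal.ofReal_ne_top,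
      lintegral_exp_brownian_sum hW.toIsPreBrownianReal hm htm,
      ← ENNReal.ofReal_mul (Real.exp_pos _).le, ← Real.exp_add]
    congr 2
    have : ∑ j ∈ Finset.range (n + 1), (-p.γ * p.σ * x j) ^ 2 * ((t (j + 1) : ℝ) - t j) / 2 =
        p.γ ^ 2 * p.σ ^ 2 / 2 * V := by
      rw [hV, Finset.mul_sum]
      exact Finset.sum_congr rfl fun j _ => by ring
    rw [this]
    ring

theorem Noise.isProbabilityMeasure {Ω : Type*} [MeasurableSpace Ω] {P : Measure Ω}
    (B : Noise Ω P) : IsProbabilityMeasure P :=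
  (B.isBrownian.toIsPreBrownianReal.hasLaw_sub 0 0).isProbabilityMeasure

/-- By independence, clocks and Brownian motion may be integrated one after the other. -/
theorem Noise.lintegral_clock_W {Ω : Type*} [MeasurableSpace Ω] {P : Measure Ω} (B : Noise Ω P)
    {f : (Side × ℕ → ℝ) × (ℝ≥0 → ℝ) → ℝ≥0∞} (hf : Measurable f) :
    ∫⁻ ω, f (fun i => B.clock i ω, fun t => B.W t ω) ∂P =
      ∫⁻ ω, ∫⁻ ω', f (fun i => B.clock i ω, fun t => B.W t ω') ∂P ∂P := by
  have := B.isProbabilityMeasure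
  have hc : Measurable fun ω i => B.clock i ω := measurable_pi_lambda _ B.measurable_clock
  have hw : Measurable fun ω t => B.W t ω := measurable_pi_lambda _ B.measurable_W
  have h := (indepFun_iff_map_prod_eq_prod_map_map hc.aemeasurable hw.aemeasurable).1 B.indepFun
  have := Measure.isProbabilityMeasure_map (μ := P) hw.aemeasurable
  calc ∫⁻ ω, f (fun i => B.clock i ω, fun t => B.W t ω) ∂P
      = ∫⁻ z, f z ∂(P.map fun ω => (fun i => B.clock i ω, fun t => B.W t ω)) :=
        (lintegral_map hf (hc.prodMk hw)).symm
    _ = ∫⁻ c, ∫⁻ w, f (c, w) ∂(P.map fun ω t => B.W t ω) ∂(P.map fun ω i => B.clock i ω) := by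
        rw [h, lintegral_prod _ hf.aemeasurable]
    _ = ∫⁻ ω, ∫⁻ w, f (fun i => B.clock i ω, w) ∂(P.map fun ω t => B.W t ω) ∂P :=
        lintegral_map hf.lintegral_prod_right' hc
    _ = _ := lintegral_congr fun ω => lintegral_map (by fun_prop) hw

/-! ### Probabilities of few and of many fills -/

theorem waitingTime_le_iff {r e h : ℝ} (hr : 0 ≤ r) (hh : 0 ≤ h) :
    waitingTime r e ≤ ENNReal.ofReal h ↔ r ≠ 0 ∧ e ≤ r * h := by
  unfold waitingTime
  split_ifs with h0
  · simp [h0]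
  · have hr' : 0 < r := lt_of_le_of_ne hr (Ne.symm h0)
    rw [ENNReal.ofReal_le_ofReal_iff hh, div_le_iff₀ hr', mul_comm]
    simp [h0]

section Clocks

variable {Ω : Type*} [MeasurableSpace Ω] {P : Measure Ω} (B : Noise Ω P)

theorem Noise.measure_clock_le (i : Side × ℕ) {x : ℝ} (hx : 0 ≤ x) :
    P {ω | B.clock i ω ≤ x} = ENNReal.ofReal (1 - Real.exp (-x)) := by
  have := isProbabilityMeasure_expMeasure (r := 1) one_pos
  have h1 : P {ω | B.clock i ω ≤ x} = expMeasure 1 (Iic x) := by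
    rw [← (B.hasLaw_clock i).map_eq, Measure.map_apply (B.measurable_clock i) measurableSet_Iic]
    rfl
  rw [h1, ← ofReal_cdf, cdf_expMeasure_eq one_pos, if_pos hx, one_mul]

theorem Noise.measure_waitingTime_le (i : Side × ℕ) {r h : ℝ} (hr : 0 ≤ r) (hh : 0 ≤ h) :
    P {ω | waitingTime r (B.clock i ω) ≤ ENNReal.ofReal h} =
      ENNReal.ofReal (1 - Real.exp (-(r * h))) := by
  simp only [waitingTime_le_iff hr hh]
  rcases eq_or_ne r 0 with rfl | h0
  · simp
  · simp only [ne_eq, h0, not_false_eq_true, true_and]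
    exact B.measure_clock_le i (by positivity)

theorem Noise.measure_lt_waitingTime (i : Side × ℕ) {r h : ℝ} (hr : 0 ≤ r) (hh : 0 ≤ h) :
    P {ω | ENNReal.ofReal h < waitingTime r (B.clock i ω)} =
      ENNReal.ofReal (Real.exp (-(r * h))) := by
  have := B.isProbabilityMeasure
  have hm : MeasurableSet {ω | waitingTime r (B.clock i ω) ≤ ENNReal.ofReal h} :=
    measurableSet_le (measurable_waitingTime.comp (measurable_const.prodMk (B.measurable_clock i)))
      measurable_const
  have h1 : {ω | ENNReal.ofReal h < waitingTime r (B.clock i ω)} =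
      {ω | waitingTime r (B.clock i ω) ≤ ENNReal.ofReal h}ᶜ := by
    ext ω; simp
  have hexp : Real.exp (-(r * h)) ≤ 1 := Real.exp_le_one_iff.2 (by nlinarith)
  rw [h1, prob_compl_eq_one_sub hm, B.measure_waitingTime_le i hr hh, ← ENNReal.ofReal_one,
    ← ENNReal.ofReal_sub _ (by linarith)]
  congr 1
  ring

theorem Noise.measure_clock_inter {i j : Side × ℕ} (hij : i ≠ j) {s t : Set ℝ}
    (hs : MeasurableSet s) (ht : MeasurableSet t) :
    P {ω | B.clock i ω ∈ s ∧ B.clock j ω ∈ t} =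
      P {ω | B.clock i ω ∈ s} * P {ω | B.clock j ω ∈ t} :=
  (B.iIndepFun_clock.indepFun hij).measure_inter_preimage_eq_mul _ _ hs ht

/-- The clock values of a sample point. -/
def Noise.clocks (ω : Ω) : Side × ℕ → ℝ := fun i => B.clock i ω

theorem Noise.measurable_clocks : Measurable B.clocks := measurable_pi_lambda _ B.measurable_clock

variable {Q : ℕ} {a b Λ : ℝ} (q : Inv Q)

theorem pathAskWait_le {c : Side × ℕ → ℝ} {k : ℕ} {r : Inv Q} {h : ℝ} (ha : 0 ≤ a) (haΛ : a ≤ Λ)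
    (hh : 0 ≤ h) (hw : pathAskWait a c k r ≤ ENNReal.ofReal h) : c (Side.ask, k) ≤ Λ * h := by
  unfold pathAskWait at hw
  split_ifs at hw
  · exact ((waitingTime_le_iff ha hh).1 hw).2.trans (by gcongr)
  · simp [waitingTime] at hw

theorem pathBidWait_le {c : Side × ℕ → ℝ} {k : ℕ} {r : Inv Q} {h : ℝ} (hb : 0 ≤ b) (hbΛ : b ≤ Λ)
    (hh : 0 ≤ h) (hw : pathBidWait b c k r ≤ ENNReal.ofReal h) : c (Side.bid, k) ≤ Λ * h := by
  unfold pathBidWait at hw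
  split_ifs at hw
  · exact ((waitingTime_le_iff hb hh).1 hw).2.trans (by gcongr)
  · simp [waitingTime] at hw

/-- If `n` fills occur up to time `h`, each of the first `n` waiting times is at most `h`, so one of
the `2 ^ n` choices of one clock per jump consists of clocks below `Λ h`. -/
theorem Noise.measure_pathTime_le (ha : 0 ≤ a) (haΛ : a ≤ Λ) (hb : 0 ≤ b) (hbΛ : b ≤ Λ) {h : ℝ}
    (hh : 0 ≤ h) (n : ℕ) :
    P {ω | pathTime a b q (B.clocks ω) n ≤ ENNReal.ofReal h} ≤
      ENNReal.ofReal ((2 * Λ * h) ^ n) := by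
  have hΛ : 0 ≤ Λ := ha.trans haΛ
  let side : Bool → Side := fun x => if x then Side.ask else Side.bid
  have hsub : {ω | pathTime a b q (B.clocks ω) n ≤ ENNReal.ofReal h} ⊆
      ⋃ s : Fin n → Bool, ⋂ k ∈ (Finset.univ : Finset (Fin n)),
        (fun ω => B.clock (side (s k), (k : ℕ)) ω) ⁻¹' Iic (Λ * h) := by
    intro ω hω
    have hk : ∀ k : Fin n, ∃ x : Bool, B.clock (side x, (k : ℕ)) ω ≤ Λ * h := fun k => by
      have h1 : pathTime a b q (B.clocks ω) (k + 1) ≤ ENNReal.ofReal h :=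
        (pathTime_mono a b q _ (by omega)).trans hω
      rw [pathTime_succ] at h1
      rcases min_le_iff.1 (le_add_self.trans h1) with h2 | h2
      · exact ⟨true, pathAskWait_le ha haΛ hh h2⟩
      · exact ⟨false, pathBidWait_le hb hbΛ hh h2⟩
    choose s hs using hk
    simp only [mem_iUnion, mem_iInter]
    exact ⟨s, fun k _ => hs k⟩
  refine (measure_mono hsub).trans ((measure_iUnion_fintype_le _ _).trans ?_)
  have hterm : ∀ s : Fin n → Bool, P (⋂ k ∈ (Finset.univ : Finset (Fin n)),
      (fun ω => B.clock (side (s k), (k : ℕ)) ω) ⁻¹' Iic (Λ * h)) ≤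
        ENNReal.ofReal ((Λ * h) ^ n) := fun s => by
    have hinj : Function.Injective fun k : Fin n => (side (s k), (k : ℕ)) := fun i j hij =>
      Fin.ext (Prod.ext_iff.1 hij).2
    rw [(B.iIndepFun_clock.precomp hinj).measure_inter_preimage_eq_mul Finset.univ
      fun _ _ => measurableSet_Iic]
    calc ∏ k : Fin n, P ((fun ω => B.clock (side (s k), (k : ℕ)) ω) ⁻¹' Iic (Λ * h))
        ≤ ∏ _k : Fin n, ENNReal.ofReal (Λ * h) := Finset.prod_le_prod' fun k _ => by
          refine (B.measure_clock_le (side (s k), (k : ℕ)) (by positivity)).le.trans ?_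
          refine ENNReal.ofReal_le_ofReal ?_
          linarith [Real.add_one_le_exp (-(Λ * h))]
      _ = _ := by simp [ENNReal.ofReal_pow (by positivity : 0 ≤ Λ * h)]
  calc ∑ s : Fin n → Bool, P (⋂ k ∈ (Finset.univ : Finset (Fin n)),
      (fun ω => B.clock (side (s k), (k : ℕ)) ω) ⁻¹' Iic (Λ * h))
      ≤ ∑ _s : Fin n → Bool, ENNReal.ofReal ((Λ * h) ^ n) :=
        Finset.sum_le_sum fun s _ => hterm s
    _ = ENNReal.ofReal ((2 * Λ * h) ^ n) := by
        rw [Finset.sum_const, nsmul_eq_mul, mul_assoc 2, mul_pow 2,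
          ENNReal.ofReal_mul (by positivity)]
        simp

/-- Almost surely only finitely many fills occur up to a short time `h`. -/
theorem Noise.ae_exists_pathTime (ha : 0 ≤ a) (haΛ : a ≤ Λ) (hb : 0 ≤ b) (hbΛ : b ≤ Λ) {h : ℝ}
    (hh : 0 ≤ h) (hsmall : 2 * Λ * h < 1) :
    ∀ᵐ ω ∂P, ∃ n, pathTime a b q (B.clocks ω) n ≤ ENNReal.ofReal h ∧
      ENNReal.ofReal h < pathTime a b q (B.clocks ω) (n + 1) := by
  have hΛ : 0 ≤ Λ := ha.trans haΛ
  have hzero : P {ω | ∀ n, pathTime a b q (B.clocks ω) n ≤ ENNReal.ofReal h} = 0 := by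
    have hlim : Filter.Tendsto (fun n : ℕ => ENNReal.ofReal ((2 * Λ * h) ^ n)) Filter.atTop
        (nhds 0) := by
      rw [← ENNReal.ofReal_zero]
      exact ENNReal.tendsto_ofReal (tendsto_pow_atTop_nhds_zero_of_lt_one (by positivity) hsmall)
    refine le_antisymm (ge_of_tendsto' hlim fun n => ?_) zero_le
    have hsub : {ω | ∀ n, pathTime a b q (B.clocks ω) n ≤ ENNReal.ofReal h} ⊆
        {ω | pathTime a b q (B.clocks ω) n ≤ ENNReal.ofReal h} := fun ω hω => by
      simp only [mem_ofPred_eq] at hω ⊢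
      exact hω n
    exact (measure_mono hsub).trans (B.measure_pathTime_le q ha haΛ hb hbΛ hh n)
  have hae : ∀ᵐ ω ∂P, ¬ ∀ n, pathTime a b q (B.clocks ω) n ≤ ENNReal.ofReal h := by
    rw [ae_iff]
    simpa using hzero
  filter_upwards [hae] with ω hω
  by_contra! hcon
  apply hω
  intro n
  induction n with
  | zero => simp
  | succ n ih => exact hcon n ih

end Clocks

/-! ### The exponential moment of the reward -/

section Moment

variable {p : Params} {Ω : Type*} [MeasurableSpace Ω] {P : Measure Ω} (B : Noise Ω P)

/-- The exponential moment `E exp (-γ reward)` with intensities `a`, `b`, with clocks and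
Brownian motion integrated one after the other. -/
def expMoment (a b : ℝ) (δ : Quote) (q : Inv p.Q) (h : ℝ) (φ : Inv p.Q → ℝ) : ℝ≥0∞ :=
  ∫⁻ ω, ∫⁻ ω', ENNReal.ofReal (Real.exp (-p.γ *
    pathReward p a b δ q h φ (B.clocks ω) (gridEval fun t => B.W t ω'))) ∂P ∂P

theorem measurable_expMoment (q : Inv p.Q) (h : ℝ) (φ : Inv p.Q → ℝ) :
    Measurable fun x : ℝ × ℝ × Quote => expMoment B x.1 x.2.1 x.2.2 q h φ := by
  have := B.isProbabilityMeasure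
  have hw : Measurable fun ω t => B.W t ω := measurable_pi_lambda _ B.measurable_W
  unfold expMoment
  have h1 : Measurable fun z : ((ℝ × ℝ × Quote) × Ω) × Ω => ENNReal.ofReal (Real.exp (-p.γ *
      pathReward p z.1.1.1 z.1.1.2.1 z.1.1.2.2 q h φ (B.clocks z.1.2)
        (gridEval fun t => B.W t z.2))) := by
    refine (Real.measurable_exp.comp (Measurable.const_mul ?_ _)).ennreal_ofReal
    exact measurable_pathReward q h φ (by fun_prop) (by fun_prop) (by fun_prop)
      (B.measurable_clocks.comp (by fun_prop)) (hw.comp measurable_snd)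
  exact (h1.lintegral_prod_right' (ν := P)).lintegral_prod_right' (ν := P)

/-- The score depends on the market only through the two intensities at the quote, which makes it a
measurable function of them and of the quote. -/
theorem score_eq_log_expMoment (M : Market p) (δ : Quote) (q : Inv p.Q) (h : ℝ)
    (φ : Inv p.Q → ℝ) : score M B δ q h φ =
      -(1 / p.γ) * Real.log (expMoment B (M.Λa (δ 0)) (M.Λb (δ 1)) δ q h φ).toReal := by
  set f : (Side × ℕ → ℝ) × (ℝ≥0 → ℝ) → ℝ := fun z =>
    Real.exp (-p.γ * pathReward p (M.Λa (δ 0)) (M.Λb (δ 1)) δ q h φ z.1 (gridEval z.2)) with hf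
  have hfm : Measurable f := Real.measurable_exp.comp (Measurable.const_mul
    (measurable_pathReward q h φ measurable_const measurable_const measurable_const
      measurable_fst measurable_snd) _)
  have hw : Measurable fun ω t => B.W t ω := measurable_pi_lambda _ B.measurable_W
  have hae : (fun ω => Real.exp (-p.γ * reward M B δ q h φ ω)) =ᵐ[P]
      fun ω => f (B.clocks ω, fun t => B.W t ω) := by
    filter_upwards [B.isBrownian.cont] with ω hc
    have hg : (gridEval fun t => B.W t ω) = fun t => B.W t ω := funext fun t => gridEval_eq hc t
    simp only [hf, hg, reward_eq_pathReward]
    rfl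
  rw [score, integral_congr_ae hae, integral_eq_lintegral_of_nonneg_ae
    (Filter.Eventually.of_forall fun ω => (Real.exp_pos _).le)
    (hfm.comp (B.measurable_clocks.prodMk hw)).aestronglyMeasurable]
  congr 3
  exact B.lintegral_clock_W hfm.ennreal_ofReal

end Moment

/-! ### Two-sided bounds for the exponential moment -/

section MomentBounds

variable {p : Params} {Ω : Type*} [MeasurableSpace Ω] {P : Measure Ω} (B : Noise Ω P)

/-- The intensity of ask fills in state `q`. -/
def effAsk {Q : ℕ} (q : Inv Q) (a : ℝ) : ℝ := if q.AskActive then a else 0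

/-- The intensity of bid fills in state `q`. -/
def effBid {Q : ℕ} (q : Inv Q) (b : ℝ) : ℝ := if q.BidActive then b else 0

theorem effAsk_mem {Q : ℕ} (q : Inv Q) {a Λ : ℝ} (ha : 0 ≤ a) (haΛ : a ≤ Λ) :
    0 ≤ effAsk q a ∧ effAsk q a ≤ Λ := by
  unfold effAsk; split_ifs
  · exact ⟨ha, haΛ⟩
  · exact ⟨le_rfl, ha.trans haΛ⟩

theorem effBid_mem {Q : ℕ} (q : Inv Q) {b Λ : ℝ} (hb : 0 ≤ b) (hbΛ : b ≤ Λ) :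
    0 ≤ effBid q b ∧ effBid q b ≤ Λ := by
  unfold effBid; split_ifs
  · exact ⟨hb, hbΛ⟩
  · exact ⟨le_rfl, hb.trans hbΛ⟩

theorem abs_pathGain_le {Q : ℕ} (a b : ℝ) {δ : Quote} {D K : ℝ} (hδ : ∀ i, |δ i| ≤ D) (q : Inv Q)
    {φ : Inv Q → ℝ} (hφ : ∀ r, |φ r| ≤ K) (c : Side × ℕ → ℝ) (n : ℕ) :
    |pathGain a b δ q φ c n| ≤ n * D + K := by
  unfold pathGain
  refine (abs_add_le _ _).trans (add_le_add ?_ (hφ _))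
  refine (Finset.abs_sum_le_sum_abs _ _).trans ?_
  calc ∑ k ∈ Finset.range n, |if PathAsk a b q c k then δ 0 else δ 1|
      ≤ ∑ _k ∈ Finset.range n, D := Finset.sum_le_sum fun k _ => by split_ifs <;> exact hδ _
    _ = n * D := by simp

/-- The probabilities that up to time `h` neither of the first two clocks has rung, that the clock of
a given side has rung, and that it has rung while the other one has not. -/
theorem measure_pathWait {a b Λ : ℝ} (ha : 0 ≤ a) (haΛ : a ≤ Λ) (hb : 0 ≤ b) (hbΛ : b ≤ Λ)
    (q : Inv p.Q) {h : ℝ} (hh : 0 ≤ h) :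
    P {ω | ENNReal.ofReal h < pathTime a b q (B.clocks ω) 1} =
        ENNReal.ofReal (Real.exp (-((effAsk q a + effBid q b) * h))) ∧
      P {ω | pathAskWait a (B.clocks ω) 0 q ≤ ENNReal.ofReal h} =
        ENNReal.ofReal (1 - Real.exp (-(effAsk q a * h))) ∧
      P {ω | pathBidWait b (B.clocks ω) 0 q ≤ ENNReal.ofReal h} =
        ENNReal.ofReal (1 - Real.exp (-(effBid q b * h))) ∧
      P {ω | pathAskWait a (B.clocks ω) 0 q ≤ ENNReal.ofReal h ∧
          ENNReal.ofReal h < pathBidWait b (B.clocks ω) 0 q} =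
        ENNReal.ofReal ((1 - Real.exp (-(effAsk q a * h))) * Real.exp (-(effBid q b * h))) ∧
      P {ω | pathBidWait b (B.clocks ω) 0 q ≤ ENNReal.ofReal h ∧
          ENNReal.ofReal h < pathAskWait a (B.clocks ω) 0 q} =
        ENNReal.ofReal ((1 - Real.exp (-(effBid q b * h))) * Real.exp (-(effAsk q a * h))) := by
  obtain ⟨hra, -⟩ := effAsk_mem q ha haΛ
  obtain ⟨hrb, -⟩ := effBid_mem q hb hbΛ
  have hA : ∀ ω, pathAskWait a (B.clocks ω) 0 q =
    waitingTime (effAsk q a) (B.clock (Side.ask, 0) ω) := fun ω => rfl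
  have hB : ∀ ω, pathBidWait b (B.clocks ω) 0 q =
    waitingTime (effBid q b) (B.clock (Side.bid, 0) ω) := fun ω => rfl
  have hne : ((Side.ask, 0) : Side × ℕ) ≠ (Side.bid, 0) := by simp
  have hle : ∀ r, MeasurableSet {e : ℝ | waitingTime r e ≤ ENNReal.ofReal h} := fun r =>
    measurableSet_le (measurable_waitingTime.comp (measurable_const.prodMk measurable_id))
      measurable_const
  have hlt : ∀ r, MeasurableSet {e : ℝ | ENNReal.ofReal h < waitingTime r e} := fun r =>
    measurableSet_lt measurable_const
      (measurable_waitingTime.comp (measurable_const.prodMk measurable_id))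
  have h1 : ∀ {r : ℝ}, 0 ≤ r → 0 ≤ 1 - Real.exp (-(r * h)) := fun hr => by
    have := Real.exp_le_one_iff.2 (neg_nonpos.2 (mul_nonneg hr hh))
    linarith
  simp only [hA, hB, pathTime_succ, pathTime_zero, pathState_zero, zero_add, lt_min_iff]
  refine ⟨?_, B.measure_waitingTime_le _ hra hh, B.measure_waitingTime_le _ hrb hh, ?_, ?_⟩
  · refine (B.measure_clock_inter hne (hlt _) (hlt _)).trans ?_
    simp only [mem_ofPred_eq]
    rw [B.measure_lt_waitingTime _ hra hh, B.measure_lt_waitingTime _ hrb hh,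
      ← ENNReal.ofReal_mul (Real.exp_pos _).le, ← Real.exp_add]
    congr 2; ring
  · refine (B.measure_clock_inter hne (hle _) (hlt _)).trans ?_
    simp only [mem_ofPred_eq]
    rw [B.measure_waitingTime_le _ hra hh, B.measure_lt_waitingTime _ hrb hh,
      ← ENNReal.ofReal_mul (h1 hra)]
  · refine (B.measure_clock_inter hne.symm (hle _) (hlt _)).trans ?_
    simp only [mem_ofPred_eq]
    rw [B.measure_waitingTime_le _ hrb hh, B.measure_lt_waitingTime _ hra hh,
      ← ENNReal.ofReal_mul (h1 hrb)]

variable {a b Λ D K h : ℝ} {δ : Quote} {q : Inv p.Q} {φ : Inv p.Q → ℝ}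

theorem measurable_pathTime_clocks (a b : ℝ) (q : Inv p.Q) (n : ℕ) :
    Measurable fun ω => pathTime a b q (B.clocks ω) n :=
  measurable_pathTime q measurable_const measurable_const B.measurable_clocks n

theorem measurable_pathAskWait_clocks (a : ℝ) (q : Inv p.Q) :
    Measurable fun ω => pathAskWait a (B.clocks ω) 0 q :=
  measurable_pathAskWait measurable_const B.measurable_clocks 0 q

theorem measurable_pathBidWait_clocks (b : ℝ) (q : Inv p.Q) :
    Measurable fun ω => pathBidWait b (B.clocks ω) 0 q :=
  measurable_pathBidWait measurable_const B.measurable_clocks 0 q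

/-- Upper bound for the exponential moment, separating paths with no fill, with one fill, and with
at least two fills. -/
theorem expMoment_le (ha : 0 ≤ a) (haΛ : a ≤ Λ) (hb : 0 ≤ b) (hbΛ : b ≤ Λ) (hh : 0 ≤ h)
    (hδ : ∀ i, |δ i| ≤ D) (hφ : ∀ r, |φ r| ≤ K)
    (hsmall : 2 * Λ * h * Real.exp (p.γ * D) ≤ 1 / 2) :
    expMoment B a b δ q h φ ≤ ENNReal.ofReal
      (Real.exp (-p.γ * φ q + p.kap * (q : ℝ) ^ 2 * h)
          * Real.exp (-((effAsk q a + effBid q b) * h))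
        + Real.exp (-p.γ * (δ 0 + φ q.down) + p.kap * p.Q ^ 2 * h)
          * (1 - Real.exp (-(effAsk q a * h)))
        + Real.exp (-p.γ * (δ 1 + φ q.up) + p.kap * p.Q ^ 2 * h)
          * (1 - Real.exp (-(effBid q b * h)))
        + 2 * (Real.exp (p.γ * K + p.kap * p.Q ^ 2 * h)
          * (2 * Λ * h * Real.exp (p.γ * D)) ^ 2)) := by
  have hγ := p.γ_pos
  have hΛ : 0 ≤ Λ := ha.trans haΛ
  have hD : 0 ≤ D := (abs_nonneg _).trans (hδ 0)
  obtain ⟨hm0, hmA, hmB, -, -⟩ := measure_pathWait B ha haΛ hb hbΛ q hh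
  obtain ⟨hra, -⟩ := effAsk_mem q ha haΛ
  obtain ⟨hrb, -⟩ := effBid_mem q hb hbΛ
  have h1 : ∀ {r : ℝ}, 0 ≤ r → 0 ≤ 1 - Real.exp (-(r * h)) := fun hr => by
    have := Real.exp_le_one_iff.2 (neg_nonpos.2 (mul_nonneg hr hh))
    linarith
  set g0 := Real.exp (-p.γ * φ q + p.kap * (q : ℝ) ^ 2 * h) with hg0
  set gA := Real.exp (-p.γ * (δ 0 + φ q.down) + p.kap * p.Q ^ 2 * h) with hgA
  set gB := Real.exp (-p.γ * (δ 1 + φ q.up) + p.kap * p.Q ^ 2 * h) with hgB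
  set F := Real.exp (p.γ * K + p.kap * p.Q ^ 2 * h) with hF
  set x := 2 * Λ * h * Real.exp (p.γ * D) with hx
  have hx0 : 0 ≤ x := by positivity
  have hexp1 : 1 ≤ Real.exp (p.γ * D) := Real.one_le_exp (by positivity)
  have hsm : 2 * Λ * h < 1 := by
    have : 2 * Λ * h ≤ x := le_mul_of_one_le_right (by positivity) hexp1
    linarith
  set S0 := {ω | ENNReal.ofReal h < pathTime a b q (B.clocks ω) 1} with hS0
  set SA := {ω | pathAskWait a (B.clocks ω) 0 q ≤ ENNReal.ofReal h} with hSA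
  set SB := {ω | pathBidWait b (B.clocks ω) 0 q ≤ ENNReal.ofReal h} with hSB
  set S : ℕ → Set Ω := fun n => {ω | pathTime a b q (B.clocks ω) (n + 2) ≤ ENNReal.ofReal h}
    with hS
  have hS0m : MeasurableSet S0 :=
    measurableSet_lt measurable_const (measurable_pathTime_clocks B a b q 1)
  have hSAm : MeasurableSet SA :=
    measurableSet_le (measurable_pathAskWait_clocks B a q) measurable_const
  have hSBm : MeasurableSet SB :=
    measurableSet_le (measurable_pathBidWait_clocks B b q) measurable_const
  have hSm : ∀ n, MeasurableSet (S n) := fun n =>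
    measurableSet_le (measurable_pathTime_clocks B a b q (n + 2)) measurable_const
  have hpt : ∀ᵐ ω ∂P, ∫⁻ ω', ENNReal.ofReal (Real.exp (-p.γ *
        pathReward p a b δ q h φ (B.clocks ω) (gridEval fun t => B.W t ω'))) ∂P ≤
      S0.indicator (fun _ => ENNReal.ofReal g0) ω + SA.indicator (fun _ => ENNReal.ofReal gA) ω
        + SB.indicator (fun _ => ENNReal.ofReal gB) ω
        + ∑' n, (S n).indicator
          (fun _ => ENNReal.ofReal (F * Real.exp (p.γ * D) ^ (n + 2))) ω := by
    filter_upwards [B.ae_exists_pathTime q ha haΛ hb hbΛ hh hsm] with ω ⟨n, hn1, hn2⟩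
    obtain ⟨v, hv0, hv1, hvn, hv⟩ := exists_lintegral_exp_pathReward B.isBrownian B.measurable_W
      δ hh φ hn1 hn2
    rw [hv]
    match n, hn1, hn2, hvn with
    | 0, hn1, hn2, hvn =>
      have hmem : ω ∈ S0 := hn2
      rw [indicator_of_mem hmem, hvn rfl]
      refine le_trans (le_of_eq ?_) (le_add_right (le_add_right le_self_add))
      simp [pathGain, hg0]
    | 1, hn1, hn2, hvn =>
      rw [pathTime_succ, pathTime_zero, pathState_zero, zero_add] at hn1
      by_cases hask : PathAsk a b q (B.clocks ω) 0
      · have hask' := hask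
        rw [PathAsk, pathState_zero] at hask'
        rw [min_eq_left hask'] at hn1
        have hmem : ω ∈ SA := hn1
        rw [indicator_of_mem hmem]
        refine le_trans (ENNReal.ofReal_le_ofReal ?_)
          (le_add_right (le_add_right le_add_self))
        simp only [pathGain, Finset.range_one, Finset.sum_singleton, hask, if_true, hgA,
          pathState_succ, pathState_zero]
        gcongr
      · have hask' := hask
        rw [PathAsk, pathState_zero, not_le] at hask'
        rw [min_eq_right hask'.le] at hn1
        have hmem : ω ∈ SB := hn1
        rw [indicator_of_mem hmem]
        refine le_trans (ENNReal.ofReal_le_ofReal ?_) (le_add_right le_add_self)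
        simp only [pathGain, Finset.range_one, Finset.sum_singleton, hask, if_false, hgB,
          pathState_succ, pathState_zero]
        gcongr
    | n + 2, hn1, hn2, hvn =>
      have hmem : ω ∈ S n := hn1
      refine le_trans ?_ (le_add_left (ENNReal.le_tsum n))
      rw [indicator_of_mem hmem]
      refine ENNReal.ofReal_le_ofReal ?_
      rw [hF, ← Real.exp_nat_mul, ← Real.exp_add]
      refine Real.exp_le_exp.2 ?_
      have hg := abs_le.1 (abs_pathGain_le a b hδ q hφ (B.clocks ω) (n + 2))
      have := mul_le_mul_of_nonneg_left hg.1 hγ.le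
      push_cast at this ⊢
      linarith
  -- paths with at least `n + 2` fills contribute at most `F x ^ (n + 2)`, and `x ≤ 1 / 2`
  have hterm : ∀ n, ∫⁻ ω, (S n).indicator
      (fun _ => ENNReal.ofReal (F * Real.exp (p.γ * D) ^ (n + 2))) ω ∂P ≤
        ENNReal.ofReal (F * x ^ 2) * (2⁻¹ : ℝ≥0∞) ^ n := fun n => by
    rw [lintegral_indicator_const (hSm n)]
    calc ENNReal.ofReal (F * Real.exp (p.γ * D) ^ (n + 2)) * P (S n)
        ≤ ENNReal.ofReal (F * Real.exp (p.γ * D) ^ (n + 2)) *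
          ENNReal.ofReal ((2 * Λ * h) ^ (n + 2)) := by
          gcongr
          exact B.measure_pathTime_le q ha haΛ hb hbΛ hh (n + 2)
      _ = ENNReal.ofReal (F * x ^ 2 * x ^ n) := by
          rw [← ENNReal.ofReal_mul (by positivity)]
          congr 1
          rw [hx]
          ring
      _ ≤ ENNReal.ofReal (F * x ^ 2 * (1 / 2) ^ n) := by
          refine ENNReal.ofReal_le_ofReal ?_
          gcongr
      _ = _ := by
          rw [ENNReal.ofReal_mul (by positivity), ENNReal.ofReal_pow (by norm_num), one_div,
            ENNReal.ofReal_inv_of_pos (by norm_num), ENNReal.ofReal_ofNat]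
  unfold expMoment
  refine (lintegral_mono_ae hpt).trans ?_
  have hsm' : Measurable fun ω => ∑' n, (S n).indicator
      (fun _ => ENNReal.ofReal (F * Real.exp (p.γ * D) ^ (n + 2))) ω :=
    Measurable.tsum fun n => measurable_const.indicator (hSm n)
  rw [lintegral_add_right _ hsm', lintegral_add_right _ (measurable_const.indicator hSBm),
    lintegral_add_right _ (measurable_const.indicator hSAm), lintegral_indicator_const hS0m,
    lintegral_indicator_const hSAm, lintegral_indicator_const hSBm, hm0, hmA, hmB,
    lintegral_tsum fun n => (measurable_const.indicator (hSm n)).aemeasurable,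
    ← ENNReal.ofReal_mul (by positivity), ← ENNReal.ofReal_mul (by positivity),
    ← ENNReal.ofReal_mul (by positivity)]
  have hga := mul_nonneg (Real.exp_pos (-p.γ * (δ 0 + φ q.down) + p.kap * p.Q ^ 2 * h)).le (h1 hra)
  have hgb := mul_nonneg (Real.exp_pos (-p.γ * (δ 1 + φ q.up) + p.kap * p.Q ^ 2 * h)).le (h1 hrb)
  rw [ENNReal.ofReal_add (by positivity) (by positivity),
    ENNReal.ofReal_add (by positivity) hgb, ENNReal.ofReal_add (by positivity) hga]
  gcongr
  refine (ENNReal.tsum_le_tsum hterm).trans (le_of_eq ?_)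
  rw [ENNReal.tsum_mul_left, ENNReal.tsum_geometric, ENNReal.one_sub_inv_two, inv_inv, mul_comm,
    ENNReal.ofReal_mul (p := 2) (by norm_num), ENNReal.ofReal_ofNat]

/-- Lower bound for the exponential moment: only paths with at most one fill are counted. -/
theorem le_expMoment_add (ha : 0 ≤ a) (haΛ : a ≤ Λ) (hb : 0 ≤ b) (hbΛ : b ≤ Λ) (hh : 0 ≤ h)
    (hsmall : 2 * Λ * h < 1) :
    ENNReal.ofReal
      (Real.exp (-p.γ * φ q + p.kap * (q : ℝ) ^ 2 * h)
          * Real.exp (-((effAsk q a + effBid q b) * h))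
        + Real.exp (-p.γ * (δ 0 + φ q.down))
          * ((1 - Real.exp (-(effAsk q a * h))) * Real.exp (-(effBid q b * h)))
        + Real.exp (-p.γ * (δ 1 + φ q.up))
          * ((1 - Real.exp (-(effBid q b * h))) * Real.exp (-(effAsk q a * h)))) ≤
    expMoment B a b δ q h φ + ENNReal.ofReal ((Real.exp (-p.γ * (δ 0 + φ q.down))
      + Real.exp (-p.γ * (δ 1 + φ q.up))) * (2 * Λ * h) ^ 2) := by
  obtain ⟨hm0, -, -, hmA, hmB⟩ := measure_pathWait B ha haΛ hb hbΛ q hh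
  obtain ⟨hra, -⟩ := effAsk_mem q ha haΛ
  obtain ⟨hrb, -⟩ := effBid_mem q hb hbΛ
  have h1 : ∀ {r : ℝ}, 0 ≤ r → 0 ≤ 1 - Real.exp (-(r * h)) := fun hr => by
    have := Real.exp_le_one_iff.2 (neg_nonpos.2 (mul_nonneg hr hh))
    linarith
  have h1a := h1 hra
  have h1b := h1 hrb
  set g0 := Real.exp (-p.γ * φ q + p.kap * (q : ℝ) ^ 2 * h) with hg0
  set gA := Real.exp (-p.γ * (δ 0 + φ q.down)) with hgA
  set gB := Real.exp (-p.γ * (δ 1 + φ q.up)) with hgB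
  set S0 := {ω | ENNReal.ofReal h < pathTime a b q (B.clocks ω) 1} with hS0
  set SA := {ω | pathAskWait a (B.clocks ω) 0 q ≤ ENNReal.ofReal h ∧
          ENNReal.ofReal h < pathBidWait b (B.clocks ω) 0 q} with hSA
  set SB := {ω | pathBidWait b (B.clocks ω) 0 q ≤ ENNReal.ofReal h ∧
          ENNReal.ofReal h < pathAskWait a (B.clocks ω) 0 q} with hSB
  set S2 := {ω | pathTime a b q (B.clocks ω) 2 ≤ ENNReal.ofReal h} with hS2
  have hS0m : MeasurableSet S0 :=
    measurableSet_lt measurable_const (measurable_pathTime_clocks B a b q 1)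
  have hSAm : MeasurableSet SA :=
    (measurableSet_le (measurable_pathAskWait_clocks B a q) measurable_const).inter
      (measurableSet_lt measurable_const (measurable_pathBidWait_clocks B b q))
  have hSBm : MeasurableSet SB :=
    (measurableSet_le (measurable_pathBidWait_clocks B b q) measurable_const).inter
      (measurableSet_lt measurable_const (measurable_pathAskWait_clocks B a q))
  have hS2m : MeasurableSet S2 :=
    measurableSet_le (measurable_pathTime_clocks B a b q 2) measurable_const
  have hpt : ∀ᵐ ω ∂P,
      S0.indicator (fun _ => ENNReal.ofReal g0) ω + SA.indicator (fun _ => ENNReal.ofReal gA) ω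
        + SB.indicator (fun _ => ENNReal.ofReal gB) ω ≤
      ∫⁻ ω', ENNReal.ofReal (Real.exp (-p.γ *
        pathReward p a b δ q h φ (B.clocks ω) (gridEval fun t => B.W t ω'))) ∂P
        + S2.indicator (fun _ => ENNReal.ofReal (gA + gB)) ω := by
    filter_upwards [B.ae_exists_pathTime q ha haΛ hb hbΛ hh hsmall] with ω ⟨n, hn1, hn2⟩
    obtain ⟨v, hv0, hv1, hvn, hv⟩ := exists_lintegral_exp_pathReward B.isBrownian B.measurable_W
      δ hh φ hn1 hn2
    rw [hv]
    have ht1 : pathTime a b q (B.clocks ω) 1 =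
        min (pathAskWait a (B.clocks ω) 0 q) (pathBidWait b (B.clocks ω) 0 q) := by
      rw [pathTime_succ, pathTime_zero, pathState_zero, zero_add]
    by_cases hn0 : n = 0
    · subst hn0
      have hmem : ω ∈ S0 := hn2
      rw [zero_add, ht1, lt_min_iff] at hn2
      have hA : ω ∉ SA := fun h => absurd h.1 (not_le.2 hn2.1)
      have hB : ω ∉ SB := fun h => absurd h.1 (not_le.2 hn2.2)
      rw [indicator_of_mem hmem, indicator_of_notMem hA, indicator_of_notMem hB, hvn rfl]
      refine le_trans (le_of_eq ?_) le_self_add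
      simp [pathGain, hg0]
    have h0 : ω ∉ S0 := fun h => absurd (h.trans_le (pathTime_mono a b q _ (by omega : 1 ≤ n)))
      (not_lt.2 hn1)
    rw [indicator_of_notMem h0, zero_add]
    by_cases hn : n = 1
    · subst hn
      by_cases hask : PathAsk a b q (B.clocks ω) 0
      · have hask' := hask
        rw [PathAsk, pathState_zero] at hask'
        have hB : ω ∉ SB := fun h => absurd (h.1.trans_lt h.2) (not_lt.2 hask')
        rw [indicator_of_notMem hB, add_zero]
        refine (indicator_le_self' (fun _ _ => zero_le) ω).trans
          (le_trans (ENNReal.ofReal_le_ofReal ?_) le_self_add)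
        simp only [pathGain, Finset.range_one, Finset.sum_singleton, hask, if_true, hgA,
          pathState_succ, pathState_zero]
        exact Real.exp_le_exp.2 (by linarith)
      · have hask' := hask
        rw [PathAsk, pathState_zero] at hask'
        have hA : ω ∉ SA := fun h => hask' (h.1.trans h.2.le)
        rw [indicator_of_notMem hA, zero_add]
        refine (indicator_le_self' (fun _ _ => zero_le) ω).trans
          (le_trans (ENNReal.ofReal_le_ofReal ?_) le_self_add)
        simp only [pathGain, Finset.range_one, Finset.sum_singleton, hask, if_false, hgB,
          pathState_succ, pathState_zero]
        exact Real.exp_le_exp.2 (by linarith)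
    · have h2 : ω ∈ S2 := (pathTime_mono a b q _ (by omega : 2 ≤ n)).trans hn1
      rw [indicator_of_mem h2, ENNReal.ofReal_add (by positivity) (by positivity)]
      refine le_trans ?_ le_add_self
      gcongr <;> exact indicator_le_self' (fun _ _ => zero_le) ω
  have hint := lintegral_mono_ae hpt
  rw [lintegral_add_right _ (measurable_const.indicator hS2m),
    lintegral_add_right _ (measurable_const.indicator hSBm),
    lintegral_add_right _ (measurable_const.indicator hSAm), lintegral_indicator_const hS0m,
    lintegral_indicator_const hSAm, lintegral_indicator_const hSBm,
    lintegral_indicator_const hS2m, hm0, hmA, hmB,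
    ← ENNReal.ofReal_mul (by positivity), ← ENNReal.ofReal_mul (by positivity),
    ← ENNReal.ofReal_mul (by positivity), ← ENNReal.ofReal_add (by positivity) (by positivity),
    ← ENNReal.ofReal_add (by positivity) (by positivity)] at hint
  refine hint.trans ?_
  unfold expMoment
  gcongr
  rw [ENNReal.ofReal_mul (by positivity)]
  gcongr
  exact B.measure_pathTime_le q ha haΛ hb hbΛ hh 2

end MomentBounds

/-! ### The one-step expansion of the score -/

/-- Second-order Taylor estimate for the bounds obtained by counting fills. -/
theorem abs_sub_one_add_le_of_fill_bounds {k κ ra rb αa αb α Λ h z F : ℝ} (hk : 0 ≤ k)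
    (hkκ : k ≤ κ) (hra : 0 ≤ ra) (hraΛ : ra ≤ Λ) (hrb : 0 ≤ rb) (hrbΛ : rb ≤ Λ) (hαa : 0 ≤ αa)
    (hαaα : αa ≤ α) (hαb : 0 ≤ αb) (hαbα : αb ≤ α) (hh : 0 ≤ h) (hF : 0 ≤ F)
    (hsmall : (κ + 2 * Λ) * h ≤ 1)
    (hup : z ≤ Real.exp (k * h) * Real.exp (-((ra + rb) * h))
      + αa * Real.exp (κ * h) * (1 - Real.exp (-(ra * h)))
      + αb * Real.exp (κ * h) * (1 - Real.exp (-(rb * h))) + F * h ^ 2)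
    (hlow : Real.exp (k * h) * Real.exp (-((ra + rb) * h))
      + αa * ((1 - Real.exp (-(ra * h))) * Real.exp (-(rb * h)))
      + αb * ((1 - Real.exp (-(rb * h))) * Real.exp (-(ra * h)))
      - (αa + αb) * (2 * Λ * h) ^ 2 ≤ z) :
    |z - (1 + (k - ra - rb + ra * αa + rb * αb) * h)| ≤
      ((κ + 2 * Λ) ^ 2 + 4 * α * κ * Λ + 12 * α * Λ ^ 2 + F) * h ^ 2 := by
  have hκ : 0 ≤ κ := hk.trans hkκ
  have hΛ : 0 ≤ Λ := hra.trans hraΛ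
  have hα : 0 ≤ α := hαa.trans hαaα
  have hκh : κ * h ≤ 1 := by nlinarith [mul_nonneg hΛ hh]
  have hΛh : Λ * h ≤ 1 := by nlinarith [mul_nonneg hκ hh, mul_nonneg hΛ hh]
  have hm : |(k - ra - rb) * h| ≤ (κ + 2 * Λ) * h := by
    rw [abs_mul, abs_of_nonneg hh]
    gcongr
    exact abs_le.2 ⟨by linarith, by linarith⟩
  have he0 : Real.exp (k * h) * Real.exp (-((ra + rb) * h)) = Real.exp ((k - ra - rb) * h) := by
    rw [← Real.exp_add]; congr 1; ring
  rw [he0] at hup hlow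
  have hexp := abs_le.1 (Real.abs_exp_sub_one_sub_id_le (hm.trans hsmall))
  have hmsq : ((k - ra - rb) * h) ^ 2 ≤ (κ + 2 * Λ) ^ 2 * h ^ 2 := by
    rw [← mul_pow, ← sq_abs]
    gcongr
  have hE1 : Real.exp (κ * h) ≤ 1 + 2 * κ * h := by
    have := Real.abs_exp_sub_one_le (x := κ * h) (by rwa [abs_of_nonneg (by positivity)])
    rw [abs_of_nonneg (by positivity : 0 ≤ κ * h)] at this
    linarith [(abs_le.1 this).2]
  -- the bounds for one side, with the intensity `r` of this side and the intensity `s` of the other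
  have hside : ∀ {r s β : ℝ}, 0 ≤ r → r ≤ Λ → 0 ≤ s → s ≤ Λ → 0 ≤ β → β ≤ α →
      β * Real.exp (κ * h) * (1 - Real.exp (-(r * h))) ≤ r * β * h + 2 * α * κ * Λ * h ^ 2 ∧
      r * β * h - 2 * α * Λ ^ 2 * h ^ 2 ≤
        β * ((1 - Real.exp (-(r * h))) * Real.exp (-(s * h))) := by
    intro r s β hr hrΛ hs hsΛ hβ hβα
    have hrh : r * h ≤ 1 := le_trans (by gcongr) hΛh
    have hsh : s * h ≤ 1 := le_trans (by gcongr) hΛh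
    have hrh0 : 0 ≤ r * h := by positivity
    have h1 : 1 - Real.exp (-(r * h)) ≤ r * h := by linarith [Real.add_one_le_exp (-(r * h))]
    have h2 : 1 - r * h + (r * h) ^ 2 ≥ Real.exp (-(r * h)) := by
      have := (abs_le.1 (Real.abs_exp_sub_one_sub_id_le (x := -(r * h))
        (by rwa [abs_neg, abs_of_nonneg hrh0]))).2
      linarith [neg_sq (r * h)]
    have h3 : 1 - s * h ≤ Real.exp (-(s * h)) := by linarith [Real.add_one_le_exp (-(s * h))]
    constructor
    · calc β * Real.exp (κ * h) * (1 - Real.exp (-(r * h)))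
          ≤ β * (1 + 2 * κ * h) * (r * h) := by
            have : 0 ≤ 1 - Real.exp (-(r * h)) := by
              have := Real.exp_le_one_iff.2 (neg_nonpos.2 hrh0)
              linarith
            gcongr
        _ = r * β * h + 2 * β * κ * r * h ^ 2 := by ring
        _ ≤ _ := by gcongr
    · have h4 : (r * h - (r * h) ^ 2) * (1 - s * h) ≤
          (1 - Real.exp (-(r * h))) * Real.exp (-(s * h)) := by
        apply mul_le_mul (by linarith) h3 (by linarith)
        linarith [Real.exp_le_one_iff.2 (neg_nonpos.2 hrh0)]
      have h5 : r * h - 2 * Λ ^ 2 * h ^ 2 ≤ (r * h - (r * h) ^ 2) * (1 - s * h) := by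
        have e1 : (r * h) ^ 2 ≤ (Λ * h) ^ 2 := by gcongr
        have e2 : (r * h) * (s * h) ≤ (Λ * h) * (Λ * h) := by gcongr
        have e3 : 0 ≤ (r * h) ^ 2 * (s * h) := by positivity
        nlinarith
      calc r * β * h - 2 * α * Λ ^ 2 * h ^ 2 ≤ r * β * h - 2 * β * Λ ^ 2 * h ^ 2 := by
            have : 2 * β * Λ ^ 2 * h ^ 2 ≤ 2 * α * Λ ^ 2 * h ^ 2 := by gcongr
            linarith
        _ = β * (r * h - 2 * Λ ^ 2 * h ^ 2) := by ring
        _ ≤ _ := mul_le_mul_of_nonneg_left (h5.trans h4) hβ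
  obtain ⟨ua, la⟩ := hside hra hraΛ hrb hrbΛ hαa hαaα
  obtain ⟨ub, lb⟩ := hside hrb hrbΛ hra hraΛ hαb hαbα
  have hlast : (αa + αb) * (2 * Λ * h) ^ 2 ≤ 8 * α * Λ ^ 2 * h ^ 2 := by
    calc (αa + αb) * (2 * Λ * h) ^ 2 ≤ (α + α) * (2 * Λ * h) ^ 2 := by gcongr
      _ = _ := by ring
  have p1 : 0 ≤ α * κ * Λ * h ^ 2 := by positivity
  have p2 : 0 ≤ α * Λ ^ 2 * h ^ 2 := by positivity
  have p3 : 0 ≤ F * h ^ 2 := by positivity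
  rw [abs_le]
  constructor
  · linarith [hexp.1]
  · linarith [hexp.2]

/-- If `z` is `1 - x` up to second order in `h`, then `log z` is `-x` up to second order in `h`. -/
theorem abs_log_add_le {z x E X h : ℝ} (hh : 0 ≤ h) (hh1 : h ≤ 1) (hE : 0 ≤ E)
    (hz : |z - (1 - x)| ≤ E * h ^ 2) (hx : |x| ≤ X * h) (hsmall : (X + E) * h ≤ 1 / 2) :
    0 < z ∧ |Real.log z + x| ≤ (E + 2 * (X + E) ^ 2) * h ^ 2 := by
  have hw : |z - 1| ≤ (X + E) * h := by
    calc |z - 1| = |(z - (1 - x)) + (-x)| := by congr 1; ring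
      _ ≤ E * h ^ 2 + X * h := (abs_add_le _ _).trans (add_le_add hz (by rwa [abs_neg]))
      _ ≤ (X + E) * h := by nlinarith [mul_nonneg hE hh]
  have hw' := abs_le.1 (hw.trans hsmall)
  have hz0 : 0 < z := by linarith [hw'.1]
  have hsq : (z - 1) ^ 2 ≤ (X + E) ^ 2 * h ^ 2 := by
    rw [← mul_pow, ← sq_abs]
    gcongr
  have h1 := Real.log_le_sub_one_of_pos hz0
  have h2 : z - 1 - 2 * (z - 1) ^ 2 ≤ Real.log z := by
    refine le_trans ?_ (Real.one_sub_inv_le_log_of_pos hz0)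
    have h3 : 1 - z⁻¹ = (z - 1) / z := by field_simp
    rw [h3, le_div_iff₀ hz0]
    nlinarith [sq_nonneg (z - 1), hw'.1]
  have hz' := abs_le.1 hz
  have p1 : 0 ≤ (X + E) ^ 2 * h ^ 2 := by positivity
  refine ⟨hz0, abs_le.2 ⟨?_, ?_⟩⟩
  · linarith [hz'.1]
  · linarith [hz'.2]

/-- A bound for the absolute value of quotes in `A`. -/
def Params.D (p : Params) : ℝ := max |p.lo| |p.hi|

theorem Params.abs_le_D {p : Params} {δ : Quote} (hδ : δ ∈ p.A) (i : Fin 2) : |δ i| ≤ p.D :=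
  abs_le_max_abs_abs (hδ i).1 (hδ i).2

theorem Params.D_nonneg (p : Params) : 0 ≤ p.D := (abs_nonneg p.lo).trans (le_max_left _ _)

/-- The Hamiltonian in terms of the rates of fills: `-γ H` is the first-order coefficient in `h` of
`exp (γ φ_q)` times the exponential moment. -/
theorem Market.mul_H {p : Params} (M : Market p) (q : Inv p.Q) (φ : Inv p.Q → ℝ) (δ : Quote) :
    p.γ * M.H q φ δ = -(p.kap * (q : ℝ) ^ 2 - effAsk q (M.Λa (δ 0)) - effBid q (M.Λb (δ 1))
      + effAsk q (M.Λa (δ 0)) * Real.exp (-p.γ * (δ 0 + φ q.down - φ q))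
      + effBid q (M.Λb (δ 1)) * Real.exp (-p.γ * (δ 1 + φ q.up - φ q))) := by
  have hγ := p.γ_pos.ne'
  simp only [Market.H, Market.askRate, Market.bidRate, Market.askIncr, Market.bidIncr, effAsk,
    effBid, Params.kap]
  split_ifs <;> field_simp <;> ring

/-- The one-step consistency estimate: on bounded sets of terminal data, the score is
`φ_q + h H_q(φ, δ)` up to an error of order `h²`, uniformly in the quote, the market and the
noise. -/
theorem exists_abs_score_sub_le (p : Params) (K : ℝ) : ∃ E ≥ 0, ∃ h₀ > 0,
    ∀ (M : Market p) (Ω : Type*) [MeasurableSpace Ω] (P : Measure Ω) (B : Noise Ω P),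
      ∀ δ ∈ p.A, ∀ (q : Inv p.Q) (φ : Inv p.Q → ℝ) (h : ℝ), (∀ r, |φ r| ≤ K) → 0 ≤ h → h ≤ h₀ →
        |score M B δ q h φ - φ q - h * M.H q φ δ| ≤ E * h ^ 2 := by
  have hγ := p.γ_pos
  have hκ0 := p.kap_nonneg
  have hD := p.D_nonneg
  set Λ : ℝ := |p.Λbar|
  set κ : ℝ := p.kap * p.Q ^ 2
  set α : ℝ := Real.exp (p.γ * (p.D + 2 * |K|))
  set F : ℝ := 2 * (Real.exp (p.γ * (2 * |K|) + 1) * (2 * Λ * Real.exp (p.γ * p.D)) ^ 2)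
  set E : ℝ := (κ + 2 * Λ) ^ 2 + 4 * α * κ * Λ + 12 * α * Λ ^ 2 + F
  set X : ℝ := κ + 2 * Λ + 2 * Λ * α
  have hΛ : 0 ≤ Λ := abs_nonneg _
  have hκ : 0 ≤ κ := by positivity
  have hα : 0 ≤ α := by positivity
  have hF : 0 ≤ F := by positivity
  have hE : 0 ≤ E := by positivity
  have hX : 0 ≤ X := by positivity
  set S : ℝ := 1 + (κ + 2 * Λ) + 4 * Λ * Real.exp (p.γ * p.D) + 2 * (X + E)
  have hS : 0 < S := by positivity
  refine ⟨1 / p.γ * (E + 2 * (X + E) ^ 2), by positivity, 1 / S, by positivity, ?_⟩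
  intro M Ω _ P B δ hδ q φ h hφ hh hh0
  have hhS : h * S ≤ 1 := by rwa [le_div_iff₀ hS] at hh0
  have e1 : 0 ≤ h * (κ + 2 * Λ) := by positivity
  have e2 : 0 ≤ h * (4 * Λ * Real.exp (p.γ * p.D)) := by positivity
  have e3 : 0 ≤ h * (2 * (X + E)) := by positivity
  have hhS' : h + h * (κ + 2 * Λ) + h * (4 * Λ * Real.exp (p.γ * p.D)) + h * (2 * (X + E)) ≤ 1 := by
    have : h * S = h + h * (κ + 2 * Λ) + h * (4 * Λ * Real.exp (p.γ * p.D))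
        + h * (2 * (X + E)) := by ring
    linarith
  have hh1 : h ≤ 1 := by linarith
  have hs1 : (κ + 2 * Λ) * h ≤ 1 := by linarith
  have hs2 : 2 * Λ * h * Real.exp (p.γ * p.D) ≤ 1 / 2 := by linarith
  have hs3 : (X + E) * h ≤ 1 / 2 := by linarith
  have hκh : κ * h ≤ 1 := by linarith [mul_nonneg hΛ hh]
  have hφ' : ∀ r, |φ r| ≤ |K| := fun r => (hφ r).trans (le_abs_self K)
  obtain ⟨ha, haΛ'⟩ := M.Λa_mem _ (hδ 0)
  obtain ⟨hb, hbΛ'⟩ := M.Λb_mem _ (hδ 1)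
  have haΛ : M.Λa (δ 0) ≤ Λ := haΛ'.trans (le_abs_self _)
  have hbΛ : M.Λb (δ 1) ≤ Λ := hbΛ'.trans (le_abs_self _)
  have hexp1 : 1 ≤ Real.exp (p.γ * p.D) := Real.one_le_exp (by positivity)
  have hs4 : 2 * Λ * h < 1 := by
    have : 2 * Λ * h ≤ 2 * Λ * h * Real.exp (p.γ * p.D) :=
      le_mul_of_one_le_right (by positivity) hexp1
    linarith
  have hup := expMoment_le B (q := q) ha haΛ hb hbΛ hh (Params.abs_le_D hδ) hφ' hs2
  have hlow := le_expMoment_add B (q := q) (δ := δ) (φ := φ) ha haΛ hb hbΛ hh hs4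
  obtain ⟨hra, hraΛ⟩ := effAsk_mem q ha haΛ
  obtain ⟨hrb, hrbΛ⟩ := effBid_mem q hb hbΛ
  set Z := expMoment B (M.Λa (δ 0)) (M.Λb (δ 1)) δ q h φ with hZ
  set ra := effAsk q (M.Λa (δ 0)) with hra_def
  set rb := effBid q (M.Λb (δ 1)) with hrb_def
  have hZtop : Z ≠ ∞ := ne_top_of_le_ne_top ENNReal.ofReal_ne_top hup
  set k := p.kap * (q : ℝ) ^ 2 with hk_def
  have hk : 0 ≤ k := by positivity
  have hkκ : k ≤ κ := mul_le_mul_of_nonneg_left (Inv.sq_le q) hκ0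
  set αa := Real.exp (-p.γ * (δ 0 + φ q.down - φ q)) with hαa_def
  set αb := Real.exp (-p.γ * (δ 1 + φ q.up - φ q)) with hαb_def
  have hαle : ∀ (x : ℝ) (r : Inv p.Q), |x| ≤ p.D → Real.exp (-p.γ * (x + φ r - φ q)) ≤ α := by
    intro x r hx
    refine Real.exp_le_exp.2 ?_
    rw [neg_mul, ← mul_neg]
    refine mul_le_mul_of_nonneg_left ?_ hγ.le
    linarith [(abs_le.1 hx).1, (abs_le.1 (hφ' r)).1, (abs_le.1 (hφ' q)).2]
  have hαaα : αa ≤ α := hαle _ _ (Params.abs_le_D hδ 0)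
  have hαbα : αb ≤ α := hαle _ _ (Params.abs_le_D hδ 1)
  set A0 := Real.exp (p.γ * φ q) with hA0
  have hA0pos : 0 < A0 := Real.exp_pos _
  set z := A0 * Z.toReal with hz
  have hone : ∀ {r : ℝ}, 0 ≤ r → 0 ≤ 1 - Real.exp (-(r * h)) := fun hr => by
    have := Real.exp_le_one_iff.2 (neg_nonpos.2 (mul_nonneg hr hh))
    linarith
  have h1a := hone hra
  have h1b := hone hrb
  have c0 : A0 * Real.exp (-p.γ * φ q + k * h) = Real.exp (k * h) := by
    rw [hA0, ← Real.exp_add]; congr 1; ring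
  have ca : A0 * Real.exp (-p.γ * (δ 0 + φ q.down)) = αa := by
    rw [hA0, hαa_def, ← Real.exp_add]; congr 1; ring
  have cb : A0 * Real.exp (-p.γ * (δ 1 + φ q.up)) = αb := by
    rw [hA0, hαb_def, ← Real.exp_add]; congr 1; ring
  have hup' : z ≤ Real.exp (k * h) * Real.exp (-((ra + rb) * h))
      + αa * Real.exp (κ * h) * (1 - Real.exp (-(ra * h)))
      + αb * Real.exp (κ * h) * (1 - Real.exp (-(rb * h))) + F * h ^ 2 := by
    have h1 := ENNReal.toReal_mono ENNReal.ofReal_ne_top hup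
    rw [ENNReal.toReal_ofReal (by positivity)] at h1
    have h2 := mul_le_mul_of_nonneg_left h1 hA0pos.le
    refine h2.trans ?_
    have e : A0 * (Real.exp (-p.γ * φ q + k * h) * Real.exp (-((ra + rb) * h))
        + Real.exp (-p.γ * (δ 0 + φ q.down) + κ * h) * (1 - Real.exp (-(ra * h)))
        + Real.exp (-p.γ * (δ 1 + φ q.up) + κ * h) * (1 - Real.exp (-(rb * h)))
        + 2 * (Real.exp (p.γ * |K| + κ * h) * (2 * Λ * h * Real.exp (p.γ * p.D)) ^ 2)) =
        Real.exp (k * h) * Real.exp (-((ra + rb) * h))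
        + αa * Real.exp (κ * h) * (1 - Real.exp (-(ra * h)))
        + αb * Real.exp (κ * h) * (1 - Real.exp (-(rb * h)))
        + A0 * (2 * (Real.exp (p.γ * |K| + κ * h) * (2 * Λ * h * Real.exp (p.γ * p.D)) ^ 2)) := by
      rw [← c0, ← ca, ← cb, Real.exp_add _ (κ * h), Real.exp_add _ (κ * h)]
      ring
    refine e.le.trans (add_le_add le_rfl ?_)
    have h3 : A0 * Real.exp (p.γ * |K| + κ * h) ≤ Real.exp (p.γ * (2 * |K|) + 1) := by
      rw [hA0, ← Real.exp_add]
      refine Real.exp_le_exp.2 ?_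
      have := mul_le_mul_of_nonneg_left (abs_le.1 (hφ' q)).2 hγ.le
      linarith
    calc A0 * (2 * (Real.exp (p.γ * |K| + κ * h) * (2 * Λ * h * Real.exp (p.γ * p.D)) ^ 2))
        = 2 * ((A0 * Real.exp (p.γ * |K| + κ * h)) * (2 * Λ * Real.exp (p.γ * p.D)) ^ 2) * h ^ 2 := by
          ring
      _ ≤ F * h ^ 2 := by
          simp only [F]
          gcongr
  have hlow' : Real.exp (k * h) * Real.exp (-((ra + rb) * h))
      + αa * ((1 - Real.exp (-(ra * h))) * Real.exp (-(rb * h)))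
      + αb * ((1 - Real.exp (-(rb * h))) * Real.exp (-(ra * h)))
      - (αa + αb) * (2 * Λ * h) ^ 2 ≤ z := by
    rw [← ENNReal.ofReal_toReal hZtop, ← ENNReal.ofReal_add ENNReal.toReal_nonneg (by positivity)]
      at hlow
    have h1 := (ENNReal.ofReal_le_ofReal_iff (by positivity)).1 hlow
    have h2 := mul_le_mul_of_nonneg_left h1 hA0pos.le
    rw [← c0, ← ca, ← cb, hz]
    linarith
  have hexp := abs_sub_one_add_le_of_fill_bounds hk hkκ hra hraΛ hrb hrbΛ (Real.exp_pos _).le hαaα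
    (Real.exp_pos _).le hαbα hh hF hs1 hup' hlow'
  have hmulH : p.γ * M.H q φ δ = -(k - ra - rb + ra * αa + rb * αb) := M.mul_H q φ δ
  have hx : |h * (p.γ * M.H q φ δ)| ≤ X * h := by
    rw [abs_mul, abs_of_nonneg hh, mul_comm]
    gcongr
    rw [hmulH, abs_neg]
    have u1 : ra * αa ≤ Λ * α := by gcongr
    have u2 : rb * αb ≤ Λ * α := by gcongr
    have u3 : 0 ≤ ra * αa := by positivity
    have u4 : 0 ≤ rb * αb := by positivity
    have u5 : 0 ≤ Λ * α := by positivity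
    have hXd : X = κ + 2 * Λ + 2 * Λ * α := rfl
    exact abs_le.2 ⟨by linarith, by linarith⟩
  have hz1 : |z - (1 - h * (p.γ * M.H q φ δ))| ≤ E * h ^ 2 := by
    rw [hmulH]
    convert hexp using 2
    ring
  obtain ⟨hzpos, hlog⟩ := abs_log_add_le hh hh1 hE hz1 hx hs3
  have hZpos : 0 < Z.toReal := pos_of_mul_pos_right hzpos hA0pos.le
  have hlogz : Real.log z = p.γ * φ q + Real.log Z.toReal := by
    rw [hz, Real.log_mul hA0pos.ne' hZpos.ne', hA0, Real.log_exp]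
  have hscore : score M B δ q h φ - φ q - h * M.H q φ δ =
      -(1 / p.γ) * (Real.log z + h * (p.γ * M.H q φ δ)) := by
    rw [score_eq_log_expMoment, ← hZ, hlogz]
    field_simp
    ring
  rw [hscore, abs_mul, abs_neg, abs_of_pos (by positivity), mul_assoc]
  gcongr

theorem Params.mem_A {p : Params} {δ : Quote} : δ ∈ p.A ↔ ∀ i, δ i ∈ Icc p.lo p.hi := Iff.rfl

theorem Params.A_eq_iInter (p : Params) :
    p.A = ⋂ i, (fun δ : Quote => δ i) ⁻¹' Icc p.lo p.hi := by
  ext δ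
  simp [Params.mem_A]

theorem Params.measurableSet_A (p : Params) : MeasurableSet p.A := by
  rw [p.A_eq_iInter]
  exact MeasurableSet.iInter fun i => measurableSet_Icc.preimage (by fun_prop)

/-- The score is a measurable function of the quote up to null sets, for any measure that charges
only `A`, where the intensities are continuous. -/
theorem aestronglyMeasurable_score {p : Params} (M : Market p) {Ω : Type*} [MeasurableSpace Ω]
    {P : Measure Ω} (B : Noise Ω P) (q : Inv p.Q) (h : ℝ) (φ : Inv p.Q → ℝ) {ρ : Measure Quote}
    (hρ : ρ ≪ volume.restrict p.A) :
    AEStronglyMeasurable (fun δ => score M B δ q h φ) ρ := by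
  have hA := p.measurableSet_A
  have hcont : ∀ (Λ : ℝ → ℝ), ContinuousOn Λ (Icc p.lo p.hi) → ∀ i : Fin 2,
      AEMeasurable (fun δ : Quote => Λ (δ i)) (volume.restrict p.A) := fun Λ hΛ i =>
    (hΛ.comp (by fun_prop : Continuous fun δ : Quote => δ i).continuousOn
      fun _ hδ => Params.mem_A.1 hδ i).aemeasurable hA
  have hm : AEMeasurable (fun δ : Quote => (M.Λa (δ 0), M.Λb (δ 1), δ)) (volume.restrict p.A) :=
    (hcont _ M.contDiffOn_Λa.continuousOn 0).prodMk
      ((hcont _ M.contDiffOn_Λb.continuousOn 1).prodMk aemeasurable_id)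
  have hf : Measurable fun x : ℝ × ℝ × Quote =>
      -(1 / p.γ) * Real.log (expMoment B x.1 x.2.1 x.2.2 q h φ).toReal :=
    (Real.measurable_log.comp (measurable_expMoment B q h φ).ennreal_toReal).const_mul _
  have heq : (fun δ => score M B δ q h φ) =
      (fun x : ℝ × ℝ × Quote =>
        -(1 / p.γ) * Real.log (expMoment B x.1 x.2.1 x.2.2 q h φ).toReal) ∘
      fun δ : Quote => (M.Λa (δ 0), M.Λb (δ 1), δ) :=
    funext fun δ => score_eq_log_expMoment B M δ q h φ
  rw [heq]
  exact (hf.comp_aemeasurable hm).aestronglyMeasurable.mono_ac hρ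

/-! ### Regularity of the Hamiltonians -/

theorem Params.isCompact_A (p : Params) : IsCompact p.A := by
  have h : p.A = (EuclideanSpace.equiv (Fin 2) ℝ).toHomeomorph ⁻¹'
      Set.pi univ fun _ => Icc p.lo p.hi := by
    ext δ
    simp only [Params.mem_A, mem_preimage, mem_pi, mem_univ, true_imp_iff]
    rfl
  rw [h]
  exact (Homeomorph.isCompact_preimage _).2 (isCompact_univ_pi fun _ => isCompact_Icc)

theorem Params.A_nonempty (p : Params) : p.A.Nonempty :=
  ⟨!₂[p.lo, p.lo], Params.mem_A.2 fun i => by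
    fin_cases i <;> simp [p.lo_lt_hi.le]⟩

theorem abs_exp_sub_exp_le {x y m : ℝ} (hx : x ≤ m) (hy : y ≤ m) :
    |Real.exp x - Real.exp y| ≤ Real.exp m * |x - y| := by
  wlog hxy : y ≤ x generalizing x y
  · rw [abs_sub_comm, abs_sub_comm x]
    exact this hy hx (le_of_not_ge hxy)
  rw [abs_of_nonneg (sub_nonneg.2 (Real.exp_le_exp.2 hxy)), abs_of_nonneg (sub_nonneg.2 hxy)]
  have h1 : Real.exp y = Real.exp x * Real.exp (y - x) := by rw [← Real.exp_add]; ring_nf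
  have h2 := Real.add_one_le_exp (y - x)
  calc Real.exp x - Real.exp y = Real.exp x * (1 - Real.exp (y - x)) := by rw [h1]; ring
    _ ≤ Real.exp x * (x - y) := mul_le_mul_of_nonneg_left (by linarith) (Real.exp_pos _).le
    _ ≤ _ := mul_le_mul_of_nonneg_right (Real.exp_le_exp.2 hx) (sub_nonneg.2 hxy)

theorem abs_intensity_sub_le {p : Params} {Λ : ℝ → ℝ} (hΛ : ContDiffOn ℝ 1 Λ (Icc p.lo p.hi))
    (hL : ∀ x ∈ Icc p.lo p.hi, |derivWithin Λ (Icc p.lo p.hi) x| ≤ p.L) {x y : ℝ}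
    (hx : x ∈ Icc p.lo p.hi) (hy : y ∈ Icc p.lo p.hi) : |Λ x - Λ y| ≤ |p.L| * |x - y| :=
  (Convex.norm_image_sub_le_of_norm_derivWithin_le (hΛ.differentiableOn one_ne_zero) hL
    (convex_Icc _ _) hy hx).trans (mul_le_mul_of_nonneg_right (le_abs_self _) (abs_nonneg _))

/-- On bounded sets of value vectors the Hamiltonian is bounded, and Lipschitz jointly in the value
vector and the quote, with a constant that depends on the parameters only. -/
theorem exists_H_bounds (p : Params) (K : ℝ) : ∃ C ≥ 0, ∀ (M : Market p) (q : Inv p.Q)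
    (y y' : Inv p.Q → ℝ) (δ δ' : Quote) (s e : ℝ), (∀ r, |y r| ≤ K) → (∀ r, |y' r| ≤ K) →
      (∀ r, |y r - y' r| ≤ s) → δ ∈ p.A → δ' ∈ p.A → (∀ i, |δ i - δ' i| ≤ e) →
      |M.H q y δ| ≤ C ∧ |M.H q y δ - M.H q y' δ'| ≤ C * (s + e) := by
  have hγ := p.γ_pos
  have hκ0 := p.kap_nonneg
  have hD := p.D_nonneg
  set Λ : ℝ := |p.Λbar|
  set κ : ℝ := p.kap * p.Q ^ 2
  set α : ℝ := Real.exp (p.γ * (p.D + 2 * |K|))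
  have hΛ : 0 ≤ Λ := abs_nonneg _
  have hκ : 0 ≤ κ := by positivity
  have hα : 0 ≤ α := by positivity
  set C₁ : ℝ := κ + 2 * Λ + 2 * Λ * α
  set C₂ : ℝ := 2 * (|p.L| * (1 + α) + Λ * α * (2 * p.γ))
  have hC₁ : 0 ≤ C₁ := by positivity
  have hC₂ : 0 ≤ C₂ := by positivity
  refine ⟨1 / p.γ * (C₁ + C₂), by positivity, ?_⟩
  intro M q y y' δ δ' s e hy hy' hs hδ hδ' he
  have hs0 : 0 ≤ s := (abs_nonneg _).trans (hs q)
  have he0 : 0 ≤ e := (abs_nonneg _).trans (he 0)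
  have hK : K ≤ |K| := le_abs_self K
  obtain ⟨hra, hraΛ⟩ := effAsk_mem q (M.Λa_mem _ (hδ 0)).1
    ((M.Λa_mem _ (hδ 0)).2.trans (le_abs_self p.Λbar))
  obtain ⟨hrb, hrbΛ⟩ := effBid_mem q (M.Λb_mem _ (hδ 1)).1
    ((M.Λb_mem _ (hδ 1)).2.trans (le_abs_self p.Λbar))
  obtain ⟨hra', hraΛ'⟩ := effAsk_mem q (M.Λa_mem _ (hδ' 0)).1
    ((M.Λa_mem _ (hδ' 0)).2.trans (le_abs_self p.Λbar))
  obtain ⟨hrb', hrbΛ'⟩ := effBid_mem q (M.Λb_mem _ (hδ' 1)).1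
    ((M.Λb_mem _ (hδ' 1)).2.trans (le_abs_self p.Λbar))
  have hda : |effAsk q (M.Λa (δ 0)) - effAsk q (M.Λa (δ' 0))| ≤ |p.L| * e := by
    unfold effAsk
    split_ifs
    · exact (abs_intensity_sub_le M.contDiffOn_Λa M.deriv_Λa_le (hδ 0) (hδ' 0)).trans
        (mul_le_mul_of_nonneg_left (he 0) (abs_nonneg _))
    · simpa using mul_nonneg (abs_nonneg _) he0
  have hdb : |effBid q (M.Λb (δ 1)) - effBid q (M.Λb (δ' 1))| ≤ |p.L| * e := by
    unfold effBid
    split_ifs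
    · exact (abs_intensity_sub_le M.contDiffOn_Λb M.deriv_Λb_le (hδ 1) (hδ' 1)).trans
        (mul_le_mul_of_nonneg_left (he 1) (abs_nonneg _))
    · simpa using mul_nonneg (abs_nonneg _) he0
  have hexpo : ∀ {x : ℝ} {w : Inv p.Q → ℝ} (r : Inv p.Q), |x| ≤ p.D → (∀ r, |w r| ≤ K) →
      -p.γ * (x + w r - w q) ≤ p.γ * (p.D + 2 * |K|) := by
    intro x w r hx hw
    rw [neg_mul, ← mul_neg]
    refine mul_le_mul_of_nonneg_left ?_ hγ.le
    linarith [(abs_le.1 hx).1, (abs_le.1 (hw r)).1, (abs_le.1 (hw q)).2]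
  -- one side of the book, with intensities `r`, `r'`, quotes `x`, `x'` and neighbour `n`
  have hside : ∀ {r r' x x' : ℝ} (n : Inv p.Q), 0 ≤ r → r ≤ Λ → 0 ≤ r' → r' ≤ Λ →
      |r - r'| ≤ |p.L| * e → |x| ≤ p.D → |x'| ≤ p.D → |x - x'| ≤ e →
      |(r - r * Real.exp (-p.γ * (x + y n - y q)))
        - (r' - r' * Real.exp (-p.γ * (x' + y' n - y' q)))| ≤
        (|p.L| * (1 + α) + Λ * α * (2 * p.γ)) * (s + e) := by
    intro r r' x x' n hr hrΛ hr' hrΛ' hrr hx hx' hxx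
    set E := Real.exp (-p.γ * (x + y n - y q)) with hE
    set E' := Real.exp (-p.γ * (x' + y' n - y' q)) with hE'
    have hEα : E ≤ α := Real.exp_le_exp.2 (hexpo n hx hy)
    have hE0 : 0 ≤ E := (Real.exp_pos _).le
    have hdE : |E - E'| ≤ α * (p.γ * (2 * s + e)) := by
      refine (abs_exp_sub_exp_le (hexpo n hx hy) (hexpo n hx' hy')).trans ?_
      refine mul_le_mul_of_nonneg_left ?_ hα
      rw [← mul_sub, abs_mul, abs_neg, abs_of_pos hγ]
      refine mul_le_mul_of_nonneg_left ?_ hγ.le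
      have e1 := abs_le.1 hxx
      have e2 := abs_le.1 (hs n)
      have e3 := abs_le.1 (hs q)
      exact abs_le.2 ⟨by linarith, by linarith⟩
    calc |(r - r * E) - (r' - r' * E')| = |(r - r') * (1 - E) + -(r' * (E - E'))| := by
          congr 1; ring
      _ ≤ |r - r'| * |1 - E| + r' * |E - E'| := by
          refine (abs_add_le _ _).trans (le_of_eq ?_)
          rw [abs_mul, abs_neg, abs_mul, abs_of_nonneg hr']
      _ ≤ (|p.L| * e) * (1 + α) + Λ * (α * (p.γ * (2 * s + e))) := by
          gcongr
          exact abs_le.2 ⟨by linarith, by linarith⟩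
      _ ≤ _ := by
          have t1 : 0 ≤ |p.L| * (1 + α) * s := by positivity
          have t2 : 0 ≤ Λ * α * p.γ * e := by positivity
          nlinarith
  have hA := M.mul_H q y δ
  have hB := M.mul_H q y' δ'
  have b1 := hside q.down hra hraΛ hra' hraΛ' hda (Params.abs_le_D hδ 0) (Params.abs_le_D hδ' 0)
    (he 0)
  have b2 := hside q.up hrb hrbΛ hrb' hrbΛ' hdb (Params.abs_le_D hδ 1) (Params.abs_le_D hδ' 1)
    (he 1)
  set Ea := Real.exp (-p.γ * (δ 0 + y q.down - y q)) with hEa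
  set Eb := Real.exp (-p.γ * (δ 1 + y q.up - y q)) with hEb
  have hEaα : Ea ≤ α := Real.exp_le_exp.2 (hexpo q.down (Params.abs_le_D hδ 0) hy)
  have hEbα : Eb ≤ α := Real.exp_le_exp.2 (hexpo q.up (Params.abs_le_D hδ 1) hy)
  have hEa0 : 0 ≤ Ea := (Real.exp_pos _).le
  have hEb0 : 0 ≤ Eb := (Real.exp_pos _).le
  have hk : 0 ≤ p.kap * (q : ℝ) ^ 2 := by positivity
  have hkκ : p.kap * (q : ℝ) ^ 2 ≤ κ := mul_le_mul_of_nonneg_left (Inv.sq_le q) hκ0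
  constructor
  · have h1 : |p.γ * M.H q y δ| ≤ C₁ := by
      rw [hA, abs_neg]
      have u1 : effAsk q (M.Λa (δ 0)) * Ea ≤ Λ * α := by gcongr
      have u2 : effBid q (M.Λb (δ 1)) * Eb ≤ Λ * α := by gcongr
      have u3 : 0 ≤ effAsk q (M.Λa (δ 0)) * Ea := by positivity
      have u4 : 0 ≤ effBid q (M.Λb (δ 1)) * Eb := by positivity
      have u5 : 0 ≤ Λ * α := by positivity
      have hd : C₁ = κ + 2 * Λ + 2 * Λ * α := rfl
      exact abs_le.2 ⟨by linarith, by linarith⟩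
    rw [abs_mul, abs_of_pos hγ] at h1
    rw [one_div, ← div_eq_inv_mul, le_div_iff₀ hγ]
    linarith
  · have h1 : |p.γ * (M.H q y δ - M.H q y' δ')| ≤ C₂ * (s + e) := by
      rw [mul_sub, hA, hB]
      have e1 := abs_le.1 b1
      have e2 := abs_le.1 b2
      have hd : C₂ * (s + e) = 2 * ((|p.L| * (1 + α) + Λ * α * (2 * p.γ)) * (s + e)) := by
        simp only [C₂]; ring
      rw [hd]
      exact abs_le.2 ⟨by linarith [e1.1, e2.1], by linarith [e1.2, e2.2]⟩
    rw [abs_mul, abs_of_pos hγ] at h1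
    rw [mul_assoc, one_div, ← div_eq_inv_mul, le_div_iff₀ hγ]
    have : 0 ≤ C₁ * (s + e) := by positivity
    linarith

section Hard

variable {p : Params} (M : Market p) (q : Inv p.Q) (y : Inv p.Q → ℝ)

theorem Market.continuousOn_H : ContinuousOn (M.H q y) p.A := by
  have hc : ∀ {Λ : ℝ → ℝ}, ContinuousOn Λ (Icc p.lo p.hi) → ∀ i : Fin 2,
      ContinuousOn (fun δ : Quote => Λ (δ i)) p.A := fun hΛ i =>
    hΛ.comp (by fun_prop : Continuous fun δ : Quote => δ i).continuousOn
      fun _ hδ => Params.mem_A.1 hδ i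
  have ha := hc M.contDiffOn_Λa.continuousOn 0
  have hb := hc M.contDiffOn_Λb.continuousOn 1
  unfold Market.H Market.askRate Market.bidRate Market.askIncr Market.bidIncr
  split_ifs <;> fun_prop

theorem Market.exists_isMaxOn_H : ∃ δ ∈ p.A, IsMaxOn (M.H q y) p.A δ :=
  p.isCompact_A.exists_isMaxOn p.A_nonempty (M.continuousOn_H q y)

theorem Market.H0_eq {δ : Quote} (hδ : δ ∈ optimalQuotes M q y) : M.H0 q y = M.H q y δ :=
  (IsGreatest.csSup_eq ⟨mem_image_of_mem _ hδ.1, by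
    rintro _ ⟨δ', hδ', rfl⟩
    exact isMaxOn_iff.1 hδ.2 δ' hδ'⟩)

theorem optimalQuotes_nonempty : (optimalQuotes M q y).Nonempty :=
  let ⟨δ, h1, h2⟩ := M.exists_isMaxOn_H q y
  ⟨δ, h1, h2⟩

theorem Market.H_le_H0 {δ : Quote} (hδ : δ ∈ p.A) : M.H q y δ ≤ M.H0 q y := by
  obtain ⟨δ', h⟩ := optimalQuotes_nonempty M q y
  rw [M.H0_eq q y h]
  exact isMaxOn_iff.1 h.2 δ hδ

end Hard

theorem abs_H0_sub_le {p : Params} {M : Market p} {q : Inv p.Q} {y y' : Inv p.Q → ℝ} {s : ℝ}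
    (h : ∀ δ ∈ p.A, |M.H q y δ - M.H q y' δ| ≤ s) : |M.H0 q y - M.H0 q y'| ≤ s := by
  obtain ⟨δ, hδ⟩ := optimalQuotes_nonempty M q y
  obtain ⟨δ', hδ'⟩ := optimalQuotes_nonempty M q y'
  have h1 := abs_le.1 (h δ hδ.1)
  have h2 := abs_le.1 (h δ' hδ'.1)
  have h3 := M.H_le_H0 q y hδ'.1
  have h4 := M.H_le_H0 q y' hδ.1
  have h5 := M.H0_eq q y hδ
  have h6 := M.H0_eq q y' hδ'
  exact abs_le.2 ⟨by linarith, by linarith⟩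

/-! ### The reference measure, log-sum-exp functionals and Gibbs measures -/

section Reference

variable {p : Params} (M : Market p)

instance : IsProbabilityMeasure M.ν := M.isProbabilityMeasure

theorem Market.ν_absolutelyContinuous : M.ν ≪ volume.restrict p.A :=
  withDensity_absolutelyContinuous _ _

theorem ae_mem_A_of_ac {ρ : Measure Quote} (hρ : ρ ≪ M.ν) : ∀ᵐ δ ∂ρ, δ ∈ p.A :=
  (hρ.trans M.ν_absolutelyContinuous).ae_le (ae_restrict_mem p.measurableSet_A)

/-- The square with lower corner `x` and side length `e`. -/
def square (x : Fin 2 → ℝ) (e : ℝ) : Set Quote := {δ | ∀ i, δ i ∈ Icc (x i) (x i + e)}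

theorem mem_square {x : Fin 2 → ℝ} {e : ℝ} {δ : Quote} :
    δ ∈ square x e ↔ ∀ i, δ i ∈ Icc (x i) (x i + e) := Iff.rfl

theorem square_eq_preimage (x : Fin 2 → ℝ) (e : ℝ) :
    square x e = WithLp.ofLp ⁻¹' Icc x fun i => x i + e := by
  ext δ
  simp only [mem_square, mem_preimage, mem_Icc, Pi.le_def]
  exact forall_and

theorem measurableSet_square (x : Fin 2 → ℝ) (e : ℝ) : MeasurableSet (square x e) := by
  rw [square_eq_preimage]
  exact measurableSet_Icc.preimage (PiLp.volume_preserving_ofLp (Fin 2)).measurable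

theorem volume_square (x : Fin 2 → ℝ) {e : ℝ} (he : 0 ≤ e) :
    volume (square x e) = ENNReal.ofReal (e ^ 2) := by
  rw [square_eq_preimage,
    (PiLp.volume_preserving_ofLp (Fin 2)).measure_preimage measurableSet_Icc.nullMeasurableSet,
    Real.volume_Icc_pi]
  simp [ENNReal.ofReal_mul he, sq]

theorem le_ν_square {x : Fin 2 → ℝ} {e : ℝ} (he : 0 ≤ e) (hsub : square x e ⊆ p.A) :
    p.mlo * e ^ 2 ≤ M.ν.real (square x e) := by
  have hm := measurableSet_square x e
  have h : ENNReal.ofReal (p.mlo * e ^ 2) ≤ M.ν (square x e) := by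
    rw [Market.ν, withDensity_apply _ hm, Measure.restrict_restrict hm, inter_eq_left.2 hsub]
    calc ENNReal.ofReal (p.mlo * e ^ 2) = ∫⁻ _ in square x e, ENNReal.ofReal p.mlo := by
          rw [lintegral_const, Measure.restrict_apply_univ, volume_square x he,
            ENNReal.ofReal_mul p.mlo_pos.le]
      _ ≤ _ := by
          refine lintegral_mono_ae ?_
          filter_upwards [ae_mono (Measure.restrict_mono hsub le_rfl) M.m_mem] with δ hδ
          exact ENNReal.ofReal_le_ofReal hδ.1
  exact (ENNReal.ofReal_le_iff_le_toReal (measure_ne_top _ _)).1 h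

/-- Around every point of `A` there is a square inside `A` of any admissible side length. -/
theorem exists_square {δ : Quote} (hδ : δ ∈ p.A) {e : ℝ} (he : 0 ≤ e) (he' : e ≤ p.hi - p.lo) :
    ∃ x : Fin 2 → ℝ, square x e ⊆ p.A ∧ ∀ δ' ∈ square x e, ∀ i, |δ' i - δ i| ≤ e := by
  have hx : ∀ i, p.lo ≤ min (δ i) (p.hi - e) ∧ min (δ i) (p.hi - e) + e ≤ p.hi ∧
      min (δ i) (p.hi - e) ≤ δ i ∧ δ i ≤ min (δ i) (p.hi - e) + e := by
    intro i
    have h1 := (Params.mem_A.1 hδ i).1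
    have h2 := (Params.mem_A.1 hδ i).2
    rcases le_total (δ i) (p.hi - e) with h | h
    · rw [min_eq_left h]
      exact ⟨h1, by linarith, le_rfl, by linarith⟩
    · rw [min_eq_right h]
      exact ⟨by linarith, by linarith, h, by linarith⟩
  refine ⟨fun i => min (δ i) (p.hi - e), fun δ' h' => Params.mem_A.2 fun i => ?_, fun δ' h' i => ?_⟩
  · have := mem_square.1 h' i
    exact ⟨(hx i).1.trans this.1, this.2.trans (hx i).2.1⟩
  · have h1 := mem_square.1 h' i
    obtain ⟨-, -, h2, h3⟩ := hx i
    exact abs_le.2 ⟨by linarith [h1.1], by linarith [h1.2]⟩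

theorem integrable_exp_of_bound {f : Quote → ℝ} {B : ℝ} (hf : AEStronglyMeasurable f M.ν)
    (hB : ∀ δ ∈ p.A, |f δ| ≤ B) : Integrable (fun δ => Real.exp (f δ)) M.ν := by
  refine Integrable.of_bound (Real.continuous_exp.comp_aestronglyMeasurable hf) (Real.exp B) ?_
  filter_upwards [ae_mem_A_of_ac M Measure.AbsolutelyContinuous.rfl] with δ hδ
  rw [Real.norm_of_nonneg (Real.exp_pos _).le]
  exact Real.exp_le_exp.2 ((le_abs_self _).trans (hB δ hδ))

/-- The log-sum-exp functional at temperature `lam`. -/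
def Market.lse (lam : ℝ) (f : Quote → ℝ) : ℝ :=
  lam * Real.log (∫ δ, Real.exp (f δ / lam) ∂M.ν)

theorem aestronglyMeasurable_H (q : Inv p.Q) (y : Inv p.Q → ℝ) :
    AEStronglyMeasurable (M.H q y) M.ν :=
  ((M.continuousOn_H q y).aestronglyMeasurable p.measurableSet_A).mono_ac M.ν_absolutelyContinuous

variable {M} {f g : Quote → ℝ} {lam c ε B : ℝ}

theorem integrable_exp_div (hlam : 0 < lam) (hf : AEStronglyMeasurable f M.ν)
    (hB : ∀ δ ∈ p.A, |f δ| ≤ B) : Integrable (fun δ => Real.exp (f δ / lam)) M.ν := by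
  simp only [div_eq_mul_inv]
  refine integrable_exp_of_bound M (hf.mul_const _) (B := B * lam⁻¹) fun δ hδ => ?_
  rw [abs_mul, abs_of_pos (inv_pos.2 hlam)]
  exact mul_le_mul_of_nonneg_right (hB δ hδ) (inv_pos.2 hlam).le

theorem lse_le_add (hlam : 0 < lam) (hf : AEStronglyMeasurable f M.ν)
    (hfB : ∀ δ ∈ p.A, |f δ| ≤ B) (hg : AEStronglyMeasurable g M.ν) (hgB : ∀ δ ∈ p.A, |g δ| ≤ B)
    (hfg : ∀ δ ∈ p.A, f δ ≤ g δ + c) : M.lse lam f ≤ M.lse lam g + c := by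
  have hif := integrable_exp_div hlam hf hfB
  have hig := integrable_exp_div hlam hg hgB
  have hpos := integral_exp_pos hif
  have hle : ∫ δ, Real.exp (f δ / lam) ∂M.ν ≤
      Real.exp (c / lam) * ∫ δ, Real.exp (g δ / lam) ∂M.ν := by
    rw [← integral_const_mul]
    refine integral_mono_ae hif (hig.const_mul _) ?_
    filter_upwards [ae_mem_A_of_ac M Measure.AbsolutelyContinuous.rfl] with δ hδ
    rw [← Real.exp_add]
    refine Real.exp_le_exp.2 ?_
    rw [← add_div]
    exact div_le_div_of_nonneg_right (by linarith [hfg δ hδ]) hlam.le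
  have h2 := Real.log_le_log hpos hle
  rw [Real.log_mul (Real.exp_pos _).ne' (integral_exp_pos hig).ne', Real.log_exp] at h2
  have h3 := mul_le_mul_of_nonneg_left h2 hlam.le
  rw [mul_add, mul_div_cancel₀ _ hlam.ne'] at h3
  unfold Market.lse
  linarith

theorem lse_const (hlam : lam ≠ 0) (c : ℝ) : M.lse lam (fun _ => c) = c := by
  simp [Market.lse, mul_div_cancel₀ _ hlam]

/-- Laplace's principle with a rate: for a function that is Lipschitz on `A`, log-sum-exp at
temperature `lam` is below the maximum by at most a multiple of `lam (1 + |log lam|)`, because the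
reference measure gives mass at least `mlo e²` to a square of side `e ~ lam` at the maximizer. -/
theorem exists_laplace (p : Params) (C : ℝ) (hC : 0 ≤ C) : ∃ D ≥ 0, ∀ (M : Market p)
    (f : Quote → ℝ) (B : ℝ) (δ₀ : Quote) (lam : ℝ), 0 < lam → lam ≤ 1 → δ₀ ∈ p.A →
      AEStronglyMeasurable f M.ν → (∀ δ ∈ p.A, |f δ| ≤ B) →
      (∀ e, ∀ δ ∈ p.A, (∀ i, |δ i - δ₀ i| ≤ e) → f δ₀ - C * e ≤ f δ) →
      f δ₀ - D * (lam * (1 + |Real.log lam|)) ≤ M.lse lam f := by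
  set w : ℝ := min 1 (p.hi - p.lo) with hw
  have hw0 : 0 < w := lt_min one_pos (sub_pos.2 p.lo_lt_hi)
  refine ⟨C * w + |Real.log (p.mlo * w ^ 2)| + 2, by positivity, ?_⟩
  intro M f B δ₀ lam hlam hlam1 hδ₀ hf hB hlip
  have he0 : 0 < lam * w := by positivity
  have he1 : lam * w ≤ p.hi - p.lo :=
    (mul_le_of_le_one_left hw0.le hlam1).trans (min_le_right _ _)
  obtain ⟨x, hsub, hx⟩ := exists_square hδ₀ he0.le he1
  have hint := integrable_exp_div hlam hf hB
  have hmass := le_ν_square M he0.le hsub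
  have hlow : Real.exp ((f δ₀ - C * (lam * w)) / lam) * (p.mlo * (lam * w) ^ 2) ≤
      ∫ δ, Real.exp (f δ / lam) ∂M.ν := by
    refine (mul_le_mul_of_nonneg_left hmass (Real.exp_pos _).le).trans ?_
    refine (setIntegral_ge_of_const_le_real (measurableSet_square x _) (measure_ne_top _ _)
      (fun δ hδ => ?_) hint.integrableOn).trans
        (setIntegral_le_integral hint (Filter.Eventually.of_forall fun δ => (Real.exp_pos _).le))
    exact Real.exp_le_exp.2 (div_le_div_of_nonneg_right (hlip _ δ (hsub hδ) (hx δ hδ)) hlam.le)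
  have hpos : 0 < p.mlo * (lam * w) ^ 2 := mul_pos p.mlo_pos (by positivity)
  have hlog := Real.log_le_log (mul_pos (Real.exp_pos _) hpos) hlow
  rw [Real.log_mul (Real.exp_pos _).ne' hpos.ne', Real.log_exp] at hlog
  have hlog2 : Real.log (p.mlo * (lam * w) ^ 2) =
      Real.log (p.mlo * w ^ 2) + 2 * Real.log lam := by
    rw [mul_pow, mul_left_comm, mul_comm (lam ^ 2), Real.log_mul
      (mul_pos p.mlo_pos (by positivity)).ne' (by positivity), Real.log_pow]
    norm_num
  rw [hlog2] at hlog
  have h3 := mul_le_mul_of_nonneg_left hlog hlam.le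
  rw [mul_add, mul_div_cancel₀ _ hlam.ne'] at h3
  unfold Market.lse
  refine le_trans ?_ h3
  have h4 := neg_abs_le (Real.log (p.mlo * w ^ 2))
  have h5 := neg_abs_le (Real.log lam)
  have h6 : lam * -(|Real.log (p.mlo * w ^ 2)| + 2 * |Real.log lam|) ≤
      lam * (Real.log (p.mlo * w ^ 2) + 2 * Real.log lam) :=
    mul_le_mul_of_nonneg_left (by linarith) hlam.le
  have h7 : 0 ≤ lam * |Real.log lam| * (C * w + |Real.log (p.mlo * w ^ 2)|) := by positivity
  nlinarith

/-- The Gibbs variational inequality: under the Gibbs measure of `f`, the mean of `f` is at least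
its log-sum-exp (the difference is `lam` times a relative entropy). -/
theorem lse_le_integral_tilted (hlam : 0 < lam) (hf : AEStronglyMeasurable f M.ν)
    (hB : ∀ δ ∈ p.A, |f δ| ≤ B) :
    M.lse lam f ≤ ∫ δ, f δ ∂(M.ν.tilted fun δ => f δ / lam) := by
  have hint := integrable_exp_div hlam hf hB
  set Z := ∫ δ, Real.exp (f δ / lam) ∂M.ν with hZ
  have hZpos : 0 < Z := integral_exp_pos hint
  have hprod : Integrable (fun δ => f δ / lam * Real.exp (f δ / lam)) M.ν := by
    refine hint.bdd_mul (c := B / lam) (by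
      simp only [div_eq_mul_inv]; exact hf.mul_const _) ?_
    filter_upwards [ae_mem_A_of_ac M Measure.AbsolutelyContinuous.rfl] with δ hδ
    rw [norm_div, Real.norm_of_nonneg hlam.le]
    exact div_le_div_of_nonneg_right (hB δ hδ) hlam.le
  -- the elementary inequality `x log x ≥ x log Z + x - Z` at `x = exp (f / lam)`
  have hpt : ∀ δ, Real.log Z * Real.exp (f δ / lam) + Real.exp (f δ / lam) - Z ≤
      f δ / lam * Real.exp (f δ / lam) := fun δ => by
    have hx := Real.exp_pos (f δ / lam)
    have h1 := Real.log_le_sub_one_of_pos (div_pos hZpos hx)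
    rw [Real.log_div hZpos.ne' hx.ne', Real.log_exp] at h1
    have h2 := mul_le_mul_of_nonneg_right h1 hx.le
    rw [sub_mul (Z / _), div_mul_cancel₀ _ hx.ne'] at h2
    linarith
  have hkey : Real.log Z * Z ≤ ∫ δ, f δ / lam * Real.exp (f δ / lam) ∂M.ν := by
    have hsum : Integrable (fun δ => Real.log Z * Real.exp (f δ / lam) + Real.exp (f δ / lam))
        M.ν := (hint.const_mul (Real.log Z)).add hint
    have h1 := integral_mono (hsum.sub (integrable_const Z)) hprod hpt
    have h2 : ∫ δ, (Real.log Z * Real.exp (f δ / lam) + Real.exp (f δ / lam) - Z) ∂M.ν =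
        Real.log Z * Z := by
      rw [integral_sub hsum (integrable_const Z),
        integral_add (hint.const_mul _) hint, integral_const_mul, ← hZ]
      simp
    exact h2.symm.le.trans h1
  have heq : ∫ δ, f δ ∂(M.ν.tilted fun δ => f δ / lam) =
      lam / Z * ∫ δ, f δ / lam * Real.exp (f δ / lam) ∂M.ν := by
    rw [integral_tilted, ← hZ, ← integral_const_mul]
    refine integral_congr_ae (Filter.Eventually.of_forall fun δ => ?_)
    simp only [smul_eq_mul]
    field_simp
  rw [heq, Market.lse, ← hZ, div_mul_eq_mul_div, le_div_iff₀ hZpos, mul_assoc]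
  exact mul_le_mul_of_nonneg_left hkey hlam.le

theorem isProbabilityMeasure_gibbs (hlam : 0 < lam) (hf : AEStronglyMeasurable f M.ν)
    (hB : ∀ δ ∈ p.A, |f δ| ≤ B) : IsProbabilityMeasure (M.ν.tilted fun δ => f δ / lam) :=
  isProbabilityMeasure_tilted (integrable_exp_div hlam hf hB)

theorem integrable_of_bound_of_ac {ρ : Measure Quote} [IsFiniteMeasure ρ] (hρ : ρ ≪ M.ν)
    (hf : AEStronglyMeasurable f ρ) (hB : ∀ δ ∈ p.A, |f δ| ≤ B) : Integrable f ρ :=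
  Integrable.of_bound hf B ((ae_mem_A_of_ac M hρ).mono hB)

/-- If `f` is `ε`-close to `g + c`, and the log-sum-exp of `g` is at least `G - D`, then the mean of
`G - g` under the Gibbs measure of `f` is at most `2 ε + D`. -/
theorem integral_gap_le (hlam : 0 < lam) {G D : ℝ} (hf : AEStronglyMeasurable f M.ν)
    (hg : AEStronglyMeasurable g M.ν) (hgB : ∀ δ ∈ p.A, |g δ| ≤ B)
    (hfg : ∀ δ ∈ p.A, |f δ - c - g δ| ≤ ε) (hG : G - D ≤ M.lse lam g) :
    IsProbabilityMeasure (M.ν.tilted fun δ => f δ / lam) ∧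
      ∫ δ, (G - g δ) ∂(M.ν.tilted fun δ => f δ / lam) ≤ 2 * ε + D := by
  have hε : 0 ≤ ε := (abs_nonneg _).trans (hfg _ p.A_nonempty.some_mem)
  have hB0 : 0 ≤ B := (abs_nonneg _).trans (hgB _ p.A_nonempty.some_mem)
  have hfB : ∀ δ ∈ p.A, |f δ| ≤ B + |c| + ε := fun δ hδ => by
    have h1 := abs_le.1 (hfg δ hδ)
    have h2 := abs_le.1 (hgB δ hδ)
    have h3 := le_abs_self c
    have h4 := neg_abs_le c
    exact abs_le.2 ⟨by linarith, by linarith⟩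
  have hgB' : ∀ δ ∈ p.A, |g δ| ≤ B + |c| + ε := fun δ hδ =>
    (hgB δ hδ).trans (by linarith [abs_nonneg c])
  have hprob := isProbabilityMeasure_gibbs hlam hf hfB
  refine ⟨hprob, ?_⟩
  set π := M.ν.tilted fun δ => f δ / lam with hπ
  have hac : π ≪ M.ν := tilted_absolutelyContinuous _ _
  have hfi : Integrable f π := integrable_of_bound_of_ac hac (hf.mono_ac hac) hfB
  have hgi : Integrable g π := integrable_of_bound_of_ac hac (hg.mono_ac hac) hgB
  have h1 : M.lse lam g ≤ M.lse lam f + (ε - c) :=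
    lse_le_add hlam hg hgB' hf hfB fun δ hδ => by linarith [(abs_le.1 (hfg δ hδ)).1]
  have h2 := lse_le_integral_tilted hlam hf hfB
  have h3 : ∫ δ, f δ ∂π ≤ ∫ δ, (g δ + (c + ε)) ∂π := by
    refine integral_mono_ae hfi (hgi.add (integrable_const _)) ?_
    filter_upwards [ae_mem_A_of_ac M hac] with δ hδ
    linarith [(abs_le.1 (hfg δ hδ)).2]
  rw [integral_add hgi (integrable_const _), integral_const, probReal_univ, one_smul] at h3
  rw [integral_sub (integrable_const _) hgi, integral_const, probReal_univ, one_smul]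
  linarith

end Reference

/-! ### A priori bounds for the hard value -/

section Value

variable {p : Params} {M : Market p} {v : ℝ → Inv p.Q → ℝ}

theorem Market.mul_H_le {M : Market p} {q : Inv p.Q} {y : Inv p.Q → ℝ} {δ : Quote}
    (hδ : δ ∈ p.A) : p.γ * M.H q y δ ≤ 2 * |p.Λbar| := by
  obtain ⟨hra, hraΛ⟩ := effAsk_mem q (M.Λa_mem _ (hδ 0)).1
    ((M.Λa_mem _ (hδ 0)).2.trans (le_abs_self p.Λbar))
  obtain ⟨hrb, hrbΛ⟩ := effBid_mem q (M.Λb_mem _ (hδ 1)).1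
    ((M.Λb_mem _ (hδ 1)).2.trans (le_abs_self p.Λbar))
  have hk : 0 ≤ p.kap * (q : ℝ) ^ 2 := mul_nonneg p.kap_nonneg (sq_nonneg _)
  rw [M.mul_H q y δ]
  have h1 := mul_nonneg hra (Real.exp_pos (-p.γ * (δ 0 + y q.down - y q))).le
  have h2 := mul_nonneg hrb (Real.exp_pos (-p.γ * (δ 1 + y q.up - y q))).le
  linarith

/-- Upper bound for the hard value: each fill gains at most `1 / γ` in the Hamiltonian. -/
theorem Market.IsHardValue.le (hv : M.IsHardValue v) {t : ℝ} (ht : t ∈ Icc 0 p.T) (q : Inv p.Q) :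
    v t q ≤ 2 * |p.Λbar| / p.γ * p.T := by
  have hγ := p.γ_pos
  set c := 2 * |p.Λbar| / p.γ with hc
  have hc0 : 0 ≤ c := by positivity
  have hd : ∀ s ∈ Icc 0 p.T, HasDerivWithinAt (fun s => v s q + c * s) (-M.H0 q (v s) + c)
      (Icc 0 p.T) s := fun s hs => by
    simpa using (hv.hasDerivWithinAt s hs q).fun_add
      ((hasDerivWithinAt_id s (Icc 0 p.T)).const_mul c)
  have hH : ∀ s, M.H0 q (v s) ≤ c := fun s => by
    obtain ⟨δ, hδ⟩ := optimalQuotes_nonempty M q (v s)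
    rw [M.H0_eq q _ hδ, hc, le_div_iff₀ hγ, mul_comm]
    exact Market.mul_H_le hδ.1
  have hmono : MonotoneOn (fun s => v s q + c * s) (Icc 0 p.T) := by
    refine monotoneOn_of_hasDerivWithinAt_nonneg (convex_Icc 0 p.T)
      (fun s hs => (hd s hs).continuousWithinAt)
      (fun s hs => (hd s (interior_subset hs)).mono interior_subset) fun s _ => ?_
    linarith [hH s]
  have h1 := hmono ht ⟨p.T_pos.le, le_rfl⟩ ht.2
  simp only [hv.terminal_eq, Market.terminal] at h1
  have h2 : 0 ≤ p.Φ * (q : ℝ) ^ 2 := mul_nonneg p.Φ_nonneg (sq_nonneg _)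
  have h3 : 0 ≤ c * t := mul_nonneg hc0 ht.1
  linarith

/-- In terms of `w = exp (-γ v)` the right-hand side of the backward system grows at most linearly,
with a constant that depends on the parameters only. -/
theorem Market.abs_exp_mul_H_le {M : Market p} (q : Inv p.Q) {y : Inv p.Q → ℝ} {δ : Quote}
    (hδ : δ ∈ p.A) : |p.γ * M.H q y δ * Real.exp (-p.γ * y q)| ≤
      (p.kap * p.Q ^ 2 + 2 * |p.Λbar| + 2 * |p.Λbar| * Real.exp (p.γ * p.D))
        * ‖fun r => Real.exp (-p.γ * y r)‖ := by
  have hγ := p.γ_pos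
  have hκ0 := p.kap_nonneg
  obtain ⟨hra, hraΛ⟩ := effAsk_mem q (M.Λa_mem _ (hδ 0)).1
    ((M.Λa_mem _ (hδ 0)).2.trans (le_abs_self p.Λbar))
  obtain ⟨hrb, hrbΛ⟩ := effBid_mem q (M.Λb_mem _ (hδ 1)).1
    ((M.Λb_mem _ (hδ 1)).2.trans (le_abs_self p.Λbar))
  set W := ‖fun r => Real.exp (-p.γ * y r)‖ with hW
  have hw : ∀ r, Real.exp (-p.γ * y r) ≤ W := fun r =>
    (Real.le_norm_self _).trans (norm_le_pi_norm (fun r => Real.exp (-p.γ * y r)) r)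
  have hW0 : 0 ≤ W := norm_nonneg _
  set ra := effAsk q (M.Λa (δ 0))
  set rb := effBid q (M.Λb (δ 1))
  have hk : 0 ≤ p.kap * (q : ℝ) ^ 2 := by positivity
  have hkκ : p.kap * (q : ℝ) ^ 2 ≤ p.kap * p.Q ^ 2 :=
    mul_le_mul_of_nonneg_left (Inv.sq_le q) hκ0
  have hx : ∀ i, Real.exp (-p.γ * δ i) ≤ Real.exp (p.γ * p.D) := fun i => by
    refine Real.exp_le_exp.2 ?_
    rw [neg_mul, ← mul_neg]
    exact mul_le_mul_of_nonneg_left (by linarith [(abs_le.1 (Params.abs_le_D hδ i)).1]) hγ.le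
  have e1 : Real.exp (-p.γ * (δ 0 + y q.down - y q)) * Real.exp (-p.γ * y q) =
      Real.exp (-p.γ * δ 0) * Real.exp (-p.γ * y q.down) := by
    rw [← Real.exp_add, ← Real.exp_add]; congr 1; ring
  have e2 : Real.exp (-p.γ * (δ 1 + y q.up - y q)) * Real.exp (-p.γ * y q) =
      Real.exp (-p.γ * δ 1) * Real.exp (-p.γ * y q.up) := by
    rw [← Real.exp_add, ← Real.exp_add]; congr 1; ring
  have heq : p.γ * M.H q y δ * Real.exp (-p.γ * y q) =
      (ra + rb) * Real.exp (-p.γ * y q) - p.kap * (q : ℝ) ^ 2 * Real.exp (-p.γ * y q)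
        - (ra * (Real.exp (-p.γ * δ 0) * Real.exp (-p.γ * y q.down))
          + rb * (Real.exp (-p.γ * δ 1) * Real.exp (-p.γ * y q.up))) := by
    rw [M.mul_H q y δ, ← e1, ← e2]; ring
  rw [heq]
  have b1 : (ra + rb) * Real.exp (-p.γ * y q) ≤ (|p.Λbar| + |p.Λbar|) * W := by
    gcongr; exact hw q
  have b2 : p.kap * (q : ℝ) ^ 2 * Real.exp (-p.γ * y q) ≤ p.kap * p.Q ^ 2 * W := by
    gcongr; exact hw q
  have b3 : ra * (Real.exp (-p.γ * δ 0) * Real.exp (-p.γ * y q.down)) ≤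
      |p.Λbar| * (Real.exp (p.γ * p.D) * W) :=
    mul_le_mul hraΛ (mul_le_mul (hx 0) (hw _) (Real.exp_pos _).le (Real.exp_pos _).le)
      (by positivity) (abs_nonneg _)
  have b4 : rb * (Real.exp (-p.γ * δ 1) * Real.exp (-p.γ * y q.up)) ≤
      |p.Λbar| * (Real.exp (p.γ * p.D) * W) :=
    mul_le_mul hrbΛ (mul_le_mul (hx 1) (hw _) (Real.exp_pos _).le (Real.exp_pos _).le)
      (by positivity) (abs_nonneg _)
  have p1 : 0 ≤ (ra + rb) * Real.exp (-p.γ * y q) := by positivity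
  have p2 : 0 ≤ p.kap * (q : ℝ) ^ 2 * Real.exp (-p.γ * y q) := by positivity
  have p3 : 0 ≤ ra * (Real.exp (-p.γ * δ 0) * Real.exp (-p.γ * y q.down)) := by positivity
  have p4 : 0 ≤ rb * (Real.exp (-p.γ * δ 1) * Real.exp (-p.γ * y q.up)) := by positivity
  exact abs_le.2 ⟨by linarith, by linarith⟩

/-- Grönwall's inequality for `exp (-γ v)` in reversed time: a lower bound for the hard value. -/
theorem Market.IsHardValue.exp_neg_le (hv : M.IsHardValue v) {t : ℝ} (ht : t ∈ Icc 0 p.T)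
    (q : Inv p.Q) : Real.exp (-p.γ * v t q) ≤ Real.exp (p.γ * (p.Φ * p.Q ^ 2)) *
      Real.exp ((p.kap * p.Q ^ 2 + 2 * |p.Λbar| + 2 * |p.Λbar| * Real.exp (p.γ * p.D)) * p.T) := by
  set L := p.kap * p.Q ^ 2 + 2 * |p.Λbar| + 2 * |p.Λbar| * Real.exp (p.γ * p.D) with hL
  have hγ := p.γ_pos
  have hκ0 := p.kap_nonneg
  have hL0 : 0 ≤ L := by positivity
  set f : ℝ → Inv p.Q → ℝ := fun s r => Real.exp (-p.γ * v (p.T - s) r) with hf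
  set f' : ℝ → Inv p.Q → ℝ := fun s r =>
    -(p.γ * M.H0 r (v (p.T - s)) * Real.exp (-p.γ * v (p.T - s) r)) with hf'
  have hmaps : MapsTo (fun s => p.T - s) (Icc 0 p.T) (Icc 0 p.T) := fun s hs =>
    ⟨by linarith [hs.2], by linarith [hs.1]⟩
  have hd : ∀ s ∈ Icc 0 p.T, HasDerivWithinAt f (f' s) (Icc 0 p.T) s := fun s hs => by
    refine hasDerivWithinAt_pi.2 fun r => ?_
    have h1 := (hv.hasDerivWithinAt _ (hmaps hs) r).scomp s
      ((hasDerivWithinAt_id s (Icc 0 p.T)).const_sub p.T) hmaps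
    have h2 := (h1.const_mul (-p.γ)).exp
    convert! h2 using 1
    simp only [hf', Function.comp_def, smul_eq_mul]
    ring
  have hbound : ∀ s ∈ Ico 0 p.T, ‖f' s‖ ≤ L * ‖f s‖ + 0 := fun s _ => by
    rw [add_zero]
    refine (pi_norm_le_iff_of_nonneg (by positivity)).2 fun r => ?_
    obtain ⟨δ, hδ⟩ := optimalQuotes_nonempty M r (v (p.T - s))
    rw [Real.norm_eq_abs, hf', abs_neg, M.H0_eq r _ hδ]
    exact M.abs_exp_mul_H_le r hδ.1
  have h0 : ‖f 0‖ ≤ Real.exp (p.γ * (p.Φ * p.Q ^ 2)) := by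
    refine (pi_norm_le_iff_of_nonneg (Real.exp_pos _).le).2 fun r => ?_
    rw [Real.norm_of_nonneg (Real.exp_pos _).le]
    simp only [sub_zero, hv.terminal_eq, Market.terminal]
    refine Real.exp_le_exp.2 ?_
    have := mul_le_mul_of_nonneg_left (mul_le_mul_of_nonneg_left (Inv.sq_le r) p.Φ_nonneg) hγ.le
    linarith
  have hgron := norm_le_gronwallBound_of_norm_deriv_right_le
    (fun s hs => (hd s hs).continuousWithinAt)
    (fun s hs => (hd s (Ico_subset_Icc_self hs)).mono_of_mem_nhdsWithin
      (Icc_mem_nhdsGE_of_mem hs)) h0 hbound (p.T - t) (hmaps ht)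
  rw [gronwallBound_ε0, sub_zero] at hgron
  have h1 : Real.exp (-p.γ * v t q) ≤ ‖f (p.T - t)‖ := by
    have := norm_le_pi_norm (f (p.T - t)) q
    simp only [hf, sub_sub_cancel] at this ⊢
    exact (Real.le_norm_self _).trans this
  refine h1.trans (hgron.trans ?_)
  gcongr
  linarith [ht.1]

/-- The hard value is bounded by a constant that depends on the parameters only. -/
theorem exists_hardValue_bound (p : Params) : ∃ R ≥ 0, ∀ (M : Market p) (v : ℝ → Inv p.Q → ℝ),
    M.IsHardValue v → ∀ t ∈ Icc 0 p.T, ∀ q, |v t q| ≤ R := by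
  have hγ := p.γ_pos
  have hκ0 := p.kap_nonneg
  have hT := p.T_pos
  have hΦ := p.Φ_nonneg
  set L := p.kap * p.Q ^ 2 + 2 * |p.Λbar| + 2 * |p.Λbar| * Real.exp (p.γ * p.D) with hL
  have hL0 : 0 ≤ L := by positivity
  refine ⟨2 * |p.Λbar| / p.γ * p.T + (p.Φ * p.Q ^ 2 + L * p.T / p.γ), by positivity, ?_⟩
  intro M v hv t ht q
  have h1 := hv.le ht q
  have h2 := hv.exp_neg_le ht q
  rw [← Real.exp_add, Real.exp_le_exp] at h2
  have h3 : -v t q ≤ p.Φ * p.Q ^ 2 + L * p.T / p.γ := by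
    have : p.γ * -v t q ≤ p.γ * (p.Φ * p.Q ^ 2 + L * p.T / p.γ) := by
      rw [mul_add, mul_div_cancel₀ _ hγ.ne']
      linarith
    exact le_of_mul_le_mul_left this hγ
  have h4 : 0 ≤ p.Φ * p.Q ^ 2 + L * p.T / p.γ := by positivity
  have h5 : 0 ≤ 2 * |p.Λbar| / p.γ * p.T := by positivity
  exact abs_le.2 ⟨by linarith, by linarith⟩

theorem Market.IsHardValue.abs_sub_le (hv : M.IsHardValue v) {C : ℝ}
    (hC : ∀ t ∈ Icc 0 p.T, ∀ q, |M.H0 q (v t)| ≤ C) {s t : ℝ} (hs : s ∈ Icc 0 p.T)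
    (ht : t ∈ Icc 0 p.T) (q : Inv p.Q) : |v t q - v s q| ≤ C * |t - s| :=
  Convex.norm_image_sub_le_of_norm_hasDerivWithin_le
    (fun x hx => hv.hasDerivWithinAt x hx q)
    (fun x hx => by rw [norm_neg]; exact hC x hx q) (convex_Icc _ _) hs ht

/-- The local error of the explicit Euler step for the hard value. -/
theorem Market.IsHardValue.abs_taylor_le (hv : M.IsHardValue v) {C : ℝ} (hC0 : 0 ≤ C)
    (hC : ∀ t ∈ Icc 0 p.T, ∀ q, |M.H0 q (v t)| ≤ C)
    (hLip : ∀ t ∈ Icc 0 p.T, ∀ t' ∈ Icc 0 p.T, ∀ q, ∀ s, (∀ r, |v t r - v t' r| ≤ s) →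
      |M.H0 q (v t) - M.H0 q (v t')| ≤ C * s)
    {s t : ℝ} (hs : s ∈ Icc 0 p.T) (ht : t ∈ Icc 0 p.T) (hst : s ≤ t) (q : Inv p.Q) :
    |v s q - v t q - (t - s) * M.H0 q (v t)| ≤ C ^ 2 * (t - s) ^ 2 := by
  have hsub : Icc s t ⊆ Icc 0 p.T := Icc_subset_Icc hs.1 ht.2
  have h := Convex.norm_image_sub_le_of_norm_hasDerivWithin_le
    (f := fun u => v u q + u * M.H0 q (v t)) (f' := fun u => -M.H0 q (v u) + M.H0 q (v t))
    (s := Icc s t) (C := C * (C * (t - s))) (x := t) (y := s)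
    (fun x hx => by
      simpa using ((hv.hasDerivWithinAt x (hsub hx) q).mono hsub).fun_add
        ((hasDerivWithinAt_id x (Icc s t)).mul_const (M.H0 q (v t))))
    (fun x hx => by
      rw [neg_add_eq_sub, Real.norm_eq_abs]
      refine hLip t ht x (hsub hx) q _ fun r => (hv.abs_sub_le hC (hsub hx) ht r).trans ?_
      rw [abs_of_nonneg (by linarith [hx.2])]
      exact mul_le_mul_of_nonneg_left (by linarith [hx.1]) hC0)
    (convex_Icc _ _) ⟨hst, le_rfl⟩ ⟨le_rfl, hst⟩
  rw [Real.norm_eq_abs, Real.norm_eq_abs, abs_sub_comm s t, abs_of_nonneg (sub_nonneg.2 hst)] at h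
  calc |v s q - v t q - (t - s) * M.H0 q (v t)|
      = |v s q + s * M.H0 q (v t) - (v t q + t * M.H0 q (v t))| := by congr 1; ring
    _ ≤ C * (C * (t - s)) * (t - s) := h
    _ = _ := by ring

end Value

/-! ### Convergence of one-step schemes -/

/-- A one-step scheme that is consistent with the hard Hamiltonian on a neighbourhood of the hard
value converges to it: the induction keeps the iterates within distance `1` of the hard value, where
the Hamiltonian is Lipschitz. -/
theorem abs_iterate_sub_le {p : Params} {M : Market p} {v : ℝ → Inv p.Q → ℝ}
    (hv : M.IsHardValue v) {R C ε h : ℝ} (hC0 : 0 ≤ C) (hε : 0 ≤ ε) (hh : 0 < h)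
    (hR : ∀ t ∈ Icc 0 p.T, ∀ q, |v t q| ≤ R)
    (hHb : ∀ q y, (∀ r, |y r| ≤ R + 1) → |M.H0 q y| ≤ C)
    (hHL : ∀ q y y' s, (∀ r, |y r| ≤ R + 1) → (∀ r, |y' r| ≤ R + 1) →
      (∀ r, |y r - y' r| ≤ s) → |M.H0 q y - M.H0 q y'| ≤ C * s)
    {S : (Inv p.Q → ℝ) → Inv p.Q → ℝ}
    (hS : ∀ y q, (∀ r, |y r| ≤ R + 1) → |S y q - y q - h * M.H0 q y| ≤ h * ε)
    (hsmall : p.T * (ε + C ^ 2 * h) * Real.exp (C * p.T) ≤ 1) (k : ℕ) (hk : k * h ≤ p.T)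
    (q : Inv p.Q) : |S^[k] M.terminal q - v (p.T - k * h) q| ≤
      k * h * (ε + C ^ 2 * h) * Real.exp (C * (k * h)) := by
  have hT := p.T_pos
  have hvR : ∀ t ∈ Icc 0 p.T, ∀ q, |v t q| ≤ R + 1 := fun t ht q =>
    (hR t ht q).trans (by linarith)
  induction k generalizing q with
  | zero => simp [hv.terminal_eq]
  | succ k ih =>
    have hkh : (k : ℝ) * h ≤ p.T := by push_cast at hk; nlinarith
    have hkh0 : 0 ≤ (k : ℝ) * h := by positivity
    set e := k * h * (ε + C ^ 2 * h) * Real.exp (C * (k * h)) with he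
    have he0 : 0 ≤ e := by positivity
    have he1 : e ≤ 1 := le_trans (by rw [he]; gcongr) hsmall
    have ht : p.T - k * h ∈ Icc 0 p.T := ⟨by linarith, by linarith⟩
    have ht' : p.T - (k + 1 : ℕ) * h ∈ Icc 0 p.T := ⟨by linarith, by push_cast; nlinarith⟩
    set y := S^[k] M.terminal with hy
    set z := v (p.T - k * h) with hz
    have hye : ∀ r, |y r - z r| ≤ e := fun r => ih hkh r
    have hyR : ∀ r, |y r| ≤ R + 1 := fun r => by
      have h1 := abs_le.1 (hye r)
      have h2 := abs_le.1 (hR _ ht r)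
      exact abs_le.2 ⟨by linarith, by linarith⟩
    have d1 := abs_le.1 (hS y q hyR)
    have d2 := abs_le.1 (hye q)
    have d3 := abs_le.1 (hHL q y z e hyR (hvR _ ht) hye)
    have d4 := hv.abs_taylor_le hC0 (fun t ht q => hHb q _ (hvR t ht))
      (fun t ht t' ht' q s => hHL q _ _ s (hvR t ht) (hvR t' ht')) ht' ht
      (by push_cast; nlinarith) q
    rw [show p.T - k * h - (p.T - (k + 1 : ℕ) * h) = h by push_cast; ring] at d4
    have d4 := abs_le.1 d4
    have d3a := mul_le_mul_of_nonneg_left d3.1 hh.le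
    have d3b := mul_le_mul_of_nonneg_left d3.2 hh.le
    have key : |S y q - v (p.T - (k + 1 : ℕ) * h) q| ≤ (1 + C * h) * e + h * (ε + C ^ 2 * h) :=
      abs_le.2 ⟨by linarith [d1.1, d2.1, d4.2], by linarith [d1.2, d2.2, d4.1]⟩
    rw [Function.iterate_succ_apply']
    refine key.trans ?_
    have g1 : 1 + C * h ≤ Real.exp (C * h) := by linarith [Real.add_one_le_exp (C * h)]
    have g2 : Real.exp (C * (k * h)) * Real.exp (C * h) = Real.exp (C * ((k + 1 : ℕ) * h)) := by
      rw [← Real.exp_add]; congr 1; push_cast; ring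
    have g3 : 1 ≤ Real.exp (C * ((k + 1 : ℕ) * h)) := Real.one_le_exp (by positivity)
    calc (1 + C * h) * e + h * (ε + C ^ 2 * h)
        ≤ Real.exp (C * h) * e + h * (ε + C ^ 2 * h) * Real.exp (C * ((k + 1 : ℕ) * h)) :=
          add_le_add (mul_le_mul_of_nonneg_right g1 he0)
            (le_mul_of_one_le_right (by positivity) g3)
      _ = _ := by rw [he, ← g2]; push_cast; ring

/-! ### Optimality gap of the two Gibbs policies -/

theorem step_pos {p : Params} {N : ℕ} (hN : 0 < N) : 0 < step p N :=
  div_pos p.T_pos (by exact_mod_cast hN)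

theorem mul_step {p : Params} {N : ℕ} (hN : 0 < N) : N * step p N = p.T :=
  mul_div_cancel₀ _ (by exact_mod_cast hN.ne')

theorem rate_nonneg {h lam : ℝ} (hh : 0 ≤ h) (hlam : 0 ≤ lam) : 0 ≤ rate h lam := by
  unfold rate; positivity

theorem mul_one_add_abs_log_le {lam : ℝ} (hlam : 0 < lam) (hlam1 : lam ≤ 1) :
    lam * (1 + |Real.log lam|) ≤ 3 * √lam := by
  have hs : 0 < √lam := Real.sqrt_pos.2 hlam
  have hs1 : √lam ≤ 1 := Real.sqrt_le_one.2 hlam1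
  have h1 := (Real.abs_log_mul_self_lt (√lam) hs hs1).le
  rw [abs_mul, abs_of_pos hs, Real.log_sqrt hlam.le, abs_div, abs_two] at h1
  have h2 : lam = √lam * √lam := (Real.mul_self_sqrt hlam.le).symm
  calc lam * (1 + |Real.log lam|)
      = √lam * √lam + 2 * √lam * (|Real.log lam| / 2 * √lam) := by
        nth_rewrite 1 [h2]; ring
    _ ≤ √lam * 1 + 2 * √lam * 1 := by gcongr
    _ = 3 * √lam := by ring

/-- The rate is small when both parameters are small. -/
theorem exists_pos_rate_le {η : ℝ} (hη : 0 < η) : ∃ h₀ > 0, ∃ lam₀ > 0, lam₀ ≤ 1 ∧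
    ∀ h lam, h ≤ h₀ → 0 < lam → lam ≤ lam₀ → rate h lam ≤ η := by
  refine ⟨η / 2, by positivity, min 1 ((η / 6) ^ 2), by positivity, min_le_left _ _, ?_⟩
  intro h lam hh hlam hle
  have h1 := mul_one_add_abs_log_le hlam (hle.trans (min_le_left _ _))
  have h2 : √lam ≤ η / 6 := Real.sqrt_le_iff.2 ⟨by positivity, hle.trans (min_le_right _ _)⟩
  unfold rate
  linarith

/-- The soft Hamiltonian lies below the hard one, by at most the error `hD` of Laplace's principle. -/
theorem H0_sub_le_Hsoft_and_Hsoft_le {p : Params} {M : Market p} {C D B lam : ℝ} {q : Inv p.Q}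
    {y : Inv p.Q → ℝ} (hlam : 0 < lam) (hlam1 : lam ≤ 1) (hB : ∀ δ ∈ p.A, |M.H q y δ| ≤ B)
    (hlip : ∀ δ ∈ p.A, ∀ δ' ∈ p.A, ∀ e, (∀ i, |δ i - δ' i| ≤ e) →
      |M.H q y δ - M.H q y δ'| ≤ C * e)
    (hD : ∀ (f : Quote → ℝ) (B : ℝ) (δ₀ : Quote) (lam : ℝ), 0 < lam → lam ≤ 1 → δ₀ ∈ p.A →
      AEStronglyMeasurable f M.ν → (∀ δ ∈ p.A, |f δ| ≤ B) →
      (∀ e, ∀ δ ∈ p.A, (∀ i, |δ i - δ₀ i| ≤ e) → f δ₀ - C * e ≤ f δ) →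
      f δ₀ - D * (lam * (1 + |Real.log lam|)) ≤ M.lse lam f) :
    M.H0 q y - D * (lam * (1 + |Real.log lam|)) ≤ M.Hsoft lam q y ∧
      M.Hsoft lam q y ≤ M.H0 q y := by
  obtain ⟨δ, hδ⟩ := optimalQuotes_nonempty M q y
  constructor
  · rw [M.H0_eq q y hδ]
    refine hD (M.H q y) B δ lam hlam hlam1 hδ.1 (aestronglyMeasurable_H M q y) hB ?_
    intro e δ' hδ' he
    linarith [(abs_le.1 (hlip δ' hδ' δ hδ.1 e he)).1]
  · have h := lse_le_add (M := M) (f := M.H q y) (g := fun _ => M.H0 q y) (c := 0)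
      (B := max B |M.H0 q y|) hlam (aestronglyMeasurable_H M q y)
      (fun δ hδ => (hB δ hδ).trans (le_max_left _ _)) aestronglyMeasurable_const
      (fun δ _ => le_max_right _ _) (fun δ hδ => by simpa using M.H_le_H0 q y hδ)
    rw [lse_const hlam.ne', add_zero] at h
    exact h

/-- The Bellman operator differs from the soft Euler step by the one-step error of the score. -/
theorem abs_bellman_sub_le {p : Params} {M : Market p} {Ω : Type*} [MeasurableSpace Ω]
    {P : Measure Ω} (B : Noise Ω P) {q : Inv p.Q} {φ : Inv p.Q → ℝ} {h lam c b : ℝ} (hh : 0 < h)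
    (hlam : 0 < lam) (hb : ∀ δ ∈ p.A, |M.H q φ δ| ≤ b)
    (hc : ∀ δ ∈ p.A, |score M B δ q h φ - φ q - h * M.H q φ δ| ≤ c) :
    |bellman M B h lam φ q - φ q - h * M.Hsoft lam q φ| ≤ c := by
  have hl : 0 < h * lam := by positivity
  have hsm : AEStronglyMeasurable (fun δ => score M B δ q h φ) M.ν :=
    aestronglyMeasurable_score M B q h φ M.ν_absolutelyContinuous
  have hHm : AEStronglyMeasurable (fun δ => h * M.H q φ δ) M.ν :=
    (aestronglyMeasurable_H M q φ).const_mul h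
  have hc0 : 0 ≤ c := (abs_nonneg _).trans (hc _ p.A_nonempty.some_mem)
  have hHb : ∀ δ ∈ p.A, |h * M.H q φ δ| ≤ h * b + |φ q| + c := fun δ hδ => by
    rw [abs_mul, abs_of_pos hh]
    have := mul_le_mul_of_nonneg_left (hb δ hδ) hh.le
    linarith [abs_nonneg (φ q)]
  have hsb : ∀ δ ∈ p.A, |score M B δ q h φ| ≤ h * b + |φ q| + c := fun δ hδ => by
    have h1 := abs_le.1 (hc δ hδ)
    have h2 := abs_le.1 (hb δ hδ)
    have h3 := mul_le_mul_of_nonneg_left h2.1 hh.le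
    have h4 := mul_le_mul_of_nonneg_left h2.2 hh.le
    have h5 := le_abs_self (φ q)
    have h6 := neg_abs_le (φ q)
    exact abs_le.2 ⟨by linarith, by linarith⟩
  have e1 := lse_le_add (c := φ q + c) hl hsm hsb hHm hHb fun δ hδ => by
    linarith [(abs_le.1 (hc δ hδ)).2]
  have e2 := lse_le_add (c := -φ q + c) hl hHm hHb hsm hsb fun δ hδ => by
    linarith [(abs_le.1 (hc δ hδ)).1]
  have e3 : M.lse (h * lam) (fun δ => h * M.H q φ δ) = h * M.Hsoft lam q φ := by
    simp only [Market.lse, Market.Hsoft, mul_div_mul_left _ _ hh.ne', mul_assoc]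
  have e4 : M.lse (h * lam) (fun δ => score M B δ q h φ) = bellman M B h lam φ q := rfl
  rw [e3, e4] at e1 e2
  exact abs_le.2 ⟨by linarith, by linarith⟩

/-- For both policies, the mean optimality gap, measured with the Hamiltonian at the hard value, is
of the order of the rate. -/
theorem exists_integral_gap_le (p : Params) : ∃ C ≥ 0, ∃ h₀ > 0, ∃ lam₀ > 0,
    ∀ (M : Market p) (Ω : Type*) [MeasurableSpace Ω] (P : Measure Ω) (B : Noise Ω P)
      (v : ℝ → Inv p.Q → ℝ), M.IsHardValue v →
    ∀ (N : ℕ) (lam : ℝ), 0 < N → step p N ≤ h₀ → 0 < lam → lam ≤ lam₀ →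
    ∀ π : ℕ → Inv p.Q → Measure Quote, (π = exactGibbs M B N lam ∨ π = hamGibbs M N lam) →
    ∀ n < N, ∀ t ∈ Ico (n * step p N) ((n + 1) * step p N), ∀ q : Inv p.Q,
      IsProbabilityMeasure (π n q) ∧ π n q ≪ M.ν ∧
        ∫ δ, (M.H0 q (v t) - M.H q (v t) δ) ∂(π n q) ≤ C * rate (step p N) lam := by
  have hT := p.T_pos
  obtain ⟨R, hR0, hR⟩ := exists_hardValue_bound p
  obtain ⟨C, hC0, hC⟩ := exists_H_bounds p (R + 1)
  obtain ⟨D, hD0, hD⟩ := exists_laplace p C hC0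
  obtain ⟨E, hE0, h₁, hh₁, hE⟩ := exists_abs_score_sub_le p (R + 1)
  -- `G * rate` bounds the distance of the discrete values to the hard value; the step and the
  -- temperature are taken so small that it stays below `1`
  set G := p.T * (E + D + C ^ 2) * Real.exp (C * p.T) with hG
  have hG0 : 0 ≤ G := by positivity
  obtain ⟨h₂, hh₂, lam₀, hlam₀, hlam₀1, hrate⟩ :=
    exists_pos_rate_le (η := 1 / (G + 1)) (by positivity)
  refine ⟨2 * (E + C * (G + C)) + D, by positivity, min h₁ h₂, lt_min hh₁ hh₂, lam₀, hlam₀, ?_⟩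
  intro M Ω _ P B v hv N lam hN hstep hlam hlamle π hπ n hn t ht q
  set h := step p N with hh_def
  have hh : 0 < h := step_pos hN
  have hhN : N * h = p.T := mul_step hN
  have hlam1 : lam ≤ 1 := hlamle.trans hlam₀1
  set ℓ := lam * (1 + |Real.log lam|) with hℓ
  have hℓ0 : 0 ≤ ℓ := by positivity
  have hrt : rate h lam = h + ℓ := rfl
  have hrt0 : 0 ≤ rate h lam := rate_nonneg hh.le hlam.le
  have hGrate : G * rate h lam ≤ 1 := by
    have h1 := hrate h lam (hstep.trans (min_le_right _ _)) hlam hlamle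
    calc G * rate h lam ≤ G * (1 / (G + 1)) := by gcongr
      _ ≤ 1 := by rw [mul_one_div, div_le_one (by positivity)]; linarith
  have hvR : ∀ t ∈ Icc 0 p.T, ∀ q, |v t q| ≤ R + 1 := fun t ht q =>
    (hR M v hv t ht q).trans (by linarith)
  have hHbd : ∀ q y, (∀ r, |y r| ≤ R + 1) → ∀ δ ∈ p.A, |M.H q y δ| ≤ C := fun q y hy δ hδ =>
    (hC M q y y δ δ 0 0 hy hy (by simp) hδ hδ (by simp)).1
  have hHy : ∀ q y y' s, (∀ r, |y r| ≤ R + 1) → (∀ r, |y' r| ≤ R + 1) →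
      (∀ r, |y r - y' r| ≤ s) → ∀ δ ∈ p.A, |M.H q y δ - M.H q y' δ| ≤ C * s :=
    fun q y y' s hy hy' hs δ hδ => by
      simpa using (hC M q y y' δ δ s 0 hy hy' hs hδ hδ (by simp)).2
  have hHδ : ∀ q y, (∀ r, |y r| ≤ R + 1) → ∀ δ ∈ p.A, ∀ δ' ∈ p.A, ∀ e,
      (∀ i, |δ i - δ' i| ≤ e) → |M.H q y δ - M.H q y δ'| ≤ C * e :=
    fun q y hy δ hδ δ' hδ' e he => by
      simpa using (hC M q y y δ δ' 0 e hy hy (by simp) hδ hδ' he).2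
  have hH0b : ∀ q y, (∀ r, |y r| ≤ R + 1) → |M.H0 q y| ≤ C := fun q y hy => by
    obtain ⟨δ, hδ⟩ := optimalQuotes_nonempty M q y
    rw [M.H0_eq q y hδ]
    exact hHbd q y hy δ hδ.1
  have hH0L : ∀ q y y' s, (∀ r, |y r| ≤ R + 1) → (∀ r, |y' r| ≤ R + 1) →
      (∀ r, |y r - y' r| ≤ s) → |M.H0 q y - M.H0 q y'| ≤ C * s :=
    fun q y y' s hy hy' hs => abs_H0_sub_le (hHy q y y' s hy hy' hs)
  have hsoft : ∀ q y, (∀ r, |y r| ≤ R + 1) →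
      M.H0 q y - D * ℓ ≤ M.Hsoft lam q y ∧ M.Hsoft lam q y ≤ M.H0 q y := fun q y hy =>
    H0_sub_le_Hsoft_and_Hsoft_le hlam hlam1 (hHbd q y hy) (hHδ q y hy) (hD M)
  have hscore : ∀ q φ, (∀ r, |φ r| ≤ R + 1) → ∀ δ ∈ p.A,
      |score M B δ q h φ - φ q - h * M.H q φ δ| ≤ E * h ^ 2 := fun q φ hφ δ hδ =>
    hE M Ω P B δ hδ q φ h hφ hh.le (hstep.trans (min_le_left _ _))
  -- both one-step maps are consistent with the hard Hamiltonian
  set ε := E * h + D * ℓ with hε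
  have hε0 : 0 ≤ ε := by positivity
  have hSe : ∀ y q, (∀ r, |y r| ≤ R + 1) →
      |(fun (y : Inv p.Q → ℝ) q => y q + step p N * M.Hsoft lam q y) y q - y q - h * M.H0 q y|
        ≤ h * ε := fun y q hy => by
    obtain ⟨s1, s2⟩ := hsoft q y hy
    have s3 := mul_le_mul_of_nonneg_left s1 hh.le
    have s4 := mul_le_mul_of_nonneg_left s2 hh.le
    have s5 : 0 ≤ h * (E * h) := by positivity
    have s6 : 0 ≤ h * (D * ℓ) := by positivity
    rw [← hh_def]
    exact abs_le.2 ⟨by linarith, by linarith⟩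
  have hSb : ∀ y q, (∀ r, |y r| ≤ R + 1) →
      |bellman M B (step p N) lam y q - y q - h * M.H0 q y| ≤ h * ε := fun y q hy => by
    obtain ⟨s1, s2⟩ := hsoft q y hy
    have s3 := mul_le_mul_of_nonneg_left s1 hh.le
    have s4 := mul_le_mul_of_nonneg_left s2 hh.le
    have s5 := abs_le.1 (abs_bellman_sub_le B hh hlam (hHbd q y hy) (hscore q y hy))
    have s6 : 0 ≤ h * (D * ℓ) := by positivity
    rw [← hh_def]
    exact abs_le.2 ⟨by linarith, by linarith⟩
  have hεr : ε + C ^ 2 * h ≤ (E + D + C ^ 2) * rate h lam := by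
    rw [hrt, hε]
    have : 0 ≤ E * ℓ + D * h + C ^ 2 * ℓ := by positivity
    linarith
  have hsmall : p.T * (ε + C ^ 2 * h) * Real.exp (C * p.T) ≤ G * rate h lam := by
    calc p.T * (ε + C ^ 2 * h) * Real.exp (C * p.T)
        ≤ p.T * ((E + D + C ^ 2) * rate h lam) * Real.exp (C * p.T) := by gcongr
      _ = G * rate h lam := by rw [hG]; ring
  have hn1 : ((n + 1 : ℕ) : ℝ) ≤ N := by exact_mod_cast hn
  have hcast : ((N - (n + 1) : ℕ) : ℝ) = N - (n + 1) := by
    rw [Nat.cast_sub hn]; push_cast; ring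
  have hkT : ((N - (n + 1) : ℕ) : ℝ) * h ≤ p.T := by
    rw [hcast, ← hhN]
    have : (0 : ℝ) ≤ n := n.cast_nonneg
    nlinarith
  have htime : p.T - ((N - (n + 1) : ℕ) : ℝ) * h = (n + 1) * h := by
    rw [hcast, ← hhN]; ring
  have hconv : ∀ S : (Inv p.Q → ℝ) → Inv p.Q → ℝ,
      (∀ y q, (∀ r, |y r| ≤ R + 1) → |S y q - y q - h * M.H0 q y| ≤ h * ε) → ∀ r,
        |S^[N - (n + 1)] M.terminal r - v ((n + 1) * h) r| ≤ G * rate h lam := by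
    intro S hS r
    have h1 := abs_iterate_sub_le hv hC0 hε0 hh (hR M v hv) hH0b hH0L hS (hsmall.trans hGrate)
      (N - (n + 1)) hkT r
    rw [htime] at h1
    refine h1.trans (le_trans ?_ hsmall)
    gcongr
  have ht1 : ((n : ℝ) + 1) * h ≤ p.T := by
    rw [← hhN]; push_cast at hn1; gcongr
  have htm : ((n : ℝ) + 1) * h ∈ Icc 0 p.T := ⟨by positivity, ht1⟩
  have htI : t ∈ Icc 0 p.T := ⟨le_trans (by positivity) ht.1, ht.2.le.trans ht1⟩
  have htd : |(n + 1) * h - t| ≤ h :=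
    abs_le.2 ⟨by linarith [ht.2], by linarith [ht.1]⟩
  -- the discrete value at the next grid point is close to the hard value at time `t`
  have hclose : ∀ w : Inv p.Q → ℝ, (∀ r, |w r - v ((n + 1) * h) r| ≤ G * rate h lam) →
      (∀ r, |w r| ≤ R + 1) ∧ ∀ r, |w r - v t r| ≤ (G + C) * rate h lam := by
    intro w hw
    refine ⟨fun r => ?_, fun r => ?_⟩
    · have h1 := abs_le.1 ((hw r).trans hGrate)
      have h2 := abs_le.1 (hR M v hv _ htm r)
      exact abs_le.2 ⟨by linarith, by linarith⟩
    · have h1 := abs_le.1 (hw r)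
      have h2 := (hv.abs_sub_le (fun t ht q => hH0b q _ (hvR t ht)) htI htm r).trans
        (mul_le_mul_of_nonneg_left htd hC0)
      have h3 := abs_le.1 h2
      have h4 : C * h ≤ C * rate h lam := by rw [hrt]; gcongr; linarith
      exact abs_le.2 ⟨by linarith, by linarith⟩
  have hGgap : M.H0 q (v t) - D * ℓ ≤ M.lse lam (M.H q (v t)) := (hsoft q _ (hvR t htI)).1
  have hac : ∀ f : Quote → ℝ, M.ν.tilted f ≪ M.ν := fun f => tilted_absolutelyContinuous _ _
  -- the gap under the Gibbs measure of any function that is close, up to a constant, to the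
  -- Hamiltonian at the hard value
  have hfinal : ∀ f : Quote → ℝ, ∀ c, AEStronglyMeasurable f M.ν →
      (∀ δ ∈ p.A, |f δ - c - M.H q (v t) δ| ≤ (E + C * (G + C)) * rate h lam) →
      IsProbabilityMeasure (M.ν.tilted fun δ => f δ / lam) ∧
      (M.ν.tilted fun δ => f δ / lam) ≪ M.ν ∧
      ∫ δ, (M.H0 q (v t) - M.H q (v t) δ) ∂(M.ν.tilted fun δ => f δ / lam) ≤
        (2 * (E + C * (G + C)) + D) * rate h lam := by
    intro f c hf hfc
    obtain ⟨r1, r2⟩ := integral_gap_le hlam hf (aestronglyMeasurable_H M q (v t))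
      (hHbd q _ (hvR t htI)) hfc hGgap
    refine ⟨r1, hac _, r2.trans ?_⟩
    have : D * ℓ ≤ D * rate h lam := by rw [hrt]; gcongr; linarith
    linarith
  have hEr : 0 ≤ E * rate h lam := by positivity
  rcases hπ with rfl | rfl
  · obtain ⟨hwR, hwt⟩ := hclose _ (hconv _ hSb)
    have hr := hfinal (fun δ => score M B δ q h (exactValue M B N lam (n + 1)) / h)
      (exactValue M B N lam (n + 1) q / h) ?_ ?_
    · have hrw : exactGibbs M B N lam n q = M.ν.tilted fun δ =>
          score M B δ q h (exactValue M B N lam (n + 1)) / h / lam := by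
        simp only [exactGibbs, div_div, hh_def]
      rw [hrw]
      exact hr
    · simp only [div_eq_mul_inv]
      exact (aestronglyMeasurable_score M B q h _ M.ν_absolutelyContinuous).mul_const _
    · intro δ hδ
      have b1 := hscore q (exactValue M B N lam (n + 1)) hwR δ hδ
      have b2 := abs_le.1 (hHy q (exactValue M B N lam (n + 1)) (v t) _ hwR (hvR t htI) hwt δ hδ)
      have b3 : |score M B δ q h (exactValue M B N lam (n + 1)) / h
          - exactValue M B N lam (n + 1) q / h - M.H q (exactValue M B N lam (n + 1)) δ|
          ≤ E * h := by
        rw [show score M B δ q h (exactValue M B N lam (n + 1)) / h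
          - exactValue M B N lam (n + 1) q / h - M.H q (exactValue M B N lam (n + 1)) δ =
          (score M B δ q h (exactValue M B N lam (n + 1)) - exactValue M B N lam (n + 1) q
            - h * M.H q (exactValue M B N lam (n + 1)) δ) / h by field_simp,
          abs_div, abs_of_pos hh, div_le_iff₀ hh]
        linarith
      have b4 := abs_le.1 b3
      have b5 : E * h ≤ E * rate h lam := by rw [hrt]; gcongr; linarith
      exact abs_le.2 ⟨by linarith, by linarith⟩
  · obtain ⟨hwR, hwt⟩ := hclose _ (hconv _ hSe)
    refine hfinal (M.H q (eulerValue M N lam (n + 1))) 0 (aestronglyMeasurable_H M q _) ?_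
    intro δ hδ
    have b2 := hHy q (eulerValue M N lam (n + 1)) (v t) _ hwR (hvR t htI) hwt δ hδ
    rw [sub_zero]
    linarith

/-! ### Active distances, mean quotes and selectors -/

/-- The active projection as a continuous linear map. -/
def activeProjL {Q : ℕ} (q : Inv Q) : Quote →L[ℝ] Quote :=
  LinearMap.toContinuousLinearMap
    { toFun := activeProj q
      map_add' := fun x y => by
        ext i
        fin_cases i <;> simp [activeProj] <;> split_ifs <;> simp
      map_smul' := fun c x => by
        ext i
        fin_cases i <;> simp [activeProj] }

theorem activeProj_sub {Q : ℕ} (q : Inv Q) (x y : Quote) :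
    activeProj q (x - y) = activeProj q x - activeProj q y := (activeProjL q).map_sub x y

theorem activeDist_eq_infDist {Q : ℕ} (q : Inv Q) (δ : Quote) (S : Set Quote) :
    activeDist q δ S = Metric.infDist (activeProj q δ) (activeProj q '' S) := by
  rw [Metric.infDist_eq_iInf, ← sInf_image' (s := activeProj q '' S), image_image]
  simp only [activeDist, activeProj_sub, dist_eq_norm]

theorem continuous_activeDist {Q : ℕ} (q : Inv Q) (S : Set Quote) :
    Continuous fun δ => activeDist q δ S := by
  simp only [activeDist_eq_infDist]
  exact (Metric.continuous_infDist_pt _).comp (activeProjL q).continuous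

/-- If the active optimizer is unique, the active distance is the distance to it. -/
theorem activeDist_eq_norm {p : Params} {M : Market p} {q : Inv p.Q} {y : Inv p.Q → ℝ}
    (hu : UniqueActiveOptimizer M q y) {δ' : Quote} (hδ' : δ' ∈ optimalQuotes M q y) (δ : Quote) :
    activeDist q δ (optimalQuotes M q y) = ‖activeProj q (δ - δ')‖ := by
  have himg : activeProj q '' optimalQuotes M q y = {activeProj q δ'} :=
    subset_antisymm (fun ξ hξ => hu.unique hξ (mem_image_of_mem _ hδ'))
      (singleton_subset_iff.2 (mem_image_of_mem _ hδ'))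
  rw [activeDist_eq_infDist, himg, Metric.infDist_singleton, dist_eq_norm, activeProj_sub]

theorem integrable_of_continuous_of_ac {p : Params} {M : Market p} {ρ : Measure Quote}
    [IsFiniteMeasure ρ] (hρ : ρ ≪ M.ν) {E : Type*} [NormedAddCommGroup E]
    {f : Quote → E} (hf : Continuous f) : Integrable f ρ := by
  obtain ⟨B, hB⟩ := p.isCompact_A.exists_bound_of_continuousOn hf.continuousOn
  exact Integrable.of_bound hf.aestronglyMeasurable B ((ae_mem_A_of_ac M hρ).mono hB)

/-- Jensen's inequality for the mean quote. -/
theorem norm_activeProj_integral_sub_sq_le {p : Params} {M : Market p} {ρ : Measure Quote}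
    [IsProbabilityMeasure ρ] (hρ : ρ ≪ M.ν) (q : Inv p.Q) (δ' : Quote) :
    ‖activeProj q (∫ δ, δ ∂ρ - δ')‖ ^ 2 ≤ ∫ δ, ‖activeProj q (δ - δ')‖ ^ 2 ∂ρ := by
  have hid : Integrable (fun δ : Quote => δ) ρ := integrable_of_continuous_of_ac hρ continuous_id
  have hPc : Continuous fun δ => activeProj q (δ - δ') :=
    (activeProjL q).continuous.comp (continuous_id.sub continuous_const)
  have h1 : activeProj q (∫ δ, δ ∂ρ - δ') = ∫ δ, activeProj q (δ - δ') ∂ρ := by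
    have h2 : ∫ δ, δ ∂ρ - δ' = ∫ δ, (δ - δ') ∂ρ := by
      rw [integral_sub hid (integrable_const _), integral_const, probReal_univ, one_smul]
    rw [h2]
    exact ((activeProjL q).integral_comp_comm (hid.sub (integrable_const _))).symm
  rw [h1]
  calc ‖∫ δ, activeProj q (δ - δ') ∂ρ‖ ^ 2 ≤ (∫ δ, ‖activeProj q (δ - δ')‖ ∂ρ) ^ 2 := by
        gcongr
        exact norm_integral_le_integral_norm _
    _ ≤ ∫ δ, ‖activeProj q (δ - δ')‖ ^ 2 ∂ρ :=
        (even_two.convexOn_pow (𝕜 := ℝ)).map_integral_le (continuous_pow 2).continuousOn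
          isClosed_univ (Filter.Eventually.of_forall fun _ => mem_univ _)
          (integrable_of_continuous_of_ac hρ hPc.norm)
          (integrable_of_continuous_of_ac hρ (hPc.norm.pow 2))

/-- The Hamiltonian does not depend on inactive coordinates. -/
theorem Market.H_congr {p : Params} (M : Market p) {q : Inv p.Q} (y : Inv p.Q → ℝ)
    {δ δ' : Quote} (h0 : q.AskActive → δ 0 = δ' 0) (h1 : q.BidActive → δ 1 = δ' 1) :
    M.H q y δ = M.H q y δ' := by
  unfold Market.H Market.askRate Market.bidRate Market.askIncr Market.bidIncr
  by_cases hA : q.AskActive <;> by_cases hB : q.BidActive <;> simp [hA, hB, h0, h1]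

/-- Replacing the inactive coordinates by `lo`. -/
def normalizeQuote (p : Params) (q : Inv p.Q) (δ : Quote) : Quote :=
  activeProj q δ + !₂[if q.AskActive then 0 else p.lo, if q.BidActive then 0 else p.lo]

theorem normalizeQuote_zero (p : Params) (q : Inv p.Q) (δ : Quote) :
    normalizeQuote p q δ 0 = if q.AskActive then δ 0 else p.lo := by
  simp only [normalizeQuote, activeProj, PiLp.add_apply]
  split_ifs <;> simp

theorem normalizeQuote_one (p : Params) (q : Inv p.Q) (δ : Quote) :
    normalizeQuote p q δ 1 = if q.BidActive then δ 1 else p.lo := by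
  simp only [normalizeQuote, activeProj, PiLp.add_apply]
  split_ifs <;> simp

/-- Normalizing the inactive coordinates preserves optimality. -/
theorem normalizeQuote_mem {p : Params} {M : Market p} {q : Inv p.Q} {y : Inv p.Q → ℝ}
    {δ : Quote} (hδ : δ ∈ optimalQuotes M q y) : normalizeQuote p q δ ∈ optimalQuotes M q y := by
  have hlo : p.lo ∈ Icc p.lo p.hi := ⟨le_rfl, p.lo_lt_hi.le⟩
  refine ⟨Params.mem_A.2 fun i => ?_, isMaxOn_iff.2 fun δ' hδ' => ?_⟩
  · fin_cases i
    · change normalizeQuote p q δ 0 ∈ _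
      rw [normalizeQuote_zero]
      split_ifs
      exacts [Params.mem_A.1 hδ.1 0, hlo]
    · change normalizeQuote p q δ 1 ∈ _
      rw [normalizeQuote_one]
      split_ifs
      exacts [Params.mem_A.1 hδ.1 1, hlo]
  · rw [M.H_congr y (δ := normalizeQuote p q δ) (δ' := δ)
      (fun h => by rw [normalizeQuote_zero, if_pos h])
      (fun h => by rw [normalizeQuote_one, if_pos h])]
    exact isMaxOn_iff.1 hδ.2 δ' hδ'

/-- Quadratic growth makes the unique active optimizer Hölder continuous of order `1 / 2` in time,
because the Hamiltonian is Lipschitz in time along the hard value. -/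
theorem continuous_activeProj_selector {p : Params} {M : Market p} {v : ℝ → Inv p.Q → ℝ}
    (hv : M.IsHardValue v) {μ : ℝ} (hμ : 0 < μ) (hg : QuadraticGrowth M v μ) {q : Inv p.Q}
    (hu : ∀ t ∈ Icc 0 p.T, UniqueActiveOptimizer M q (v t)) {f : Icc 0 p.T → Quote}
    (hf : ∀ t : Icc 0 p.T, f t ∈ optimalQuotes M q (v t)) :
    Continuous fun t => activeProj q (f t) := by
  obtain ⟨R, hR0, hR⟩ := exists_hardValue_bound p
  obtain ⟨C, hC0, hC⟩ := exists_H_bounds p R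
  have hHb : ∀ t ∈ Icc 0 p.T, ∀ r, |M.H0 r (v t)| ≤ C := fun t ht r => by
    obtain ⟨δ, hδ⟩ := optimalQuotes_nonempty M r (v t)
    rw [M.H0_eq r _ hδ]
    exact (hC M r (v t) (v t) δ δ 0 0 (hR M v hv t ht) (hR M v hv t ht) (by simp) hδ.1 hδ.1
      (by simp)).1
  have hHt : ∀ s t : Icc 0 p.T, ∀ δ ∈ p.A,
      |M.H q (v t) δ - M.H q (v s) δ| ≤ C * (C * dist t s) := fun s t δ hδ => by
    simpa using (hC M q (v t) (v s) δ δ (C * dist t s) 0 (hR M v hv t t.2) (hR M v hv s s.2)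
      (fun r => hv.abs_sub_le hHb s.2 t.2 r) hδ hδ (by simp)).2
  have hkey : ∀ s t : Icc 0 p.T, dist (activeProj q (f s)) (activeProj q (f t)) ^ 2 ≤
      4 * C ^ 2 / μ * dist s t := fun s t => by
    have h1 := hg t t.2 q (f s) (hf s).1
    rw [activeDist_eq_norm (hu t t.2) (hf t), activeProj_sub, ← dist_eq_norm,
      M.H0_eq q _ (hf t)] at h1
    have h2 := abs_le.1 (hHt s t (f t) (hf t).1)
    have h3 := abs_le.1 (hHt s t (f s) (hf s).1)
    have h4 := isMaxOn_iff.1 (hf s).2 (f t) (hf t).1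
    rw [dist_comm t s] at h2 h3
    rw [div_mul_eq_mul_div, le_div_iff₀ hμ]
    linarith
  refine Metric.continuous_iff.2 fun s ε hε => ?_
  have hc : 0 < 4 * C ^ 2 / μ + 1 := by positivity
  refine ⟨ε ^ 2 / (4 * C ^ 2 / μ + 1), by positivity, fun t ht => ?_⟩
  rw [lt_div_iff₀ hc] at ht
  have h1 := hkey t s
  have h2 : 0 ≤ dist t s := dist_nonneg
  exact lt_of_pow_lt_pow_left₀ 2 hε.le (by linarith)

theorem exists_measurable_selector {p : Params} {M : Market p} {v : ℝ → Inv p.Q → ℝ}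
    (hv : M.IsHardValue v) {μ : ℝ} (hμ : 0 < μ) (hg : QuadraticGrowth M v μ)
    (hu : ∀ t ∈ Icc 0 p.T, ∀ q : Inv p.Q, UniqueActiveOptimizer M q (v t)) :
    ∃ δopt : Icc 0 p.T → Inv p.Q → Quote, ∀ q, Measurable (fun t => δopt t q) ∧
      ∀ t : Icc 0 p.T, δopt t q ∈ optimalQuotes M q (v t) ∧
        (¬ q.AskActive → δopt t q 0 = p.lo) ∧ (¬ q.BidActive → δopt t q 1 = p.lo) := by
  choose f hf using fun (t : Icc 0 p.T) (q : Inv p.Q) => optimalQuotes_nonempty M q (v t)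
  refine ⟨fun t q => normalizeQuote p q (f t q), fun q => ⟨?_, fun t =>
    ⟨normalizeQuote_mem (hf t q), fun h => ?_, fun h => ?_⟩⟩⟩
  · exact ((continuous_activeProj_selector hv hμ hg (fun t ht => hu t ht q)
      fun t => hf t q).add continuous_const).measurable
  · rw [normalizeQuote_zero, if_neg h]
  · rw [normalizeQuote_one, if_neg h]

/-- Integration in time of a pointwise bound on the intervals of the grid. -/
theorem intervalIntegrable_and_integral_le {p : Params} {N : ℕ} (hN : 0 < N)
    {π : ℕ → Inv p.Q → Measure Quote} {q : Inv p.Q} {δopt : ℝ → Quote} {c : ℝ}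
    (hδ : ContinuousOn (fun t => activeProj q (δopt t)) (Icc 0 p.T))
    (hc : ∀ n < N, ∀ t ∈ Ico (n * step p N) ((n + 1) * step p N),
      ‖activeProj q (meanQuote π n q - δopt t)‖ ^ 2 ≤ c) :
    IntervalIntegrable (fun t => ‖activeProj q (meanQuotePath p N π t q - δopt t)‖ ^ 2)
        volume 0 p.T ∧
      ∫ t in (0 : ℝ)..p.T, ‖activeProj q (meanQuotePath p N π t q - δopt t)‖ ^ 2 ≤ c * p.T := by
  have hT := p.T_pos
  have hh := step_pos (p := p) hN
  have hhN := mul_step (p := p) hN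
  have hbound : ∀ t ∈ Ico 0 p.T,
      ‖‖activeProj q (meanQuotePath p N π t q - δopt t)‖ ^ 2‖ ≤ c := fun t ht => by
    rw [Real.norm_of_nonneg (by positivity)]
    have hdiv : 0 ≤ t / step p N := div_nonneg ht.1 hh.le
    refine hc ⌊t / step p N⌋₊ ?_ t ⟨?_, ?_⟩
    · rw [Nat.floor_lt hdiv, div_lt_iff₀ hh, hhN]
      exact ht.2
    · exact (le_div_iff₀ hh).1 (Nat.floor_le hdiv)
    · exact (div_lt_iff₀ hh).1 (Nat.lt_floor_add_one _)
  have hmeas : AEStronglyMeasurable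
      (fun t => ‖activeProj q (meanQuotePath p N π t q - δopt t)‖ ^ 2)
      (volume.restrict (Ico 0 p.T)) := by
    simp only [activeProj_sub]
    refine AEStronglyMeasurable.pow (AEStronglyMeasurable.norm (AEStronglyMeasurable.sub ?_ ?_)) 2
    · have : Measurable fun t : ℝ => activeProj q (meanQuotePath p N π t q) :=
        (measurable_of_countable fun n : ℕ => activeProj q (meanQuote π n q)).comp
          (Nat.measurable_floor.comp (measurable_id.div_const (step p N)))
      exact this.aestronglyMeasurable
    · exact (hδ.mono Ico_subset_Icc_self).aestronglyMeasurable measurableSet_Ico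
  have hint : IntegrableOn (fun t => ‖activeProj q (meanQuotePath p N π t q - δopt t)‖ ^ 2)
      (Ico 0 p.T) :=
    IntegrableOn.of_bound (by simp) hmeas c
      ((ae_restrict_iff' measurableSet_Ico).2 (Filter.Eventually.of_forall hbound))
  refine ⟨(intervalIntegrable_iff_integrableOn_Ico_of_le hT.le).2 hint, ?_⟩
  rw [intervalIntegral.integral_of_le hT.le, ← integral_Ico_eq_integral_Ioc]
  have h1 := norm_setIntegral_le_of_norm_le_const (μ := volume) (s := Ico 0 p.T) (by simp) hbound
  rw [Real.volume_real_Ico_of_le hT.le, sub_zero] at h1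
  exact (Real.le_norm_self _).trans h1

end

end MarketMaking

open MarketMaking in
theorem mainTheorem4 (p : Params) (μ : ℝ) (hμ : 0 < μ) :
    ∃ C > 0, ∃ h₀ > 0, ∃ lam₀ > 0,
      ∀ (M : Market p) (Ω : Type*) [MeasurableSpace Ω] (P : Measure Ω) (B : Noise Ω P)
        (v : ℝ → Inv p.Q → ℝ), M.IsHardValue v → QuadraticGrowth M v μ →
      -- concentration and the mean-quote bound, for both policies
      (∀ (N : ℕ) (lam : ℝ), 0 < N → step p N ≤ h₀ → 0 < lam → lam ≤ lam₀ →
        ∀ π : ℕ → Inv p.Q → Measure Quote,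
          (π = exactGibbs M B N lam ∨ π = hamGibbs M N lam) →
        ∀ n < N, ∀ t ∈ Ico (n * step p N) ((n + 1) * step p N), ∀ q : Inv p.Q,
          IsProbabilityMeasure (π n q) ∧
          Integrable (fun δ => activeDist q δ (optimalQuotes M q (v t)) ^ 2) (π n q) ∧
          ∫ δ, activeDist q δ (optimalQuotes M q (v t)) ^ 2 ∂(π n q) ≤ C * rate (step p N) lam ∧
          (UniqueActiveOptimizer M q (v t) →
            ∀ δopt ∈ optimalQuotes M q (v t),
              ‖activeProj q (meanQuote π n q - δopt)‖ ^ 2 ≤ C * rate (step p N) lam)) ∧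
      -- the selector and the integrated bound, if the active optimizer is always unique
      ((∀ t ∈ Icc 0 p.T, ∀ q : Inv p.Q, UniqueActiveOptimizer M q (v t)) →
        (∃ δopt : Icc 0 p.T → Inv p.Q → Quote,
          ∀ q, Measurable (fun t => δopt t q) ∧
            ∀ t : Icc 0 p.T, δopt t q ∈ optimalQuotes M q (v t) ∧
              (¬ q.AskActive → δopt t q 0 = p.lo) ∧ (¬ q.BidActive → δopt t q 1 = p.lo)) ∧
        ∀ δopt : ℝ → Inv p.Q → Quote,
          (∀ t ∈ Icc 0 p.T, ∀ q, δopt t q ∈ optimalQuotes M q (v t)) →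
          (∀ q, Measurable (fun t : Icc 0 p.T => activeProj q (δopt t q))) ∧
          ∀ (N : ℕ) (lam : ℝ), 0 < N → step p N ≤ h₀ → 0 < lam → lam ≤ lam₀ →
            ∀ π : ℕ → Inv p.Q → Measure Quote,
              (π = exactGibbs M B N lam ∨ π = hamGibbs M N lam) →
            (∀ q, IntervalIntegrable
              (fun t => ‖activeProj q (meanQuotePath p N π t q - δopt t q)‖ ^ 2) volume 0 p.T) ∧
            ∑ q : Inv p.Q,
              ∫ t in (0 : ℝ)..p.T, ‖activeProj q (meanQuotePath p N π t q - δopt t q)‖ ^ 2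
                ≤ C * rate (step p N) lam) := by
  obtain ⟨C, hC0, h₀, hh₀, lam₀, hlam₀, hgap⟩ := exists_integral_gap_le p
  have hT := p.T_pos
  -- the constant of the pointwise bounds; the second factor of the final constant is the total
  -- mass of time and inventories in the integrated bound
  set c := 2 / μ * C with hc
  have hc0 : 0 ≤ c := by positivity
  have hcard : 0 ≤ (Fintype.card (Inv p.Q) : ℝ) * p.T := by positivity
  refine ⟨(c + 1) * (1 + Fintype.card (Inv p.Q) * p.T), by positivity, h₀, hh₀, lam₀, hlam₀, ?_⟩
  intro M Ω _ P B v hv hg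
  have hpoint : ∀ (N : ℕ) (lam : ℝ), 0 < N → step p N ≤ h₀ → 0 < lam → lam ≤ lam₀ →
      ∀ π : ℕ → Inv p.Q → Measure Quote, (π = exactGibbs M B N lam ∨ π = hamGibbs M N lam) →
      ∀ n < N, ∀ t ∈ Ico (n * step p N) ((n + 1) * step p N), ∀ q : Inv p.Q,
        IsProbabilityMeasure (π n q) ∧
        Integrable (fun δ => activeDist q δ (optimalQuotes M q (v t)) ^ 2) (π n q) ∧
        ∫ δ, activeDist q δ (optimalQuotes M q (v t)) ^ 2 ∂(π n q) ≤ c * rate (step p N) lam ∧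
        (UniqueActiveOptimizer M q (v t) → ∀ δopt ∈ optimalQuotes M q (v t),
          ‖activeProj q (meanQuote π n q - δopt)‖ ^ 2 ≤ c * rate (step p N) lam) := by
    intro N lam hN hstep hlam hlamle π hπ n hn t ht q
    obtain ⟨hprob, hac, hle⟩ := hgap M Ω P B v hv N lam hN hstep hlam hlamle π hπ n hn t ht q
    have hh := step_pos (p := p) hN
    have htI : t ∈ Icc 0 p.T := by
      refine ⟨le_trans (by positivity) ht.1, ht.2.le.trans ?_⟩
      rw [← mul_step (p := p) hN]
      have : (n : ℝ) + 1 ≤ N := by exact_mod_cast hn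
      gcongr
    have hint : Integrable (fun δ => activeDist q δ (optimalQuotes M q (v t)) ^ 2) (π n q) :=
      integrable_of_continuous_of_ac hac ((continuous_activeDist q _).pow 2)
    have hbound : ∫ δ, activeDist q δ (optimalQuotes M q (v t)) ^ 2 ∂(π n q) ≤
        c * rate (step p N) lam := by
      have hHi : Integrable (M.H q (v t)) (π n q) := by
        obtain ⟨b, hb⟩ := p.isCompact_A.exists_bound_of_continuousOn (M.continuousOn_H q (v t))
        exact integrable_of_bound_of_ac hac ((aestronglyMeasurable_H M q (v t)).mono_ac hac) hb
      have h1 : ∫ δ, activeDist q δ (optimalQuotes M q (v t)) ^ 2 ∂(π n q) ≤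
          ∫ δ, 2 / μ * (M.H0 q (v t) - M.H q (v t) δ) ∂(π n q) := by
        refine integral_mono_ae hint (((integrable_const _).sub hHi).const_mul _) ?_
        filter_upwards [ae_mem_A_of_ac M hac] with δ hδ
        have h2 := hg t htI q δ hδ
        rw [div_mul_eq_mul_div, le_div_iff₀ hμ]
        linarith
      rw [integral_const_mul] at h1
      refine h1.trans ?_
      rw [hc, mul_assoc]
      exact mul_le_mul_of_nonneg_left hle (by positivity)
    refine ⟨hprob, hint, hbound, fun hu δopt hδopt => ?_⟩
    refine (norm_activeProj_integral_sub_sq_le hac q δopt).trans ?_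
    simpa only [activeDist_eq_norm hu hδopt] using hbound
  refine ⟨fun N lam hN hstep hlam hlamle π hπ n hn t ht q => ?_, fun hu => ⟨?_, ?_⟩⟩
  · obtain ⟨h1, h2, h3, h4⟩ := hpoint N lam hN hstep hlam hlamle π hπ n hn t ht q
    have hr := rate_nonneg (step_pos (p := p) hN).le hlam.le
    have hle : c * rate (step p N) lam ≤
        (c + 1) * (1 + Fintype.card (Inv p.Q) * p.T) * rate (step p N) lam := by
      gcongr
      nlinarith
    exact ⟨h1, h2, h3.trans hle, fun hu δopt hδ => (h4 hu δopt hδ).trans hle⟩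
  · exact exists_measurable_selector hv hμ hg hu
  · intro δopt hδopt
    have hcont : ∀ q, Continuous fun t : Icc 0 p.T => activeProj q (δopt t q) := fun q =>
      continuous_activeProj_selector hv hμ hg (fun t ht => hu t ht q) fun t => hδopt t t.2 q
    refine ⟨fun q => (hcont q).measurable, fun N lam hN hstep hlam hlamle π hπ => ?_⟩
    have hr := rate_nonneg (step_pos (p := p) hN).le hlam.le
    have hq := fun q : Inv p.Q => intervalIntegrable_and_integral_le (π := π) (q := q)
      (δopt := fun t => δopt t q) (c := c * rate (step p N) lam) hN
      (continuousOn_iff_continuous_domRestrict.2 (hcont q)) fun n hn t ht => by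
        have htI : t ∈ Icc 0 p.T := by
          have hh := step_pos (p := p) hN
          refine ⟨le_trans (by positivity) ht.1, ht.2.le.trans ?_⟩
          rw [← mul_step (p := p) hN]
          have : (n : ℝ) + 1 ≤ N := by exact_mod_cast hn
          gcongr
        exact (hpoint N lam hN hstep hlam hlamle π hπ n hn t ht q).2.2.2 (hu t htI q) _
          (hδopt t htI q)
    refine ⟨fun q => (hq q).1, (Finset.sum_le_sum fun q _ => (hq q).2).trans ?_⟩
    rw [Finset.sum_const, nsmul_eq_mul, Finset.card_univ]
    calc (Fintype.card (Inv p.Q) : ℝ) * (c * rate (step p N) lam * p.T)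
        = c * (Fintype.card (Inv p.Q) * p.T) * rate (step p N) lam := by ring
      _ ≤ (c + 1) * (1 + Fintype.card (Inv p.Q) * p.T) * rate (step p N) lam := by
          gcongr <;> linarith
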